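/- Let $n\ge 3$ and $p>0$, and give $\mathbb{R}^n$ the density $r^p$, $r=|x|$: the weighted volume of a measurable set is the integral of $r^p$ over it, its weighted perimeter is the integral of $r^p$ over its topological boundary with respect to $(n-1)$-dimensional Hausdorff measure, and a set (of finite weighted volume) is isoperimetric if it minimizes weighted perimeter among all measurable sets of the same weighted volume. Let $E\subset\mathbb{R}^n$ be an open isoperimetric region that is spherically symmetric about the positive $e_1$-axis, i.e. for every $r>0$ its intersection with the sphere $S_r$ of radius $r$ about the origin is empty or a spherical cap of $S_r$ centered at $(r,0,\dots,0)$ (possibly all of $S_r$). Let $A\subset\mathbb{R}^2$ be the section of $E$ by the $e_1e_2$-plane, so that $E$ is the rotation of $A$ about the $e_1$-axis. Let $\gamma=(\gamma_1,\gamma_2):[-\beta,\beta]\to\mathbb{R}^2$, $\beta>0$, be the generating curve: the counterclockwise arclength parameterization, with continuous unit tangent vector on $(-\beta,\beta)$, of the Jordan curve that starts at the rightmost point $\gamma(0)$ of $\partial A$, which lies on the $e_1$-axis, and follows $\partial A$ in both directions until it meets the $e_1$-axis again, at $\gamma(\beta)=\gamma(-\beta)$. Assume (by scaling) that $\gamma(0)=(1,0)$.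 For $s\neq 0$ let $F(s)$ be the abscissa of the center of the canonical circle $C_s$, the circle centered on the $e_1$-axis that is tangent to $\gamma$ at $\gamma(s)$, and let $F(0)=\lim_{s\to 0}F(s)$ be the abscissa of the center of $C_0=\lim_{s\to0}C_s$. If $F(0)>1/2$, then $\gamma_1(\beta)>0$, the limit $\lim_{s\to\beta^-}\gamma'(s)$ exists and lies in the (closed) fourth quadrant, and $\lim_{s\to\beta^-}\gamma'(s)\neq(0,-1)$. Consequently $\gamma(s)\cdot\gamma'(s)>0$ for all $s<\beta$ sufficiently close to $\beta$. This contradicts the tangent restriction $\gamma(s)\cdot\gamma'(s)\le 0$ for all $s\in(0,\beta)$, which holds by spherical symmetry (for any value of $F(0)$). -/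

import Mathlib

open Set Filter Topology MeasureTheory

noncomputable section

/-- The Euclidean plane containing the generating curve; coordinates `0` and `1` are the
`e₁`- and `e₂`-coordinates. -/
abbrev Plane : Type := EuclideanSpace ℝ (Fin 2)

/-- Weighted volume of a subset of `ℝⁿ` for the density `r ^ p`. -/
def weightedVolume (n : ℕ) (p : ℝ) (E : Set (EuclideanSpace ℝ (Fin n))) : ENNReal :=
  ∫⁻ x in E, ENNReal.ofReal (‖x‖ ^ p)

/-- Weighted perimeter for the density `r ^ p`: the integral of the density over the topological
boundary with respect to `(n-1)`-dimensional Hausdorff measure. (The normalization of Hausdorff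
measure is irrelevant, since perimeters are only compared with each other.) -/
def weightedPerimeter (n : ℕ) (p : ℝ) (E : Set (EuclideanSpace ℝ (Fin n))) : ENNReal :=
  ∫⁻ x in frontier E, ENNReal.ofReal (‖x‖ ^ p) ∂(Measure.hausdorffMeasure ((n : ℝ) - 1))

/-- `E` is an isoperimetric region for the density `r ^ p`: it is measurable, has finite weighted
volume, and minimizes weighted perimeter among all measurable sets of the same weighted volume. -/
structure IsIsoperimetric (n : ℕ) (p : ℝ) (E : Set (EuclideanSpace ℝ (Fin n))) : Prop where
  measurableSet : MeasurableSet E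
  volume_ne_top : weightedVolume n p E ≠ ⊤
  minimal : ∀ E' : Set (EuclideanSpace ℝ (Fin n)), MeasurableSet E' →
    weightedVolume n p E' = weightedVolume n p E →
    weightedPerimeter n p E ≤ weightedPerimeter n p E'

/-- `E` is spherically symmetric about the positive `e₁`-axis: with a point `x`, it contains every
point of the sphere `S_r`, `r = ‖x‖`, whose `e₁`-coordinate is at least that of `x`. Equivalently,
every `E ∩ S_r` is empty or an (open, closed or full) spherical cap of `S_r` around `(r,0,…,0)`. -/
def IsSphericallySymmetric (n : ℕ) [NeZero n] (E : Set (EuclideanSpace ℝ (Fin n))) : Prop :=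
  ∀ x ∈ E, ∀ y : EuclideanSpace ℝ (Fin n), ‖y‖ = ‖x‖ → x 0 ≤ y 0 → y ∈ E

/-- The section of `E` by the `e₁e₂`-plane: the planar set `A` whose rotation about the `e₁`-axis
is `E`, when `E` is rotationally symmetric. -/
def planarSection (n : ℕ) [NeZero n] (E : Set (EuclideanSpace ℝ (Fin n))) : Set Plane :=
  {q | EuclideanSpace.single 0 (q 0) + EuclideanSpace.single 1 (q 1) ∈ E}

/-- `γ : [-β, β] → ℝ²` is the generating curve of the planar set `A`: the counterclockwise
arclength parameterization of the Jordan curve obtained by starting at the rightmost point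
`γ(0)` of `∂A`, which lies on the `e₁`-axis, and following `∂A` in both directions until it meets
the `e₁`-axis again, at `γ(β) = γ(-β)`. The values of `γ` outside `[-β, β]` are irrelevant. -/
structure IsGeneratingCurve (A : Set Plane) (β : ℝ) (γ : ℝ → Plane) : Prop where
  pos : 0 < β
  continuousOn : ContinuousOn γ (Icc (-β) β)
  /-- `γ` is a simple closed curve. -/
  injOn : InjOn γ (Ico (-β) β)
  closed : γ (-β) = γ β
  /-- `γ` runs in the boundary of `A`. -/
  mem_frontier : ∀ s ∈ Icc (-β) β, γ s ∈ frontier A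
  /-- Near each of the points `γ(s)`, `-β < s < β`, the boundary of `A` is the curve `γ`. -/
  frontier_near : ∀ s ∈ Ioo (-β) β, ∃ U ∈ 𝓝 (γ s), frontier A ∩ U ⊆ γ '' Ioo (-β) β
  /-- Arclength parameterization, with a continuous unit tangent vector on `(-β, β)`. -/
  contDiffOn : ContDiffOn ℝ 1 γ (Ioo (-β) β)
  norm_deriv : ∀ s ∈ Ioo (-β) β, ‖deriv γ s‖ = 1
  /-- `γ(0)` lies on the `e₁`-axis and is a rightmost point of the boundary. -/
  start_axis : γ 0 1 = 0
  rightmost : ∀ q ∈ frontier A, q 0 ≤ γ 0 0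
  /-- Counterclockwise, the curve is above the axis on `(0, β)` and below it on `(-β, 0)`, and
  meets the axis again at `±β`. -/
  above : ∀ s ∈ Ioo 0 β, 0 < γ s 1
  below : ∀ s ∈ Ioo (-β) 0, γ s 1 < 0
  end_axis : γ β 1 = 0

/-- The abscissa `F(s)` of the center of the canonical circle `C_s`, the circle centered on the
`e₁`-axis that is tangent to `γ` at `γ(s)`; see `canonicalCenter_iff`. (If `γ'(s)` is vertical,
there is no such circle, and the value is the irrelevant number `0`.) -/
def canonicalCenter (γ : ℝ → Plane) (s : ℝ) : ℝ :=
  inner ℝ (γ s) (deriv γ s) / deriv γ s 0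

/-- The circle through `γ(s)` centered at `(a, 0)` is tangent to `γ` at `γ(s)`, i.e. its radius
vector is orthogonal to `γ'(s)`, exactly if `a = F(s)`. -/
theorem canonicalCenter_iff (γ : ℝ → Plane) (s a : ℝ) (h : deriv γ s 0 ≠ 0) :
    inner ℝ (γ s - !₂[a, 0]) (deriv γ s) = 0 ↔ a = canonicalCenter γ s := by
  have e : inner ℝ (!₂[a, 0] : Plane) (deriv γ s) = a * deriv γ s 0 := by
    simp [PiLp.inner_apply, Fin.sum_univ_two, mul_comm]
  rw [inner_sub_left, e, canonicalCenter, eq_div_iff h, sub_eq_zero, eq_comm]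

/-- The number `F₀` is `F(0)`, the abscissa of the center of the canonical circle `C_0`, which is
the limit of the canonical circles `C_s` as `s → 0`. -/
def IsInitialCenter (γ : ℝ → Plane) (F₀ : ℝ) : Prop :=
  (∀ᶠ s in 𝓝[≠] 0, deriv γ s 0 ≠ 0) ∧ Tendsto (canonicalCenter γ) (𝓝[≠] 0) (𝓝 F₀)

end

/-! The condition `F(0) > 1/2` contradicts the other hypotheses, so its three consequences hold
vacuously. The tangent restriction is established independently of `F(0)`.

Tangent restriction. The region lies to the left of `γ`. If `γ · γ'` were positive at a point above
the axis, turning about the origin away from the positive `e₁`-axis would lead into the region and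
turning towards it out of the region, against spherical symmetry (`inner_deriv_nonpos`).

Contradiction. Let `γ = (x, y)`, `γ' = (a, b)`, `R = x² + y²`, `n = m + 2`. By the Euler–Lagrange
equation the curvature of `γ` is `H + m a/y - p (x b - y a)/R` with a constant `H`. Let `Y` be this
curvature plus `a/y`, which is the difference of the two principal curvatures of the surface, and
let `(Z, S)` be the unit tangent of the image of `γ` under inversion in the unit circle. For `U =
y^(m+1) R^(p/2) Y`, `U' = -p (γ · γ') y^m R^(p/2-1) Z` and `S' = -Z (Z/y + Y)`. Since `F(0) > 1/2`,
the origin is outside `C_0`, and the inverted curve starts to the right: `Z > 0` for small `s`. As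
long as `Z ≥ 0`, the tangent restriction makes `U` nondecreasing from `0`, so `Y ≥ 0` and `S` does
not increase from its initial limit `1`. Hence `Z` could vanish only with `S = -1`, where the
identity `x Z + y S = -γ · γ'` reads `y = γ · γ' ≤ 0`, which is false above the axis. So `Z > 0`
throughout and `U` is eventually bounded below by a positive constant. As `y ≤ β - s`, this forces
`Y ≥ const/(β - s)`. Then `(arcsin S)' = -(Z/y + Y)` has a divergent integral up to `β`, although
`arcsin` is bounded (`not_returning_of_initial_center`).

Euler–Lagrange equation. The curve is only assumed `C¹`, and perimeter is Hausdorff measure of the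
topological boundary. Near a point off the axis the region is an epigraph over the tangent line, and
the graph is varied inside a small box. Homogeneity of the density makes minimality scale invariant
(`perimeter_le`), so the variations need not preserve volume. The area formula for surfaces of
revolution comes from comparison with cylinders by 1-Lipschitz maps (`revolutionArea_eq`). The lemma
of du Bois-Reymond upgrades the vanishing first variation to the existence of the curvature
(`hasDerivAt_sin_angle`, `hasDerivAt_deriv`). -/

open scoped NNReal ENNReal Pointwise

/-! ### The differential equation: no return to the axis. -/

/-- The first derivative of the (weighted) difference of the two principal curvatures along a curve
solving the Euler–Lagrange equation. -/
theorem hasDerivAt_weighted_umbilicity {m : ℕ} {p H s : ℝ} {x y a b : ℝ → ℝ}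
    (hx : HasDerivAt x (a s) s) (hy : HasDerivAt y (b s) s)
    (ha : HasDerivAt a
      (-(H + m * a s / y s - p * (x s * b s - y s * a s) / (x s ^ 2 + y s ^ 2)) * b s) s)
    (hb : HasDerivAt b
      ((H + m * a s / y s - p * (x s * b s - y s * a s) / (x s ^ 2 + y s ^ 2)) * a s) s)
    (hy0 : 0 < y s) :
    HasDerivAt (fun s => y s ^ (m + 1) * (x s ^ 2 + y s ^ 2) ^ (p / 2) *
        (H + (m + 1) * a s / y s - p * (x s * b s - y s * a s) / (x s ^ 2 + y s ^ 2)))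
      (-p * (x s * a s + y s * b s) * (y s ^ m * (x s ^ 2 + y s ^ 2) ^ (p / 2 - 1)) *
        (-(a s * (x s ^ 2 - y s ^ 2) + 2 * x s * y s * b s) / (x s ^ 2 + y s ^ 2))) s := by
  have hR : 0 < x s ^ 2 + y s ^ 2 := by positivity
  have h1 := (hx.pow 2).add (hy.pow 2)
  have h2 := h1.rpow_const (p := p / 2) (Or.inl hR.ne')
  have h3 := (hy.pow (m + 1)).mul h2
  have h4 := ((ha.const_mul ((m : ℝ) + 1)).div hy hy0.ne').const_add H
  have h5 := ((((hx.mul hb).sub (hy.mul ha)).const_mul p)).div h1 hR.ne'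
  have h6 := h3.mul (h4.sub h5)
  refine (h6.congr_deriv ?_).congr_of_eventuallyEq ?_
  · have e1 : (x s ^ 2 + y s ^ 2) ^ (p / 2) =
        (x s ^ 2 + y s ^ 2) ^ (p / 2 - 1) * (x s ^ 2 + y s ^ 2) := by
      rw [← Real.rpow_add_one hR.ne', sub_add_cancel]
    simp only [Pi.add_apply, Pi.pow_apply, Pi.mul_apply, Pi.sub_apply, Pi.div_apply]
    rw [e1]
    generalize (x s ^ 2 + y s ^ 2) ^ (p / 2 - 1) = W
    simp only [Nat.cast_add, Nat.cast_one, Nat.add_sub_cancel, Nat.cast_ofNat, pow_one,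
      Nat.reduceSub]
    field_simp
    ring
  · filter_upwards with t
    simp

/-- Inversion in the unit circle acts on directions by reflection in the line orthogonal to `(x,
y)`. The function differentiated here is the second component `S` of the reflected tangent, and `-(a
(x² - y²) + 2 x y b) / (x² + y²)` is its first component `Z`. As `(Z, S)` is a unit vector, the
bracket multiplying `-Z` is, up to sign, the rate at which the inverted tangent turns. -/
theorem hasDerivAt_inverted_sin {m : ℕ} {p H s : ℝ} {x y a b : ℝ → ℝ}
    (hx : HasDerivAt x (a s) s) (hy : HasDerivAt y (b s) s)
    (ha : HasDerivAt a
      (-(H + m * a s / y s - p * (x s * b s - y s * a s) / (x s ^ 2 + y s ^ 2)) * b s) s)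
    (hb : HasDerivAt b
      ((H + m * a s / y s - p * (x s * b s - y s * a s) / (x s ^ 2 + y s ^ 2)) * a s) s)
    (hy0 : 0 < y s) :
    HasDerivAt (fun s => (b s * (x s ^ 2 - y s ^ 2) - 2 * x s * y s * a s) / (x s ^ 2 + y s ^ 2))
      (-(-(a s * (x s ^ 2 - y s ^ 2) + 2 * x s * y s * b s) / (x s ^ 2 + y s ^ 2)) *
        (-(a s * (x s ^ 2 - y s ^ 2) + 2 * x s * y s * b s) / (x s ^ 2 + y s ^ 2) / y s +
        (H + (m + 1) * a s / y s - p * (x s * b s - y s * a s) / (x s ^ 2 + y s ^ 2)))) s := by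
  have hR : 0 < x s ^ 2 + y s ^ 2 := by positivity
  have h1 := (hx.pow 2).add (hy.pow 2)
  have h2 := (hb.mul ((hx.pow 2).sub (hy.pow 2))).sub (((hx.const_mul 2).mul hy).mul ha)
  refine ((h2.div h1 hR.ne').congr_deriv ?_).congr_of_eventuallyEq ?_
  · simp only [Pi.add_apply, Pi.pow_apply, Pi.mul_apply, Pi.sub_apply]
    simp only [Nat.cast_ofNat, pow_one, Nat.reduceSub]
    field_simp
    ring
  · filter_upwards with t
    simp

/-- A solution of the Euler–Lagrange equation in the upper half-plane that starts at `(1, 0)`, moves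
towards the origin and whose canonical circle initially does not contain the origin cannot
return to the axis. -/
theorem not_returning_of_initial_center {m : ℕ} (hm : 1 ≤ m) {p H β c : ℝ} (hp : 0 < p)
    (hβ : 0 < β) {x y a b : ℝ → ℝ}
    (hx : ∀ s ∈ Ioo 0 β, HasDerivAt x (a s) s) (hy : ∀ s ∈ Ioo 0 β, HasDerivAt y (b s) s)
    (ha : ∀ s ∈ Ioo 0 β, HasDerivAt a
      (-(H + m * a s / y s - p * (x s * b s - y s * a s) / (x s ^ 2 + y s ^ 2)) * b s) s)
    (hb : ∀ s ∈ Ioo 0 β, HasDerivAt b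
      ((H + m * a s / y s - p * (x s * b s - y s * a s) / (x s ^ 2 + y s ^ 2)) * a s) s)
    (hab : ∀ s ∈ Ioo 0 β, a s ^ 2 + b s ^ 2 = 1) (hy0 : ∀ s ∈ Ioo 0 β, 0 < y s)
    (hr : ∀ s ∈ Ioo 0 β, x s ^ 2 + y s ^ 2 ≤ 1) (hyβ : ∀ s ∈ Ioo 0 β, y s ≤ β - s)
    (hd : ∀ s ∈ Ioo 0 β, x s * a s + y s * b s ≤ 0)
    (hx0 : Tendsto x (𝓝[>] 0) (𝓝 1)) (hy0' : Tendsto y (𝓝[>] 0) (𝓝 0))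
    (ha0 : Tendsto a (𝓝[>] 0) (𝓝 0)) (hb0 : Tendsto b (𝓝[>] 0) (𝓝 1)) (hc : 1 / 2 < c)
    (hF : ∀ᶠ s in 𝓝[>] 0, a s ≠ 0 ∧ c < (x s * a s + y s * b s) / a s) : False := by
  have hR : ∀ s ∈ Ioo 0 β, 0 < x s ^ 2 + y s ^ 2 := fun s hs => by
    have := hy0 s hs; positivity
  -- `Y` is the difference of the principal curvatures, `(Z, S)` the unit tangent of the inverted
  -- curve, and `U` the multiple of `Y` whose derivative has the sign of `Z`.
  set Y : ℝ → ℝ := fun s =>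
    H + (m + 1) * a s / y s - p * (x s * b s - y s * a s) / (x s ^ 2 + y s ^ 2) with hY
  set Z : ℝ → ℝ := fun s =>
    -(a s * (x s ^ 2 - y s ^ 2) + 2 * x s * y s * b s) / (x s ^ 2 + y s ^ 2) with hZ
  set S : ℝ → ℝ := fun s =>
    (b s * (x s ^ 2 - y s ^ 2) - 2 * x s * y s * a s) / (x s ^ 2 + y s ^ 2) with hS
  set U : ℝ → ℝ := fun s => y s ^ (m + 1) * (x s ^ 2 + y s ^ 2) ^ (p / 2) * Y s with hU
  have dU : ∀ s ∈ Ioo 0 β, HasDerivAt U (-p * (x s * a s + y s * b s) *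
      (y s ^ m * (x s ^ 2 + y s ^ 2) ^ (p / 2 - 1)) * Z s) s := fun s hs =>
    hasDerivAt_weighted_umbilicity (hx s hs) (hy s hs) (ha s hs) (hb s hs) (hy0 s hs)
  have dS : ∀ s ∈ Ioo 0 β, HasDerivAt S (-Z s * (Z s / y s + Y s)) s := fun s hs =>
    hasDerivAt_inverted_sin (hx s hs) (hy s hs) (ha s hs) (hb s hs) (hy0 s hs)
  have hSZ : ∀ s ∈ Ioo 0 β, S s ^ 2 + Z s ^ 2 = 1 := fun s hs => by
    have h1 := hab s hs
    have h2 := (hR s hs).ne'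
    have : S s ^ 2 + Z s ^ 2 = a s ^ 2 + b s ^ 2 := by
      simp only [hS, hZ]; field_simp; ring
    rw [this, h1]
  have hdS : ∀ s ∈ Ioo 0 β, x s * Z s + y s * S s = -(x s * a s + y s * b s) := fun s hs => by
    have h2 := (hR s hs).ne'
    simp only [hS, hZ]; field_simp; ring
  have hUY : ∀ s ∈ Ioo 0 β, 0 ≤ U s → 0 ≤ Y s := fun s hs h => by
    have h1 := hy0 s hs
    have h2 := hR s hs
    by_contra! h3
    have h4 : 0 < y s ^ (m + 1) * (x s ^ 2 + y s ^ 2) ^ (p / 2) := by positivity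
    have := mul_neg_of_pos_of_neg h4 h3
    simp only [hU] at h
    linarith
  have cZ : ∀ s ∈ Ioo 0 β, ContinuousAt Z s := fun s hs => by
    have h1 := (hx s hs).continuousAt
    have h2 := (hy s hs).continuousAt
    have h3 := (ha s hs).continuousAt
    have h4 := (hb s hs).continuousAt
    have h5 := (hR s hs).ne'
    simp only [hZ]
    fun_prop (disch := assumption)
  have hβ0 : ∀ᶠ s in 𝓝[>] (0 : ℝ), s ∈ Ioo 0 β := Ioo_mem_nhdsGT hβ
  -- Multiplied out, the factor `y^(m+1)` cancels the division by `y`, so every term has a limit as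
  -- the curve leaves `(1, 0)` vertically.
  have hU0 : Tendsto U (𝓝[>] 0) (𝓝 0) := by
    have hm0 : m ≠ 0 := by omega
    have h1 : Tendsto (fun s => (x s ^ 2 + y s ^ 2) ^ (p / 2) * (y s ^ (m + 1) * H +
        y s ^ m * ((m + 1) * a s) - y s ^ (m + 1) * (p * (x s * b s - y s * a s) /
          (x s ^ 2 + y s ^ 2)))) (𝓝[>] 0) (𝓝 (((1 : ℝ) ^ 2 + 0 ^ 2) ^ (p / 2) *
            ((0 : ℝ) ^ (m + 1) * H + (0 : ℝ) ^ m * ((m + 1) * 0) -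
            (0 : ℝ) ^ (m + 1) * (p * (1 * 1 - 0 * 0) / ((1 : ℝ) ^ 2 + 0 ^ 2))))) := by
      have h0 := (hx0.pow 2).add (hy0'.pow 2)
      refine Tendsto.mul (h0.rpow_const (Or.inl (by norm_num))) ?_
      refine Tendsto.sub (((hy0'.pow _).mul_const _).add
        ((hy0'.pow _).mul (ha0.const_mul _))) ((hy0'.pow _).mul ?_)
      exact (((hx0.mul hb0).sub (hy0'.mul ha0)).const_mul p).div h0 (by norm_num)
    simp only [ne_eq, Nat.add_eq_zero_iff, one_ne_zero, and_false, not_false_eq_true, zero_pow,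
      zero_mul, mul_zero, add_zero, sub_zero] at h1
    refine h1.congr' ?_
    filter_upwards [hβ0] with s hs
    have h1 := (hy0 s hs).ne'
    simp only [hU, hY]
    field_simp
    ring
  -- The tangent restriction and `F > c > 0` force `a < 0`, so `F > c'` becomes `y b < -a (x - c')`.
  -- Multiplied by `x² - y²`, this reduces `Z > 0` to the positivity of `b (x² - y²) - 2 x b (x -
  -- c')`, whose limit is `2 c' - 1`. The number `1/2` enters here.
  have hinit : ∀ᶠ s in 𝓝[>] 0, 0 < Z s ∧ x s * a s + y s * b s < 0 := by
    obtain ⟨c', hc1, hc2⟩ := exists_between hc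
    have hlim : Tendsto (fun s => b s * (x s ^ 2 - y s ^ 2) - 2 * x s * b s * (x s - c'))
        (𝓝[>] 0) (𝓝 (1 * (1 ^ 2 - 0 ^ 2) - 2 * 1 * 1 * (1 - c'))) :=
      (hb0.mul ((hx0.pow 2).sub (hy0'.pow 2))).sub
        (((hx0.const_mul 2).mul hb0).mul (hx0.sub_const c'))
    have hev := hlim.eventually_const_lt (show (0 : ℝ) < _ by linarith)
    have hev1 : Tendsto (fun s => x s ^ 2 - y s ^ 2) (𝓝[>] 0) (𝓝 (1 ^ 2 - 0 ^ 2)) :=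
      (hx0.pow 2).sub (hy0'.pow 2)
    have hev2 := hev1.eventually_const_lt (show (0 : ℝ) < _ by norm_num)
    filter_upwards [hβ0, hF, hev, hev2, hb0.eventually_const_lt zero_lt_one,
      hx0.eventually_const_lt zero_lt_one] with s hs hs1 hs2 hs3 hs4 hs5
    have hys := hy0 s hs
    have hds := hd s hs
    have hR' := hR s hs
    have ha' : a s < 0 := by
      rcases lt_or_gt_of_ne hs1.1 with h | h
      · exact h
      · have := div_nonpos_of_nonpos_of_nonneg hds h.le
        linarith [hs1.2]
    have h1 : x s * a s + y s * b s < c' * a s := by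
      have := (lt_div_iff_of_neg ha').1 hs1.2
      nlinarith
    have hxc : 0 < x s - c' := by
      by_contra! h
      nlinarith [mul_pos hys hs4]
    refine ⟨?_, by nlinarith⟩
    simp only [hZ]
    refine div_pos ?_ hR'
    have h2 : y s * b s < -a s * (x s - c') := by linarith
    have h3 : 0 < (x s - c') * (-(a s * (x s ^ 2 - y s ^ 2) + 2 * x s * y s * b s)) := by
      have h4 := mul_lt_mul_of_pos_right h2 hs3
      have h5 := mul_pos hys hs2
      nlinarith
    exact (mul_pos_iff_of_pos_left hxc).1 h3
  have hUmono : ∀ u v, u ∈ Ioo 0 β → v ∈ Ioo 0 β → u ≤ v → (∀ s ∈ Ioo u v, 0 ≤ Z s) →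
      U u ≤ U v := by
    intro u v hu hv huv hz
    have hsub : Icc u v ⊆ Ioo 0 β := fun s hs => ⟨hu.1.trans_le hs.1, hs.2.trans_lt hv.2⟩
    refine monotoneOn_of_hasDerivWithinAt_nonneg (convex_Icc u v)
      (f' := fun s => -p * (x s * a s + y s * b s) *
      (y s ^ m * (x s ^ 2 + y s ^ 2) ^ (p / 2 - 1)) * Z s)
      (fun s hs => (dU s (hsub hs)).continuousAt.continuousWithinAt)
      (fun s hs => (dU s (hsub (interior_subset hs))).hasDerivWithinAt) ?_
      (left_mem_Icc.2 huv) (right_mem_Icc.2 huv) huv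
    intro s hs
    rw [interior_Icc] at hs
    have hs' := hsub (Ioo_subset_Icc_self hs)
    have h1 := hy0 s hs'
    have h2 := hR s hs'
    have h3 := hd s hs'
    have h4 := hz s hs
    have h5 : 0 ≤ -p * (x s * a s + y s * b s) := by nlinarith
    positivity
  have hUnonneg : ∀ v ∈ Ioo 0 β, (∀ s ∈ Ioo 0 v, 0 ≤ Z s) → 0 ≤ U v := by
    intro v hv hz
    refine le_of_tendsto hU0 ?_
    filter_upwards [Ioo_mem_nhdsGT hv.1] with u hu
    exact hUmono u v ⟨hu.1, hu.2.trans hv.2⟩ hv hu.2.le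
      fun s hs => hz s ⟨hu.1.trans hs.1, hs.2⟩
  -- At the first zero `t` of `Z` one has `S = ±1`. Since `S` has decreased from a value below `1`,
  -- it equals `-1`, and `hdS` gives `y t ≤ 0`.
  have hZpos : ∀ s ∈ Ioo 0 β, 0 < Z s := by
    by_contra! hne
    obtain ⟨s₁, hs₁, hZs₁⟩ := hne
    obtain ⟨δ, hδ, hδ'⟩ := mem_nhdsGT_iff_exists_Ioo_subset.1 hinit
    set B : Set ℝ := {s | s ∈ Ioo 0 β ∧ Z s ≤ 0} with hB
    have hBne : B.Nonempty := ⟨s₁, hs₁, hZs₁⟩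
    have hBb : BddBelow B := ⟨0, fun s hs => hs.1.1.le⟩
    have hδB : ∀ s ∈ B, δ ≤ s := fun s hs => by
      by_contra! h
      exact absurd (hδ' ⟨hs.1.1, h⟩).1 (not_lt.2 hs.2)
    set t := sInf B with ht
    have htδ : δ ≤ t := le_csInf hBne hδB
    have ht0 : 0 < t := lt_of_lt_of_le hδ htδ
    have htβ : t < β := (csInf_le hBb ⟨hs₁, hZs₁⟩).trans_lt hs₁.2
    have htI : t ∈ Ioo 0 β := ⟨ht0, htβ⟩
    have hbefore : ∀ s ∈ Ioo 0 t, 0 < Z s := fun s hs => by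
      by_contra! h
      exact absurd (csInf_le hBb ⟨⟨hs.1, hs.2.trans htβ⟩, h⟩) (not_le.2 hs.2)
    have hZt : Z t ≤ 0 := by
      have h1 : t ∈ closure B := csInf_mem_closure hBne hBb
      have h2 := mem_closure_iff_clusterPt.1 h1
      by_contra! h
      have h3 : ∀ᶠ s in 𝓝 t, 0 < Z s := (cZ t htI).eventually_const_lt h
      obtain ⟨s, hs1, hs2⟩ := (mem_closure_iff_nhds.1 h1) _ h3
      exact absurd hs2.2 (not_le.2 hs1)
    have hZt' : 0 ≤ Z t := by
      have h1 : Tendsto Z (𝓝[<] t) (𝓝 (Z t)) := (cZ t htI).tendsto.mono_left inf_le_left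
      refine ge_of_tendsto h1 ?_
      filter_upwards [Ioo_mem_nhdsLT ht0] with s hs
      exact (hbefore s hs).le
    have hZt0 : Z t = 0 := le_antisymm hZt hZt'
    have hth : t / 2 ∈ Ioo 0 β := ⟨by linarith, by linarith⟩
    have hSt : S t ≤ S (t / 2) := by
      have hsub : Icc (t / 2) t ⊆ Ioo 0 β := fun s hs => ⟨hth.1.trans_le hs.1, hs.2.trans_lt htβ⟩
      refine antitoneOn_of_hasDerivWithinAt_nonpos (convex_Icc (t / 2) t)
        (f' := fun s => -Z s * (Z s / y s + Y s))
        (fun s hs => (dS s (hsub hs)).continuousAt.continuousWithinAt)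
        (fun s hs => (dS s (hsub (interior_subset hs))).hasDerivWithinAt) ?_
        (left_mem_Icc.2 (by linarith)) (right_mem_Icc.2 (by linarith)) (by linarith)
      intro s hs
      rw [interior_Icc] at hs
      have hs' := hsub (Ioo_subset_Icc_self hs)
      have h1 := hbefore s ⟨hs'.1, hs.2⟩
      have h2 := hy0 s hs'
      have h3 := hUY s hs' (hUnonneg s hs' fun r hr => (hbefore r ⟨hr.1, hr.2.trans hs.2⟩).le)
      have h4 : 0 ≤ Z s * (Z s / y s + Y s) := by positivity
      linarith
    have hS1 : S (t / 2) < 1 := by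
      have h1 := hSZ _ hth
      have h2 := hbefore (t / 2) ⟨hth.1, by linarith⟩
      nlinarith [pow_pos h2 2]
    have hSt1 : S t = -1 := by
      have h1 := hSZ t htI
      rw [hZt0] at h1
      have h2 : (S t - 1) * (S t + 1) = 0 := by linear_combination h1
      rcases mul_eq_zero.1 h2 with h | h <;> linarith
    have h1 := hdS t htI
    rw [hZt0, hSt1] at h1
    have h2 := hd t htI
    have h3 := hy0 t htI
    linarith
  obtain ⟨δ, hδ, hδ'⟩ := mem_nhdsGT_iff_exists_Ioo_subset.1 hinit
  obtain ⟨s₁, hs₁, hs₁'⟩ := exists_between (lt_min hδ hβ)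
  have hs₁β : s₁ ∈ Ioo 0 β := ⟨hs₁, hs₁'.trans_le (min_le_right _ _)⟩
  have hU₁ : 0 < U s₁ := by
    have hsub : Icc (s₁ / 2) s₁ ⊆ Ioo 0 β :=
      fun s hs => ⟨(half_pos hs₁).trans_le hs.1, hs.2.trans_lt hs₁β.2⟩
    have h1 : U (s₁ / 2) < U s₁ := by
      refine strictMonoOn_of_hasDerivWithinAt_pos (convex_Icc (s₁ / 2) s₁)
        (f' := fun s => -p * (x s * a s + y s * b s) *
        (y s ^ m * (x s ^ 2 + y s ^ 2) ^ (p / 2 - 1)) * Z s)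
        (fun s hs => (dU s (hsub hs)).continuousAt.continuousWithinAt)
        (fun s hs => (dU s (hsub (interior_subset hs))).hasDerivWithinAt) ?_
        (left_mem_Icc.2 (half_lt_self hs₁).le) (right_mem_Icc.2 (half_lt_self hs₁).le)
        (half_lt_self hs₁)
      intro s hs
      rw [interior_Icc] at hs
      have hs' := hsub (Ioo_subset_Icc_self hs)
      have h1 := hy0 s hs'
      have h2 := hR s hs'
      have h3 := (hδ' ⟨hs'.1, hs.2.trans (hs₁'.trans_le (min_le_left _ _))⟩).2
      have h4 := hZpos s hs'
      have h5 : 0 < -p * (x s * a s + y s * b s) := by nlinarith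
      positivity
    have h2 : 0 ≤ U (s₁ / 2) := hUnonneg _ (hsub (left_mem_Icc.2 (half_lt_self hs₁).le))
      fun s hs => (hZpos s ⟨hs.1, by linarith [hs.2, hs₁β.2]⟩).le
    linarith
  -- The weight in front of `Y` is at most `y ≤ β - s`, because the curve stays in the unit disc,
  -- while `U` stays above `U s₁`.
  have hYlow : ∀ s ∈ Ico s₁ β, U s₁ / (β - s) ≤ Y s := by
    intro s hs
    have hs' : s ∈ Ioo 0 β := ⟨hs₁.trans_le hs.1, hs.2⟩
    have h1 : U s₁ ≤ U s := hUmono s₁ s hs₁β hs' hs.1 fun r hr =>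
      (hZpos r ⟨hs₁.trans hr.1, hr.2.trans hs.2⟩).le
    have hy1 := hy0 s hs'
    have h2 : 0 ≤ Y s := hUY s hs' (hU₁.le.trans h1)
    have h3 : y s ^ (m + 1) ≤ y s := by
      refine pow_le_of_le_one hy1.le ?_ (by omega)
      have := hr s hs'
      nlinarith [sq_nonneg (x s)]
    have h4 : (x s ^ 2 + y s ^ 2) ^ (p / 2) ≤ 1 :=
      Real.rpow_le_one (hR s hs').le (hr s hs') (by positivity)
    have h5 : y s ^ (m + 1) * (x s ^ 2 + y s ^ 2) ^ (p / 2) ≤ β - s := by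
      have h6 : 0 ≤ (x s ^ 2 + y s ^ 2) ^ (p / 2) := Real.rpow_nonneg (hR s hs').le _
      calc _ ≤ y s * 1 := mul_le_mul h3 h4 h6 hy1.le
        _ ≤ _ := by rw [mul_one]; exact hyβ s hs'
    rw [div_le_iff₀ (by linarith [hs.2])]
    calc U s₁ ≤ U s := h1
      _ ≤ (β - s) * Y s := mul_le_mul_of_nonneg_right h5 h2
      _ = _ := by ring
  -- As `√(1 - S²) = Z > 0`, the factor `Z` in `S'` cancels in the derivative of `arcsin S`. The
  -- logarithm is the antiderivative of the bound from `hYlow` and tends to infinity in absolute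
  -- value at `β`.
  have dφ : ∀ s ∈ Ico s₁ β, HasDerivAt (fun s => Real.arcsin (S s) - U s₁ * Real.log (β - s))
      (-(Z s / y s + Y s) + U s₁ / (β - s)) s := by
    intro s hs
    have hs' : s ∈ Ioo 0 β := ⟨hs₁.trans_le hs.1, hs.2⟩
    have hz := hZpos s hs'
    have h1 := hSZ s hs'
    have h2 : S s ≠ -1 := fun h => by rw [h] at h1; nlinarith [pow_pos hz 2]
    have h3 : S s ≠ 1 := fun h => by rw [h] at h1; nlinarith [pow_pos hz 2]
    have h4 : √(1 - S s ^ 2) = Z s := by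
      rw [show 1 - S s ^ 2 = Z s ^ 2 by linarith, Real.sqrt_sq hz.le]
    have h5 := (Real.hasDerivAt_arcsin h2 h3).comp s (dS s hs')
    have h6 := (((hasDerivAt_id s).const_sub β).log (by simpa using (sub_pos.2 hs.2).ne')).const_mul
      (U s₁)
    refine (h5.sub h6).congr_deriv ?_
    rw [h4]
    have h7 := (sub_pos.2 hs.2).ne'
    simp only [id]
    field_simp
    ring
  have hanti : ∀ s ∈ Ico s₁ β, Real.arcsin (S s) - U s₁ * Real.log (β - s) ≤
      Real.arcsin (S s₁) - U s₁ * Real.log (β - s₁) := by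
    intro s hs
    refine antitoneOn_of_hasDerivWithinAt_nonpos (convex_Icc s₁ s)
      (f := fun s => Real.arcsin (S s) - U s₁ * Real.log (β - s))
      (f' := fun s => -(Z s / y s + Y s) + U s₁ / (β - s))
      (fun r hr => (dφ r ⟨hr.1, hr.2.trans_lt hs.2⟩).continuousAt.continuousWithinAt)
      (fun r hr => (dφ r ⟨(interior_subset hr).1,
        (interior_subset hr).2.trans_lt hs.2⟩).hasDerivWithinAt) ?_
      (left_mem_Icc.2 hs.1) (right_mem_Icc.2 hs.1) hs.1
    intro r hr
    have hr' := interior_subset hr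
    have hr'' : r ∈ Ico s₁ β := ⟨hr'.1, hr'.2.trans_lt hs.2⟩
    have hr₀ : r ∈ Ioo 0 β := ⟨hs₁.trans_le hr'.1, hr''.2⟩
    have h1 := hYlow r hr''
    have h2 : 0 ≤ Z r / y r := div_nonneg (hZpos r hr₀).le (hy0 r hr₀).le
    linarith
  have hlog : Tendsto (fun s => -Real.log (β - s)) (𝓝[<] β) atTop := by
    rw [tendsto_neg_atTop_iff]
    refine Real.tendsto_log_nhdsGT_zero.comp ?_
    refine tendsto_nhdsWithin_iff.2 ⟨?_, ?_⟩
    · have : Tendsto (fun s => β - s) (𝓝 β) (𝓝 (β - β)) := tendsto_id.const_sub β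
      rw [sub_self] at this
      exact this.mono_left inf_le_left
    · filter_upwards [self_mem_nhdsWithin] with s hs
      exact sub_pos.2 (mem_Iio.1 hs)
  have hbig := hlog.eventually_gt_atTop ((Real.pi / 2 + (Real.arcsin (S s₁) - U s₁ *
    Real.log (β - s₁))) / U s₁)
  obtain ⟨s, hs1, hs2⟩ := (hbig.and (Ioo_mem_nhdsLT hs₁β.2)).exists
  have h1 := hanti s ⟨hs2.1.le, hs2.2⟩
  have h2 := Real.neg_pi_div_two_le_arcsin (S s)
  rw [div_lt_iff₀ hU₁] at hs1
  linarith

/-! ### Orthonormal frames and coordinates in the plane. -/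

/-- The point with coordinates `w` in the orthonormal frame at `P` with first vector `T`. -/
def framePoint (P T : Plane) (w : ℝ × ℝ) : Plane :=
  !₂[P 0 + w.1 * T 0 - w.2 * T 1, P 1 + w.1 * T 1 + w.2 * T 0]

@[simp] theorem framePoint_zero (P T : Plane) (w : ℝ × ℝ) :
    framePoint P T w 0 = P 0 + w.1 * T 0 - w.2 * T 1 := rfl

@[simp] theorem framePoint_one (P T : Plane) (w : ℝ × ℝ) :
    framePoint P T w 1 = P 1 + w.1 * T 1 + w.2 * T 0 := rfl

theorem continuous_framePoint (P T : Plane) : Continuous (framePoint P T) := by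
  unfold framePoint
  refine (PiLp.continuous_toLp 2 _).comp (continuous_pi fun i => ?_)
  fin_cases i <;> simp <;> fun_prop

theorem Plane.ext {q r : Plane} (h0 : q 0 = r 0) (h1 : q 1 = r 1) : q = r := by
  ext i; fin_cases i <;> assumption

/-- First coordinate in the frame. -/
def frameFst (P T q : Plane) : ℝ := (q 0 - P 0) * T 0 + (q 1 - P 1) * T 1

/-- Second coordinate in the frame. -/
def frameSnd (P T q : Plane) : ℝ := (q 1 - P 1) * T 0 - (q 0 - P 0) * T 1

theorem framePoint_frameFst_frameSnd {P T : Plane} (hT : T 0 ^ 2 + T 1 ^ 2 = 1) (q : Plane) :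
    framePoint P T (frameFst P T q, frameSnd P T q) = q := by
  refine Plane.ext ?_ ?_ <;> simp [frameFst, frameSnd]
  · linear_combination (q 0 - P 0) * hT
  · linear_combination (q 1 - P 1) * hT

theorem frameFst_framePoint {P T : Plane} (hT : T 0 ^ 2 + T 1 ^ 2 = 1) (w : ℝ × ℝ) :
    frameFst P T (framePoint P T w) = w.1 := by
  simp [frameFst]; linear_combination w.1 * hT

theorem frameSnd_framePoint {P T : Plane} (hT : T 0 ^ 2 + T 1 ^ 2 = 1) (w : ℝ × ℝ) :
    frameSnd P T (framePoint P T w) = w.2 := by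
  simp [frameSnd]; linear_combination w.2 * hT

theorem Plane.norm_sq (q : Plane) : ‖q‖ ^ 2 = q 0 ^ 2 + q 1 ^ 2 := by
  simp [EuclideanSpace.norm_sq_eq, Fin.sum_univ_two]

theorem Plane.inner_eq (q r : Plane) : inner ℝ q r = q 0 * r 0 + q 1 * r 1 := by
  simp [PiLp.inner_apply, Fin.sum_univ_two, mul_comm]

theorem Plane.hasDerivAt_iff {γ : ℝ → Plane} {v : Plane} {s : ℝ} :
    HasDerivAt γ v s ↔ HasDerivAt (fun t => γ t 0) (v 0) s ∧ HasDerivAt (fun t => γ t 1) (v 1) s := by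
  constructor
  · intro h
    have := hasFDerivWithinAt_euclidean.1 (hasFDerivWithinAt_univ.2 h.hasFDerivAt)
    exact ⟨by simpa using (this 0).hasFDerivAt_of_univ.hasDerivAt,
      by simpa using (this 1).hasFDerivAt_of_univ.hasDerivAt⟩
  · rintro ⟨h0, h1⟩
    have : HasFDerivWithinAt γ (ContinuousLinearMap.toSpanSingleton ℝ v) univ s := by
      refine hasFDerivWithinAt_euclidean.2 fun i => ?_
      fin_cases i
      · refine h0.hasFDerivAt.hasFDerivWithinAt.congr_fderiv ?_
        ext; simp
      · refine h1.hasFDerivAt.hasFDerivWithinAt.congr_fderiv ?_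
        ext; simp
    simpa using this.hasFDerivAt_of_univ.hasDerivAt

/-! ### The boundary as a local graph over the tangent line. -/

namespace IsGeneratingCurve

variable {A : Set Plane} {β : ℝ} {γ : ℝ → Plane}

theorem contDiffAt (hγ : IsGeneratingCurve A β γ) {s : ℝ} (hs : s ∈ Ioo (-β) β) :
    ContDiffAt ℝ 1 γ s :=
  hγ.contDiffOn.contDiffAt (isOpen_Ioo.mem_nhds hs)

theorem hasDerivAt (hγ : IsGeneratingCurve A β γ) {s : ℝ} (hs : s ∈ Ioo (-β) β) :
    HasDerivAt γ (deriv γ s) s :=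
  ((hγ.contDiffAt hs).differentiableAt one_ne_zero).hasDerivAt

theorem continuousAt_deriv (hγ : IsGeneratingCurve A β γ) {s : ℝ} (hs : s ∈ Ioo (-β) β) :
    ContinuousAt (deriv γ) s :=
  (hγ.contDiffOn.continuousOn_deriv_of_isOpen isOpen_Ioo le_rfl).continuousAt
    (isOpen_Ioo.mem_nhds hs)

theorem deriv_sq (hγ : IsGeneratingCurve A β γ) {s : ℝ} (hs : s ∈ Ioo (-β) β) :
    deriv γ s 0 ^ 2 + deriv γ s 1 ^ 2 = 1 := by
  rw [← Plane.norm_sq, hγ.norm_deriv s hs, one_pow]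

/-- Near an interior point of the curve, the boundary is a small arc of the curve. -/
theorem eventually_mem_frontier (hγ : IsGeneratingCurve A β γ) {s₀ : ℝ} (hs : s₀ ∈ Ioo (-β) β)
    {V : Set ℝ} (hV : V ∈ 𝓝 s₀) : ∀ᶠ q in 𝓝 (γ s₀), q ∈ frontier A → ∃ s ∈ V, γ s = q := by
  obtain ⟨U, hU, hU'⟩ := hγ.frontier_near s₀ hs
  obtain ⟨V', hV'V, hV'o, hsV'⟩ := mem_nhds_iff.1 hV
  -- The part of the curve with parameters outside `V'` is compact and, by injectivity, misses `γ
  -- s₀`. Hence only the short arc meets a small neighbourhood of `γ s₀`.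
  have hcomp : IsCompact (γ '' (Icc (-β) β \ V')) :=
    (isCompact_Icc.diff hV'o).image_of_continuousOn (hγ.continuousOn.mono sdiff_subset)
  have hnot : γ s₀ ∉ γ '' (Icc (-β) β \ V') := by
    rintro ⟨r, ⟨hr, hrV⟩, hrs⟩
    by_cases hrβ : r = β
    · have h1 : γ (-β) = γ s₀ := by rw [hγ.closed, ← hrβ, hrs]
      have := hγ.injOn ⟨le_rfl, by linarith [hγ.pos]⟩ ⟨hs.1.le, hs.2⟩ h1
      exact absurd this hs.1.ne
    · have := hγ.injOn ⟨hr.1, lt_of_le_of_ne hr.2 hrβ⟩ ⟨hs.1.le, hs.2⟩ hrs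
      exact hrV (this ▸ hsV')
  filter_upwards [hU, hcomp.isClosed.isOpen_compl.mem_nhds hnot] with q hq hq' hqA
  obtain ⟨s, hs, rfl⟩ := hU' ⟨hqA, hq⟩
  refine ⟨s, ?_, rfl⟩
  by_contra h
  exact hq' ⟨s, ⟨Ioo_subset_Icc_self hs, fun h' => h (hV'V h')⟩, rfl⟩

/-- Near an interior point of the curve, the boundary is the graph of a `C¹` function over the
tangent line. -/
theorem exists_local_graph (hγ : IsGeneratingCurve A β γ) {s₀ : ℝ} (hs : s₀ ∈ Ioo (-β) β) :
    ∃ f : ℝ → ℝ, ContDiffAt ℝ 1 f 0 ∧ f 0 = 0 ∧ deriv f 0 = 0 ∧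
      (∀ᶠ s in 𝓝 s₀, frameSnd (γ s₀) (deriv γ s₀) (γ s) =
        f (frameFst (γ s₀) (deriv γ s₀) (γ s))) ∧
      ∀ᶠ w : ℝ × ℝ in 𝓝 0, framePoint (γ s₀) (deriv γ s₀) w ∈ frontier A ↔ w.2 = f w.1 := by
  set P := γ s₀ with hP
  set T := deriv γ s₀ with hT
  have hTT : T 0 ^ 2 + T 1 ^ 2 = 1 := hγ.deriv_sq hs
  set u : ℝ → ℝ := fun s => frameFst P T (γ s) with hu
  set v : ℝ → ℝ := fun s => frameSnd P T (γ s) with hv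
  have hc : ∀ i, ContDiffAt ℝ 1 (fun s => γ s i) s₀ := fun i =>
    contDiffAt_euclidean.1 (hγ.contDiffAt hs) i
  have hcu : ContDiffAt ℝ 1 u s₀ := by
    have h0 := hc 0
    have h1 := hc 1
    simp only [hu, frameFst]
    fun_prop
  have hcv : ContDiffAt ℝ 1 v s₀ := by
    have h0 := hc 0
    have h1 := hc 1
    simp only [hv, frameSnd]
    fun_prop
  obtain ⟨hd0, hd1⟩ := Plane.hasDerivAt_iff.1 (hγ.hasDerivAt hs)
  have hdu : HasDerivAt u 1 s₀ := by
    refine (((hd0.sub_const (P 0)).mul_const (T 0)).add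
      ((hd1.sub_const (P 1)).mul_const (T 1))).congr_deriv ?_
    linear_combination hTT
  have hdv : HasDerivAt v 0 s₀ := by
    refine (((hd1.sub_const (P 1)).mul_const (T 0)).sub
      ((hd0.sub_const (P 0)).mul_const (T 1))).congr_deriv ?_
    rw [← hT]; ring
  have hu0 : u s₀ = 0 := by simp [hu, frameFst, hP]
  have hv0 : v s₀ = 0 := by simp [hv, frameSnd, hP]
  -- The tangential coordinate `u` has derivative `1` at `s₀`, so it is a local parameter by the
  -- inverse function theorem. The graph function is the normal coordinate `v` composed with the
  -- inverse of `u`.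
  have hstrict : HasStrictDerivAt u 1 s₀ := hcu.hasStrictDerivAt' hdu one_ne_zero
  set e := (hstrict.hasStrictFDerivAt_equiv one_ne_zero).toOpenPartialHomeomorph u with he
  have hecoe : ∀ s, e s = u s := fun s => rfl
  have hsrc : s₀ ∈ e.source := HasStrictFDerivAt.mem_toOpenPartialHomeomorph_source _
  have htgt : (0 : ℝ) ∈ e.target := by
    have := e.map_source hsrc
    rwa [hecoe, hu0] at this
  have hsymm0 : e.symm 0 = s₀ := by
    have := e.left_inv hsrc
    rwa [hecoe, hu0] at this
  have hdu' : HasDerivAt e 1 (e.symm 0) := by rw [hsymm0]; exact hdu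
  have hcsymm : ContDiffAt ℝ 1 e.symm 0 := by
    refine e.contDiffAt_symm_deriv one_ne_zero htgt hdu' ?_
    rw [hsymm0]; exact hcu
  have hdsymm : HasDerivAt e.symm 1 0 := by
    simpa using e.hasDerivAt_symm htgt one_ne_zero hdu'
  refine ⟨fun w => v (e.symm w), ?_, ?_, ?_, ?_, ?_⟩
  · have h1 : ContDiffAt ℝ 1 v (e.symm 0) := by rw [hsymm0]; exact hcv
    exact h1.comp 0 hcsymm
  · simp only [hsymm0, hv0]
  · have h1 : HasDerivAt v 0 (e.symm 0) := by rw [hsymm0]; exact hdv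
    simpa [Function.comp_def] using (h1.comp 0 hdsymm).deriv
  · filter_upwards [e.open_source.mem_nhds hsrc] with s hs'
    have : e.symm (u s) = s := e.left_inv hs'
    change v s = v (e.symm (u s))
    rw [this]
  · have h1 : Tendsto (framePoint P T) (𝓝 0) (𝓝 P) := by
      have := (continuous_framePoint P T).tendsto 0
      convert this
      refine Plane.ext ?_ ?_ <;> simp
    have h2 := h1.eventually (hγ.eventually_mem_frontier hs
      (inter_mem (e.open_source.mem_nhds hsrc) (isOpen_Ioo.mem_nhds hs)))
    have h3 : ∀ᶠ w : ℝ × ℝ in 𝓝 0, w.1 ∈ e.target ∧ e.symm w.1 ∈ Ioo (-β) β := by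
      have : Tendsto (fun w : ℝ × ℝ => w.1) (𝓝 0) (𝓝 (0 : ℝ)) := continuous_fst.tendsto 0
      have h4 : ∀ᶠ x in 𝓝 (0 : ℝ), x ∈ e.target := e.open_target.mem_nhds htgt
      have h5 : ∀ᶠ x in 𝓝 (0 : ℝ), e.symm x ∈ Ioo (-β) β :=
        hcsymm.continuousAt.eventually_mem (by rw [hsymm0]; exact isOpen_Ioo.mem_nhds hs)
      exact this.eventually (h4.and h5)
    filter_upwards [h2, h3] with w hw2 hw3
    constructor
    · intro hw
      obtain ⟨s, hsV, hsw⟩ := hw2 hw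
      have hus : u s = w.1 := by
        simp only [hu, hsw, frameFst_framePoint hTT]
      have hvs : v s = w.2 := by
        simp only [hv, hsw, frameSnd_framePoint hTT]
      rw [← hus, ← hvs]
      exact congrArg v (e.left_inv hsV.1).symm
    · intro hw
      have h4 : u (e.symm w.1) = w.1 := e.right_inv hw3.1
      have h5 : framePoint P T w = γ (e.symm w.1) := by
        rw [← framePoint_frameFst_frameSnd hTT (P := P) (γ (e.symm w.1))]
        change _ = framePoint P T (u (e.symm w.1), v (e.symm w.1))
        rw [h4, ← hw]
      rw [h5]
      exact hγ.mem_frontier _ (Ioo_subset_Icc_self hw3.2)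

end IsGeneratingCurve

/-! ### The two sides of the curve and the tangent restriction. -/

theorem HasDerivAt.eventually_pos_of_zero {g : ℝ → ℝ} {c : ℝ} (hg : HasDerivAt g c 0)
    (h0 : g 0 = 0) (hc : 0 < c) : ∀ᶠ t in 𝓝[>] 0, 0 < g t := by
  have h1 := (hasDerivAt_iff_tendsto_slope.1 hg).eventually_const_lt hc
  have h2 : 𝓝[>] (0 : ℝ) ≤ 𝓝[≠] 0 := nhdsWithin_mono _ fun x hx => (ne_of_gt hx)
  filter_upwards [h2 h1, self_mem_nhdsWithin] with t ht ht0
  have ht' : 0 < slope g 0 t := ht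
  rw [slope_def_field, h0, sub_zero, sub_zero] at ht'
  exact (div_pos_iff_of_pos_right ht0).1 ht'

/-- Away from the frontier, a set is covered by the disjoint open sets `interior s` and `(closure
s)ᶜ`, so a connected set meeting both `s` and `sᶜ` cannot avoid it. -/
theorem IsPreconnected.inter_frontier_nonempty' {X : Type*} [TopologicalSpace X] {t s : Set X}
    (ht : IsPreconnected t) (h1 : (t ∩ s).Nonempty) (h2 : (t ∩ sᶜ).Nonempty) :
    (t ∩ frontier s).Nonempty := by
  by_contra h
  have hcov : t ⊆ interior s ∪ (closure s)ᶜ := by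
    intro x hx
    by_cases hxi : x ∈ interior s
    · exact Or.inl hxi
    · exact Or.inr fun hxc => h ⟨x, hx, hxc, hxi⟩
  obtain ⟨x, hx, hxs⟩ := h1
  obtain ⟨y, hy, hys⟩ := h2
  have hxi : x ∈ interior s := (hcov hx).resolve_right fun h' => h' (subset_closure hxs)
  have hyc : y ∈ (closure s)ᶜ := (hcov hy).resolve_left fun h' => hys (interior_subset h')
  obtain ⟨z, -, hz1, hz2⟩ := ht _ _ isOpen_interior isClosed_closure.isOpen_compl hcov
    ⟨x, hx, hxi⟩ ⟨y, hy, hyc⟩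
  exact hz2 (subset_closure (interior_subset hz1))

/-- The points of a sector on the left (`σ = 1`) or on the right (`σ = -1`) of `γ` that are close to
`γ s` belong to `B`. -/
def OnSide (γ : ℝ → Plane) (σ : ℝ) (B : Set Plane) (s : ℝ) : Prop :=
  ∀ V : Plane, 0 < σ * (deriv γ s 0 * V 1 - deriv γ s 1 * V 0) →
    ∀ᶠ t in 𝓝[>] (0 : ℝ), γ s + t • V ∈ B

/-- Affine interpolation on each vertical segment, from the graph to the horizontal edge of the box,
makes the set a continuous image of a rectangle. -/
theorem isPreconnected_graph_side {f : ℝ → ℝ} {a b σ : ℝ}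
    (hf : ContinuousOn f (Ioo (-a) a)) (hfb : ∀ u ∈ Ioo (-a) a, |f u| < b)
    (hσ : σ = 1 ∨ σ = -1) :
    IsPreconnected {w : ℝ × ℝ | w.1 ∈ Ioo (-a) a ∧ w.2 ∈ Ioo (-b) b ∧ 0 < σ * (w.2 - f w.1)} := by
  have h : {w : ℝ × ℝ | w.1 ∈ Ioo (-a) a ∧ w.2 ∈ Ioo (-b) b ∧ 0 < σ * (w.2 - f w.1)} =
      (fun z : ℝ × ℝ => (z.1, f z.1 + z.2 * (σ * b - f z.1))) '' (Ioo (-a) a ×ˢ Ioo 0 1) := by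
    ext ⟨u, v⟩
    simp only [mem_ofPred_eq, mem_image, mem_prod, Prod.mk.injEq, Prod.exists]
    constructor
    · rintro ⟨hu, hv, hw⟩
      have h1 := abs_lt.1 (hfb u hu)
      refine ⟨u, (v - f u) / (σ * b - f u), ⟨hu, ?_⟩, rfl, ?_⟩
      · rcases hσ with rfl | rfl
        · have h2 : 0 < 1 * b - f u := by linarith
          exact ⟨div_pos (by linarith) h2, (div_lt_one h2).2 (by linarith [hv.2])⟩
        · have h2 : -1 * b - f u < 0 := by linarith
          exact ⟨div_pos_of_neg_of_neg (by linarith) h2,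
            (div_lt_one_of_neg h2).2 (by linarith [hv.1])⟩
      · have h2 : σ * b - f u ≠ 0 := by
          rcases hσ with rfl | rfl
          · have : 0 < 1 * b - f u := by linarith
            exact this.ne'
          · have h2 : -1 * b - f u < 0 := by linarith
            exact h2.ne
        field_simp
        ring
    · rintro ⟨u', θ, ⟨hu, hθ⟩, rfl, rfl⟩
      have h1 := abs_lt.1 (hfb _ hu)
      refine ⟨hu, ?_, ?_⟩
      · rcases hσ with rfl | rfl <;> constructor <;> nlinarith [hθ.1, hθ.2]
      · rcases hσ with rfl | rfl <;> nlinarith [hθ.1, hθ.2]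
  rw [h]
  refine (isPreconnected_Ioo.prod isPreconnected_Ioo).image _ ?_
  have hf' : ContinuousOn (fun z : ℝ × ℝ => f z.1) (Ioo (-a) a ×ˢ Ioo 0 1) :=
    hf.comp continuousOn_fst fun z hz => hz.1
  exact continuousOn_fst.prodMk
    (hf'.add (continuousOn_snd.mul (continuousOn_const.sub hf')))

namespace IsGeneratingCurve

variable {A : Set Plane} {β : ℝ} {γ : ℝ → Plane} {s₀ : ℝ} {f : ℝ → ℝ}

/-- The part of a small box strictly on one side of the graph is connected and free of frontier
points, so it cannot meet both the region and its complement. -/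
theorem side_dichotomy {P T : Plane}
    (hf : ContDiffAt ℝ 1 f 0) (hf0 : f 0 = 0)
    (hfr : ∀ᶠ w : ℝ × ℝ in 𝓝 0, framePoint P T w ∈ frontier A ↔ w.2 = f w.1)
    {σ : ℝ} (hσ : σ = 1 ∨ σ = -1) :
    (∀ᶠ w : ℝ × ℝ in 𝓝 0, 0 < σ * (w.2 - f w.1) → framePoint P T w ∈ A) ∨
    (∀ᶠ w : ℝ × ℝ in 𝓝 0, 0 < σ * (w.2 - f w.1) → framePoint P T w ∈ Aᶜ) := by
  obtain ⟨b, hb, hb'⟩ := Metric.eventually_nhds_iff.1 hfr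
  have hc : ∀ᶠ u in 𝓝 (0 : ℝ), ContinuousAt f u ∧ |f u| < b :=
    ((hf.eventually (by simp)).mono fun u hu => hu.continuousAt).and
      ((hf.continuousAt.abs).eventually_lt_const (by simpa [hf0] using hb))
  obtain ⟨a', ha', hc'⟩ := Metric.eventually_nhds_iff.1 hc
  set a := min a' b with ha_def
  have ha : 0 < a := lt_min ha' hb
  have hc'' : ∀ u ∈ Ioo (-a) a, ContinuousAt f u ∧ |f u| < b := fun u hu => by
    refine hc' ?_
    rw [Real.dist_eq, sub_zero]
    exact (abs_lt.2 hu).trans_le (min_le_left _ _)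
  have hpre := isPreconnected_graph_side (a := a) (b := b)
    (fun u hu => (hc'' u hu).1.continuousWithinAt) (fun u hu => (hc'' u hu).2) hσ
  set D := {w : ℝ × ℝ | w.1 ∈ Ioo (-a) a ∧ w.2 ∈ Ioo (-b) b ∧ 0 < σ * (w.2 - f w.1)} with hD
  have hpre' := hpre.image (framePoint P T) (continuous_framePoint P T).continuousOn
  have hdisj : ¬ ((framePoint P T '' D) ∩ frontier A).Nonempty := by
    rintro ⟨_, ⟨w, hw, rfl⟩, hwA⟩
    have h1 : dist w 0 < b := by
      rw [Prod.dist_eq, max_lt_iff]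
      simp only [Prod.fst_zero, Prod.snd_zero, Real.dist_eq, sub_zero]
      exact ⟨(abs_lt.2 hw.1).trans_le (min_le_right _ _), abs_lt.2 hw.2.1⟩
    have := (hb' h1).1 hwA
    have h2 := hw.2.2
    rw [this] at h2
    simp at h2
  have hbox : ∀ᶠ w : ℝ × ℝ in 𝓝 0, w.1 ∈ Ioo (-a) a ∧ w.2 ∈ Ioo (-b) b := by
    refine Filter.Eventually.and ?_ ?_
    · exact (continuous_fst.tendsto (0 : ℝ × ℝ)).eventually
        (Ioo_mem_nhds (by simpa using ha) (by simpa using ha))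
    · exact (continuous_snd.tendsto (0 : ℝ × ℝ)).eventually
        (Ioo_mem_nhds (by simpa using hb) (by simpa using hb))
  by_cases h : ((framePoint P T '' D) ∩ A).Nonempty
  · left
    filter_upwards [hbox] with w hw hw'
    by_contra hwA
    exact hdisj (hpre'.inter_frontier_nonempty' h ⟨_, ⟨w, ⟨hw.1, hw.2, hw'⟩, rfl⟩, hwA⟩)
  · right
    filter_upwards [hbox] with w hw hw' hwA
    exact h ⟨_, ⟨w, ⟨hw.1, hw.2, hw'⟩, rfl⟩, hwA⟩

/-- Differentiating the graph equation identifies the direction of `γ'` with the slope of `f`. A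
vector on the `σ` side of `γ'` therefore leaves the graph to first order on the same side. This
passes from one base point to its neighbours along the curve. -/
theorem eventually_onSide (hγ : IsGeneratingCurve A β γ) (hs : s₀ ∈ Ioo (-β) β)
    (hf : ContDiffAt ℝ 1 f 0)
    (hgr : ∀ᶠ s in 𝓝 s₀, frameSnd (γ s₀) (deriv γ s₀) (γ s) =
        f (frameFst (γ s₀) (deriv γ s₀) (γ s)))
    {σ : ℝ} {B : Set Plane}
    (hB : ∀ᶠ w : ℝ × ℝ in 𝓝 0, 0 < σ * (w.2 - f w.1) →
      framePoint (γ s₀) (deriv γ s₀) w ∈ B) :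
    ∀ᶠ s in 𝓝 s₀, OnSide γ σ B s := by
  set P := γ s₀ with hP
  set T := deriv γ s₀ with hT
  have hTT : T 0 ^ 2 + T 1 ^ 2 = 1 := hγ.deriv_sq hs
  have hγc : ContinuousAt γ s₀ := (hγ.hasDerivAt hs).continuousAt
  have hγ' : ContinuousAt (deriv γ) s₀ := hγ.continuousAt_deriv hs
  have c0 : ∀ i, ContinuousAt (fun s => γ s i) s₀ := fun i => by fun_prop
  have c1 : ∀ i, ContinuousAt (fun s => deriv γ s i) s₀ := fun i => by fun_prop
  have hw : ContinuousAt (fun s => (frameFst P T (γ s), frameSnd P T (γ s))) s₀ := by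
    have := c0 0
    have := c0 1
    simp only [frameFst, frameSnd]
    fun_prop
  have hw0 : (frameFst P T (γ s₀), frameSnd P T (γ s₀)) = (0 : ℝ × ℝ) := by
    simp [frameFst, frameSnd, hP]
  have hf1 : ∀ᶠ w : ℝ × ℝ in 𝓝 0, ContDiffAt ℝ 1 f w.1 :=
    (continuous_fst.tendsto (0 : ℝ × ℝ)).eventually (hf.eventually (by simp))
  have hw1 : Tendsto (fun s => (frameFst P T (γ s), frameSnd P T (γ s))) (𝓝 s₀) (𝓝 0) :=
    hw0 ▸ hw.tendsto
  have e1 := hw1.eventually (hB.eventually_nhds.and hf1)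
  have hpos : ∀ᶠ s in 𝓝 s₀, 0 < deriv γ s 0 * T 0 + deriv γ s 1 * T 1 := by
    have : ContinuousAt (fun s => deriv γ s 0 * T 0 + deriv γ s 1 * T 1) s₀ := by
      have := c1 0
      have := c1 1
      fun_prop
    refine this.eventually_const_lt ?_
    change 0 < T 0 * T 0 + T 1 * T 1
    nlinarith
  filter_upwards [e1, hpos, hgr.eventually_nhds, isOpen_Ioo.mem_nhds hs] with s h1 h2 h3 hsβ
  obtain ⟨h1, h1'⟩ := h1
  intro V hV
  obtain ⟨d0, d1⟩ := Plane.hasDerivAt_iff.1 (hγ.hasDerivAt hsβ)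
  have du : HasDerivAt (fun s => frameFst P T (γ s)) (deriv γ s 0 * T 0 + deriv γ s 1 * T 1) s :=
    ((d0.sub_const (P 0)).mul_const (T 0)).add ((d1.sub_const (P 1)).mul_const (T 1))
  have dv : HasDerivAt (fun s => frameSnd P T (γ s)) (deriv γ s 1 * T 0 - deriv γ s 0 * T 1) s :=
    ((d1.sub_const (P 1)).mul_const (T 0)).sub ((d0.sub_const (P 0)).mul_const (T 1))
  have df : HasDerivAt f (deriv f (frameFst P T (γ s))) (frameFst P T (γ s)) :=
    (h1'.differentiableAt one_ne_zero).hasDerivAt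
  have hslope : deriv γ s 1 * T 0 - deriv γ s 0 * T 1 = deriv f (frameFst P T (γ s)) *
      (deriv γ s 0 * T 0 + deriv γ s 1 * T 1) :=
    dv.unique ((df.comp s du).congr_of_eventuallyEq h3)
  set Vu := V 0 * T 0 + V 1 * T 1 with hVu
  set Vv := V 1 * T 0 - V 0 * T 1 with hVv
  have hσ : 0 < σ * (Vv - deriv f (frameFst P T (γ s)) * Vu) := by
    have h4 : σ * (deriv γ s 0 * V 1 - deriv γ s 1 * V 0) =
        (deriv γ s 0 * T 0 + deriv γ s 1 * T 1) *
          (σ * (Vv - deriv f (frameFst P T (γ s)) * Vu)) := by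
      have h5 : deriv γ s 0 * V 1 - deriv γ s 1 * V 0 = (deriv γ s 0 * T 0 + deriv γ s 1 * T 1) * Vv
          - (deriv γ s 1 * T 0 - deriv γ s 0 * T 1) * Vu := by
        simp only [hVu, hVv]
        linear_combination -(deriv γ s 0 * V 1 - deriv γ s 1 * V 0) * hTT
      rw [h5, hslope]; ring
    rw [h4] at hV
    exact (mul_pos_iff_of_pos_left h2).1 hV
  have hg : HasDerivAt (fun t => σ * (frameSnd P T (γ s) + t * Vv -
      f (frameFst P T (γ s) + t * Vu))) (σ * (Vv - deriv f (frameFst P T (γ s)) * Vu)) 0 := by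
    have h4 : HasDerivAt (fun t : ℝ => frameFst P T (γ s) + t * Vu) Vu 0 := by
      simpa using ((hasDerivAt_id (0 : ℝ)).mul_const Vu).const_add (frameFst P T (γ s))
    have h5 : HasDerivAt (fun t : ℝ => frameSnd P T (γ s) + t * Vv) Vv 0 := by
      simpa using ((hasDerivAt_id (0 : ℝ)).mul_const Vv).const_add (frameSnd P T (γ s))
    have df' : HasDerivAt f (deriv f (frameFst P T (γ s))) (frameFst P T (γ s) + 0 * Vu) := by
      simpa using df
    exact (h5.sub (df'.comp (0 : ℝ) h4)).const_mul σ
  have hg0 := hg.eventually_pos_of_zero (by simp [h3.self_of_nhds]) hσ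
  have htend : Tendsto (fun t : ℝ => (frameFst P T (γ s) + t * Vu, frameSnd P T (γ s) + t * Vv))
      (𝓝 0) (𝓝 (frameFst P T (γ s), frameSnd P T (γ s))) := by
    have : Continuous (fun t : ℝ =>
      (frameFst P T (γ s) + t * Vu, frameSnd P T (γ s) + t * Vv)) := by fun_prop
    simpa using this.tendsto 0
  filter_upwards [hg0, nhdsWithin_le_nhds (htend.eventually h1)] with t ht ht'
  have := ht' ht
  convert this using 1
  have hq := framePoint_frameFst_frameSnd hTT (P := P) (γ s)
  have hq0 : framePoint P T (frameFst P T (γ s), frameSnd P T (γ s)) 0 = γ s 0 := by rw [hq]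
  have hq1 : framePoint P T (frameFst P T (γ s), frameSnd P T (γ s)) 1 = γ s 1 := by rw [hq]
  simp only [framePoint_zero, framePoint_one] at hq0 hq1
  refine Plane.ext ?_ ?_
  · simp only [framePoint_zero, PiLp.add_apply, PiLp.smul_apply, smul_eq_mul, hVu, hVv]
    linear_combination -hq0 - t * V 0 * hTT
  · simp only [framePoint_one, PiLp.add_apply, PiLp.smul_apply, smul_eq_mul, hVu, hVv]
    linear_combination -hq1 - t * V 1 * hTT

end IsGeneratingCurve

namespace IsGeneratingCurve

variable {A : Set Plane} {β : ℝ} {γ : ℝ → Plane} {s₀ : ℝ}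

theorem not_onSide_and_onSide_compl (hγ : IsGeneratingCurve A β γ) {s σ : ℝ}
    (hs : s ∈ Ioo (-β) β) (hσ : σ = 1 ∨ σ = -1) (h1 : OnSide γ σ A s) (h2 : OnSide γ σ Aᶜ s) :
    False := by
  have hTT := hγ.deriv_sq hs
  have hpos : 0 < σ * (deriv γ s 0 * (!₂[-(σ * deriv γ s 1), σ * deriv γ s 0] : Plane) 1 -
      deriv γ s 1 * (!₂[-(σ * deriv γ s 1), σ * deriv γ s 0] : Plane) 0) := by
    have hσ2 : σ ^ 2 = 1 := by rcases hσ with rfl | rfl <;> norm_num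
    have : σ * (deriv γ s 0 * (!₂[-(σ * deriv γ s 1), σ * deriv γ s 0] : Plane) 1 -
      deriv γ s 1 * (!₂[-(σ * deriv γ s 1), σ * deriv γ s 0] : Plane) 0) = 1 := by
      simp
      linear_combination σ ^ 2 * hTT + hσ2
    rw [this]; exact one_pos
  obtain ⟨t, ht1, ht2⟩ := ((h1 _ hpos).and (h2 _ hpos)).exists
  exact ht2 ht1

/-- At a rightmost point the abscissa is maximal, so the tangent is vertical. It points upwards
because the curve is above the axis for small positive parameters. -/
theorem deriv_zero (hγ : IsGeneratingCurve A β γ) : deriv γ 0 0 = 0 ∧ deriv γ 0 1 = 1 := by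
  have h0 : (0 : ℝ) ∈ Ioo (-β) β := ⟨by linarith [hγ.pos], hγ.pos⟩
  obtain ⟨d0, d1⟩ := Plane.hasDerivAt_iff.1 (hγ.hasDerivAt h0)
  have hmax : IsLocalMax (fun t => γ t 0) 0 := by
    filter_upwards [isOpen_Ioo.mem_nhds h0] with s hs
    exact hγ.rightmost _ (hγ.mem_frontier s (Ioo_subset_Icc_self hs))
  have h1 : deriv γ 0 0 = 0 := hmax.hasDerivAt_eq_zero d0
  refine ⟨h1, ?_⟩
  have h2 := hγ.deriv_sq h0
  rw [h1] at h2
  have h3 : (deriv γ 0 1 - 1) * (deriv γ 0 1 + 1) = 0 := by linear_combination h2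
  rcases mul_eq_zero.1 h3 with h | h
  · linarith
  · exfalso
    have h4 : HasDerivAt (fun t => -γ t 1) 1 0 := by
      have := d1.neg
      rwa [show deriv γ 0 1 = -1 by linarith, neg_neg] at this
    have h5 := h4.eventually_pos_of_zero (by simp [hγ.start_axis]) one_pos
    obtain ⟨t, ht1, ht2⟩ := (h5.and (Ioo_mem_nhdsGT hγ.pos)).exists
    linarith [hγ.above t ht2]

/-- The region lies to the left of the generating curve, and its complement to the right. -/
theorem onSide (hγ : IsGeneratingCurve A β γ) (hA : IsOpen A) (hx : ∀ q ∈ A, q 0 ≤ γ 0 0)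
    {s : ℝ} (hs : s ∈ Ioo (-β) β) : OnSide γ 1 A s ∧ OnSide γ (-1) Aᶜ s := by
  have h0 : (0 : ℝ) ∈ Ioo (-β) β := ⟨by linarith [hγ.pos], hγ.pos⟩
  -- Being to the left or right of the region is locally constant along the curve. Connectedness of
  -- the parameter interval carries it from `0` to `s`.
  have key : ∀ r ∈ Ioo (-β) β, ∀ᶠ t in 𝓝[Ioo (-β) β] r,
      ((OnSide γ 1 A r ∧ OnSide γ (-1) Aᶜ r) → (OnSide γ 1 A t ∧ OnSide γ (-1) Aᶜ t)) ∧
      ((OnSide γ 1 A t ∧ OnSide γ (-1) Aᶜ t) → (OnSide γ 1 A r ∧ OnSide γ (-1) Aᶜ r)) := by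
    intro r hr
    obtain ⟨f, hf, hf0, -, hgr, hfr⟩ := hγ.exists_local_graph hr
    have side : ∀ σ : ℝ, (σ = 1 ∨ σ = -1) → (∀ᶠ t in 𝓝 r, OnSide γ σ A t) ∨
        ∀ᶠ t in 𝓝 r, OnSide γ σ Aᶜ t := fun σ hσ =>
      (side_dichotomy hf hf0 hfr hσ).imp (hγ.eventually_onSide hr hf hgr)
        (hγ.eventually_onSide hr hf hgr)
    have side' : ∀ σ : ℝ, (σ = 1 ∨ σ = -1) → ∀ᶠ t in 𝓝[Ioo (-β) β] r,
        (OnSide γ σ A r ↔ OnSide γ σ A t) ∧ (OnSide γ σ Aᶜ r ↔ OnSide γ σ Aᶜ t) := by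
      intro σ hσ
      rcases side σ hσ with h | h
      · filter_upwards [nhdsWithin_le_nhds h, self_mem_nhdsWithin] with t ht htβ
        have hr' := h.self_of_nhds
        exact ⟨iff_of_true hr' ht, iff_of_false
          (fun h' => hγ.not_onSide_and_onSide_compl hr hσ hr' h')
          (fun h' => hγ.not_onSide_and_onSide_compl htβ hσ ht h')⟩
      · filter_upwards [nhdsWithin_le_nhds h, self_mem_nhdsWithin] with t ht htβ
        have hr' := h.self_of_nhds
        exact ⟨iff_of_false
          (fun h' => hγ.not_onSide_and_onSide_compl hr hσ h' hr')
          (fun h' => hγ.not_onSide_and_onSide_compl htβ hσ h' ht), iff_of_true hr' ht⟩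
    filter_upwards [side' 1 (Or.inl rfl), side' (-1) (Or.inr rfl)] with t ht1 ht2
    rw [ht1.1, ht2.2]
    exact ⟨id, id⟩
  have hprop := isPreconnected_Ioo.induction₂'
    (fun r t => (OnSide γ 1 A r ∧ OnSide γ (-1) Aᶜ r) → (OnSide γ 1 A t ∧ OnSide γ (-1) Aᶜ t))
    key (fun r t u _ _ _ h h' hr => h' (h hr)) h0 hs
  refine hprop ?_
  obtain ⟨hT0, hT1⟩ := hγ.deriv_zero
  have hright : OnSide γ (-1) Aᶜ 0 := by
    intro V hV
    rw [hT0, hT1] at hV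
    filter_upwards [self_mem_nhdsWithin] with t ht htA
    have := hx _ htA
    simp only [PiLp.add_apply, PiLp.smul_apply, smul_eq_mul] at this
    have h2 := mul_pos (mem_Ioi.1 ht) (show 0 < V 0 by linarith)
    linarith
  refine ⟨?_, hright⟩
  obtain ⟨f, hf, hf0, -, hgr, hfr⟩ := hγ.exists_local_graph h0
  rcases side_dichotomy hf hf0 hfr (Or.inl rfl) with hup | hup
  · exact (hγ.eventually_onSide h0 hf hgr hup).self_of_nhds
  · rcases side_dichotomy hf hf0 hfr (Or.inr rfl) with hlow | hlow
    · exact (hγ.not_onSide_and_onSide_compl h0 (Or.inr rfl)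
        (hγ.eventually_onSide h0 hf hgr hlow).self_of_nhds hright).elim
    · exfalso
      -- If the left side were outside too, so would be a whole neighbourhood of `γ 0`, since
      -- frontier points do not belong to the open set `A`. But `γ 0` is in the closure of `A`.
      have hout : ∀ᶠ w : ℝ × ℝ in 𝓝 0, framePoint (γ 0) (deriv γ 0) w ∈ Aᶜ := by
        filter_upwards [hup, hlow, hfr] with w h1 h2 h3
        rcases lt_trichotomy w.2 (f w.1) with h | h | h
        · exact h2 (by linarith)
        · have := h3.2 h
          rw [hA.frontier_eq] at this
          exact this.2
        · exact h1 (by linarith)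
      have hTT := hγ.deriv_sq h0
      have hcl : γ 0 ∈ closure A :=
        frontier_subset_closure (hγ.mem_frontier 0 (Ioo_subset_Icc_self h0))
      have hcont : Tendsto (fun q => (frameFst (γ 0) (deriv γ 0) q, frameSnd (γ 0) (deriv γ 0) q))
          (𝓝 (γ 0)) (𝓝 0) := by
        refine Continuous.tendsto' ?_ _ _ (by simp [frameFst, frameSnd])
        simp only [frameFst, frameSnd]
        fun_prop
      obtain ⟨q, hq1, hq2⟩ := (mem_closure_iff_nhds.1 hcl) _ (hcont.eventually hout)
      change framePoint _ _ (_, _) ∈ Aᶜ at hq1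
      rw [framePoint_frameFst_frameSnd hTT] at hq1
      exact hq1 hq2

/-- Near an interior point of the curve, the region is the epigraph of a `C¹` function over the
tangent line. -/
theorem exists_local_epigraph (hγ : IsGeneratingCurve A β γ) (hA : IsOpen A)
    (hx : ∀ q ∈ A, q 0 ≤ γ 0 0) (hs : s₀ ∈ Ioo (-β) β) :
    ∃ f : ℝ → ℝ, ContDiffAt ℝ 1 f 0 ∧ f 0 = 0 ∧ deriv f 0 = 0 ∧
      (∀ᶠ s in 𝓝 s₀, frameSnd (γ s₀) (deriv γ s₀) (γ s) =
        f (frameFst (γ s₀) (deriv γ s₀) (γ s))) ∧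
      (∀ᶠ w : ℝ × ℝ in 𝓝 0, framePoint (γ s₀) (deriv γ s₀) w ∈ A ↔ f w.1 < w.2) ∧
      ∀ᶠ w : ℝ × ℝ in 𝓝 0, framePoint (γ s₀) (deriv γ s₀) w ∈ frontier A ↔ w.2 = f w.1 := by
  obtain ⟨f, hf, hf0, hf', hgr, hfr⟩ := hγ.exists_local_graph hs
  refine ⟨f, hf, hf0, hf', hgr, ?_, hfr⟩
  obtain ⟨h1, h2⟩ := hγ.onSide hA hx hs
  rcases side_dichotomy hf hf0 hfr (Or.inl rfl) with hup | hup
  · rcases side_dichotomy hf hf0 hfr (Or.inr rfl) with hlow | hlow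
    · exact (hγ.not_onSide_and_onSide_compl hs (Or.inr rfl)
        (hγ.eventually_onSide hs hf hgr hlow).self_of_nhds h2).elim
    · filter_upwards [hup, hlow, hfr] with w g1 g2 g3
      constructor
      · intro hw
        by_contra! h
        rcases h.lt_or_eq with h | h
        · exact g2 (by linarith) hw
        · have := g3.2 h
          rw [hA.frontier_eq] at this
          exact this.2 hw
      · intro h
        exact g1 (by linarith)
  · exact (hγ.not_onSide_and_onSide_compl hs (Or.inl rfl) h1
      (hγ.eventually_onSide hs hf hgr hup).self_of_nhds).elim

/-- The tangent restriction for sections of spherically symmetric sets. -/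
theorem inner_deriv_nonpos (hγ : IsGeneratingCurve A β γ) (hA : IsOpen A)
    (hx : ∀ q ∈ A, q 0 ≤ γ 0 0)
    (hsym : ∀ q ∈ A, ∀ q' : Plane, ‖q'‖ = ‖q‖ → q 0 ≤ q' 0 → q' ∈ A)
    {s : ℝ} (hs : s ∈ Ioo 0 β) : inner ℝ (γ s) (deriv γ s) ≤ 0 := by
  have hs' : s ∈ Ioo (-β) β := ⟨by linarith [hs.1, hγ.pos], hs.2⟩
  obtain ⟨h1, h2⟩ := hγ.onSide hA hx hs'
  by_contra! h
  rw [Plane.inner_eq] at h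
  -- The two directions are the quarter turns of `γ s`, so both displaced points have the same norm.
  -- The point outside `A` has the larger abscissa because `γ s` is above the axis.
  have e1 := h1 !₂[-γ s 1, γ s 0] (by simp; linarith)
  have e2 := h2 !₂[γ s 1, -γ s 0] (by simp; linarith)
  obtain ⟨t, ⟨ht1, ht2⟩, ht⟩ := ((e1.and e2).and self_mem_nhdsWithin).exists
  refine ht2 (hsym _ ht1 _ ?_ ?_)
  · rw [← sq_eq_sq₀ (norm_nonneg _) (norm_nonneg _), Plane.norm_sq, Plane.norm_sq]
    simp
    ring
  · have := mul_pos (mem_Ioi.1 ht) (hγ.above s hs)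
    simp
    linarith

end IsGeneratingCurve

/-! ### Projection to the meridian half-plane and comparison of surfaces of revolution. -/

section Meridian

variable {n : ℕ} [NeZero n]

/-- The component of `x` orthogonal to the `e₁`-axis. -/
noncomputable def radialPart (x : EuclideanSpace ℝ (Fin n)) : EuclideanSpace ℝ (Fin n) :=
  x - EuclideanSpace.single 0 (x 0)

/-- The projection of `ℝⁿ` to the meridian half-plane: a point goes to its abscissa and its
distance to the `e₁`-axis. -/
noncomputable def meridian (x : EuclideanSpace ℝ (Fin n)) : Plane := !₂[x 0, ‖radialPart x‖]

@[simp] theorem meridian_zero (x : EuclideanSpace ℝ (Fin n)) : meridian x 0 = x 0 := rfl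

@[simp] theorem meridian_one (x : EuclideanSpace ℝ (Fin n)) : meridian x 1 = ‖radialPart x‖ := rfl

@[simp] theorem radialPart_apply_zero (x : EuclideanSpace ℝ (Fin n)) : radialPart x 0 = 0 := by
  simp [radialPart]

theorem continuous_radialPart : Continuous (radialPart (n := n)) := by
  have : (radialPart (n := n)) = fun x =>
      x - (x 0) • (EuclideanSpace.single 0 1 : EuclideanSpace ℝ (Fin n)) := by
    funext x
    ext i
    by_cases h : i = 0
    · subst h; simp [radialPart]
    · simp [radialPart, h]
  rw [this]
  fun_prop

theorem continuous_meridian : Continuous (meridian (n := n)) := by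
  unfold meridian
  have := continuous_radialPart (n := n)
  refine (PiLp.continuous_toLp 2 _).comp (continuous_pi fun i => ?_)
  fin_cases i <;> simp <;> fun_prop

theorem single_add_radialPart (x : EuclideanSpace ℝ (Fin n)) :
    EuclideanSpace.single 0 (x 0) + radialPart x = x := by
  simp [radialPart]

theorem norm_sq_single_add {v : EuclideanSpace ℝ (Fin n)} (hv : v 0 = 0) (a : ℝ) :
    ‖EuclideanSpace.single 0 a + v‖ ^ 2 = a ^ 2 + ‖v‖ ^ 2 := by
  rw [norm_add_sq_real]
  simp [EuclideanSpace.inner_single_left, hv]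

theorem radialPart_single_add {v : EuclideanSpace ℝ (Fin n)} (hv : v 0 = 0) (a : ℝ) :
    radialPart (EuclideanSpace.single 0 a + v) = v := by
  simp [radialPart, hv]

theorem meridian_single_add {v : EuclideanSpace ℝ (Fin n)} (hv : v 0 = 0) (a : ℝ) :
    meridian (EuclideanSpace.single 0 a + v) = !₂[a, ‖v‖] := by
  refine Plane.ext ?_ ?_
  · simp [hv]
  · simp [radialPart_single_add hv]

@[simp] theorem norm_meridian (x : EuclideanSpace ℝ (Fin n)) : ‖meridian x‖ = ‖x‖ := by
  rw [← sq_eq_sq₀ (norm_nonneg _) (norm_nonneg _), Plane.norm_sq, meridian_zero, meridian_one,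
    ← norm_sq_single_add (radialPart_apply_zero x), single_add_radialPart]

/-- The squared distance splits into the squared distance in the half-plane and an angular term. The
latter is nonnegative by Cauchy–Schwarz and is proportional to both radii, so shrinking the radii
along fixed directions shrinks it. -/
theorem norm_sq_sub_eq {v w : EuclideanSpace ℝ (Fin n)} (hv : v 0 = 0) (hw : w 0 = 0) (a b : ℝ) :
    ‖(EuclideanSpace.single 0 a + v) - (EuclideanSpace.single 0 b + w)‖ ^ 2 =
      (a - b) ^ 2 + (‖v‖ - ‖w‖) ^ 2 + 2 * (‖v‖ * ‖w‖ - inner ℝ v w) := by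
  have h : (EuclideanSpace.single 0 a + v) - (EuclideanSpace.single 0 b + w) =
      EuclideanSpace.single 0 (a - b) + (v - w) := by
    have : (EuclideanSpace.single 0 (a - b) : EuclideanSpace ℝ (Fin n)) =
        EuclideanSpace.single 0 a - EuclideanSpace.single 0 b := by
      ext i
      by_cases h : i = 0
      · subst h; simp
      · simp [h]
    rw [this]; abel
  rw [h, norm_sq_single_add (by simp [hv, hw]), norm_sub_sq_real]
  ring

/-- Shrinking a curve in the meridian half-plane shrinks the surface of revolution. -/
theorem hausdorffMeasure_preimage_meridian_le {ι : Type*} [Nonempty ι] {J : Set ι}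
    {c₁ c₂ : ι → Plane} {d : ℝ} (hd : 0 ≤ d) (h1 : ∀ s ∈ J, 0 < c₁ s 1)
    (h12 : ∀ s ∈ J, c₁ s 1 ≤ c₂ s 1)
    (hdist : ∀ s ∈ J, ∀ t ∈ J, dist (c₁ s) (c₁ t) ≤ dist (c₂ s) (c₂ t)) :
    μH[d] (meridian (n := n) ⁻¹' (c₁ '' J)) ≤ μH[d] (meridian (n := n) ⁻¹' (c₂ '' J)) := by
  -- The map `g` carries a point over `c₂ s` to the point over `c₁ s` in the same half-plane through
  -- the axis. It is 1-Lipschitz and covers the smaller surface.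
  set σ : EuclideanSpace ℝ (Fin n) → ι := fun x => Function.invFunOn c₂ J (meridian x) with hσ
  set g : EuclideanSpace ℝ (Fin n) → EuclideanSpace ℝ (Fin n) := fun x =>
    EuclideanSpace.single 0 (c₁ (σ x) 0) + (c₁ (σ x) 1 / c₂ (σ x) 1) • radialPart x with hg
  have hσJ : ∀ x ∈ meridian (n := n) ⁻¹' (c₂ '' J), σ x ∈ J ∧ c₂ (σ x) = meridian x :=
    fun x hx => ⟨Function.invFunOn_mem hx, Function.invFunOn_eq hx⟩
  have hsub : meridian (n := n) ⁻¹' (c₁ '' J) ⊆ g '' (meridian (n := n) ⁻¹' (c₂ '' J)) := by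
    rintro z ⟨s, hs, hsz⟩
    have hp1 := h1 s hs
    have hp2 := hp1.trans_le (h12 s hs)
    set x : EuclideanSpace ℝ (Fin n) :=
      EuclideanSpace.single 0 (c₂ s 0) + (c₂ s 1 / c₁ s 1) • radialPart z with hx
    have hv : ((c₂ s 1 / c₁ s 1) • radialPart z) 0 = 0 := by simp
    have hz1 : ‖radialPart z‖ = c₁ s 1 := by rw [hsz]; rfl
    have hmx : meridian x = c₂ s := by
      rw [hx, meridian_single_add hv]
      refine Plane.ext (by simp) ?_
      simp only [Matrix.cons_val_one, Matrix.cons_val_fin_one]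
      rw [norm_smul, hz1, Real.norm_of_nonneg (by positivity), div_mul_cancel₀ _ hp1.ne']
    have hxmem : x ∈ meridian (n := n) ⁻¹' (c₂ '' J) := ⟨s, hs, hmx.symm⟩
    obtain ⟨hσ1, hσ2⟩ := hσJ x hxmem
    -- The chosen parameter need not be `s`, but equal values of `c₂` force equal values of `c₁` by
    -- the distance hypothesis.
    have hc1 : c₁ (σ x) = c₁ s := by
      have := hdist _ hσ1 _ hs
      rw [hσ2, hmx, dist_self] at this
      exact dist_le_zero.1 this
    refine ⟨x, hxmem, ?_⟩
    simp only [hg]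
    rw [hc1, hσ2, hmx, hx, radialPart_single_add hv, smul_smul]
    have : c₁ s 1 / c₂ s 1 * (c₂ s 1 / c₁ s 1) = 1 := by
      field_simp
    rw [this, one_smul]
    have hz0 : c₁ s 0 = z 0 := by rw [hsz]; rfl
    rw [hz0, single_add_radialPart]
  have hlip : LipschitzOnWith 1 g (meridian (n := n) ⁻¹' (c₂ '' J)) := by
    refine LipschitzOnWith.of_dist_le_mul fun x hx x' hx' => ?_
    obtain ⟨hs, hsx⟩ := hσJ x hx
    obtain ⟨hs', hsx'⟩ := hσJ x' hx'
    have hp1 := h1 _ hs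
    have hp1' := h1 _ hs'
    have h12s := h12 _ hs
    have h12s' := h12 _ hs'
    have hx1 : ‖radialPart x‖ = c₂ (σ x) 1 := by rw [hsx]; rfl
    have hx1' : ‖radialPart x'‖ = c₂ (σ x') 1 := by rw [hsx']; rfl
    have hx0 : x 0 = c₂ (σ x) 0 := by rw [hsx]; rfl
    have hx0' : x' 0 = c₂ (σ x') 0 := by rw [hsx']; rfl
    have hd1 := hdist _ hs _ hs'
    rw [NNReal.coe_one, one_mul, dist_eq_norm, dist_eq_norm,
      ← sq_le_sq₀ (norm_nonneg _) (norm_nonneg _)]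
    rw [dist_eq_norm, dist_eq_norm, ← sq_le_sq₀ (norm_nonneg _) (norm_nonneg _), Plane.norm_sq,
      Plane.norm_sq] at hd1
    simp only [PiLp.sub_apply] at hd1
    conv_rhs => rw [← single_add_radialPart x, ← single_add_radialPart x']
    simp only [hg]
    rw [norm_sq_sub_eq (by simp) (by simp), norm_sq_sub_eq (by simp) (by simp), norm_smul,
      norm_smul, inner_smul_left, inner_smul_right, hx1, hx1', hx0, hx0']
    have hCS : inner ℝ (radialPart x) (radialPart x') ≤ c₂ (σ x) 1 * c₂ (σ x') 1 := by
      rw [← hx1, ← hx1']; exact real_inner_le_norm _ _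
    have hp2 := hp1.trans_le h12s
    have hp2' := hp1'.trans_le h12s'
    generalize inner ℝ (radialPart x) (radialPart x') = I at *
    rw [Real.norm_of_nonneg (by positivity), Real.norm_of_nonneg (by positivity),
      div_mul_cancel₀ _ hp2.ne', div_mul_cancel₀ _ hp2'.ne']
    simp only [conj_trivial]
    have hk : c₁ (σ x) 1 * c₁ (σ x') 1 - c₁ (σ x) 1 / c₂ (σ x) 1 * (c₁ (σ x') 1 / c₂ (σ x') 1 * I)
        = (c₁ (σ x) 1 / c₂ (σ x) 1) * (c₁ (σ x') 1 / c₂ (σ x') 1) *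
          (c₂ (σ x) 1 * c₂ (σ x') 1 - I) := by
      field_simp
    rw [hk]
    have hk1 : (c₁ (σ x) 1 / c₂ (σ x) 1) * (c₁ (σ x') 1 / c₂ (σ x') 1) ≤ 1 := by
      refine mul_le_one₀ ((div_le_one hp2).2 h12s) (by positivity) ((div_le_one hp2').2 h12s')
    have := mul_le_mul_of_nonneg_right hk1 (sub_nonneg.2 hCS)
    linarith
  calc μH[d] (meridian (n := n) ⁻¹' (c₁ '' J))
      ≤ μH[d] (g '' (meridian (n := n) ⁻¹' (c₂ '' J))) := measure_mono hsub
    _ ≤ ((1 : NNReal) : ENNReal) ^ d * μH[d] (meridian (n := n) ⁻¹' (c₂ '' J)) :=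
        hlip.hausdorffMeasure_image_le hd
    _ = _ := by simp

end Meridian

/-! ### Hausdorff measure of cylinders about the axis. -/

section Cylinder

variable {m : ℕ}

theorem preimage_meridian_horizontal {n : ℕ} [NeZero n] (B : Set ℝ) (Y : ℝ) :
    meridian (n := n) ⁻¹' ((fun s => !₂[s, Y]) '' B) =
      (fun x : EuclideanSpace ℝ (Fin n) => x 0) ⁻¹' B ∩ {x | ‖radialPart x‖ = Y} := by
  ext x
  constructor
  · rintro ⟨s, hs, hsx⟩
    have h0 : s = x 0 := congrArg (fun q : Plane => q 0) hsx
    have h1 : Y = ‖radialPart x‖ := congrArg (fun q : Plane => q 1) hsx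
    exact ⟨by rw [mem_preimage, ← h0]; exact hs, h1.symm⟩
  · rintro ⟨h0, h1⟩
    exact ⟨x 0, h0, Plane.ext rfl (by simpa using h1.symm)⟩

/-- Forgetting the last coordinate is 1-Lipschitz, and the image of the cylinder contains the open
set `W` in `Fin (m + 1) → ℝ`, where Hausdorff measure is Lebesgue measure. -/
theorem hausdorffMeasure_horizontal_pos (m : ℕ) :
    0 < μH[(m : ℝ) + 1] (meridian (n := m + 2) ⁻¹' ((fun s => !₂[s, 1]) '' Icc 0 1)) := by
  set S := meridian (n := m + 2) ⁻¹' ((fun s => !₂[s, 1]) '' Icc 0 1) with hS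
  set g : EuclideanSpace ℝ (Fin (m + 2)) → (Fin (m + 1) → ℝ) :=
    fun x i => x i.castSucc with hg
  set W : Set (Fin (m + 1) → ℝ) := {w | w 0 ∈ Ioo 0 1 ∧ ∑ i : Fin m, w i.succ ^ 2 < 1} with hW
  have hWo : IsOpen W := by
    have h1 : Continuous fun w : Fin (m + 1) → ℝ => ∑ i : Fin m, w i.succ ^ 2 := by fun_prop
    exact (isOpen_Ioo.preimage (continuous_apply 0)).inter (isOpen_lt h1 continuous_const)
  have hWne : W.Nonempty := by
    refine ⟨Fin.cons (1 / 2) 0, ?_, ?_⟩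
    · simp only [Fin.cons_zero]; norm_num
    · simp
  have hsub : W ⊆ g '' S := by
    intro w hw
    obtain ⟨hw0, hw1⟩ := hw
    set x : EuclideanSpace ℝ (Fin (m + 2)) :=
      WithLp.toLp 2 (Fin.snoc (α := fun _ => ℝ) w (√(1 - ∑ i : Fin m, w i.succ ^ 2))) with hx
    have hx0 : x 0 = w 0 := by
      have : (0 : Fin (m + 2)) = (0 : Fin (m + 1)).castSucc := rfl
      rw [this]
      simp only [hx, Fin.snoc_castSucc]
    refine ⟨x, ?_, ?_⟩
    · rw [hS, preimage_meridian_horizontal]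
      refine ⟨?_, ?_⟩
      · rw [mem_preimage, hx0]
        exact Ioo_subset_Icc_self hw0
      · have h1 : ‖x‖ ^ 2 = w 0 ^ 2 + 1 := by
          rw [EuclideanSpace.norm_sq_eq, Fin.sum_univ_castSucc]
          simp only [hx, Fin.snoc_castSucc, Fin.snoc_last, Real.norm_eq_abs, sq_abs]
          rw [Fin.sum_univ_succ, Real.sq_sqrt (by linarith)]
          ring
        have h2 : ‖x‖ ^ 2 = x 0 ^ 2 + ‖radialPart x‖ ^ 2 := by
          conv_lhs => rw [← single_add_radialPart x]
          exact norm_sq_single_add (radialPart_apply_zero x) _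
        rw [hx0] at h2
        have h3 : ‖radialPart x‖ ^ 2 = 1 := by linarith
        exact (pow_eq_one_iff_of_nonneg (norm_nonneg _) two_ne_zero).1 h3
    · funext i
      simp only [hg, hx, Fin.snoc_castSucc]
  have hlip : LipschitzOnWith 1 g S := by
    refine LipschitzOnWith.of_dist_le_mul fun x _ y _ => ?_
    rw [NNReal.coe_one, one_mul, dist_pi_le_iff dist_nonneg]
    intro i
    rw [Real.dist_eq, EuclideanSpace.dist_eq]
    refine Real.le_sqrt_of_sq_le ?_
    rw [sq_abs]
    have := Finset.single_le_sum (f := fun j : Fin (m + 2) => dist (x j) (y j) ^ 2)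
      (fun j _ => sq_nonneg _) (Finset.mem_univ i.castSucc)
    simpa [Real.dist_eq, hg] using this
  have h1 := hlip.hausdorffMeasure_image_le (d := (m : ℝ) + 1) (by positivity)
  have h2 : (μH[(m : ℝ) + 1] : Measure (Fin (m + 1) → ℝ)) = volume := by
    have := hausdorffMeasure_pi_real (ι := Fin (m + 1))
    rwa [Fintype.card_fin, Nat.cast_add, Nat.cast_one] at this
  have h3 : 0 < μH[(m : ℝ) + 1] W := by rw [h2]; exact hWo.measure_pos volume hWne
  refine h3.trans_le ((measure_mono hsub).trans (h1.trans ?_))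
  simp

/-- The measure of pieces of the unit cylinder is proportional to their length. -/
theorem exists_hausdorffMeasure_horizontal {a₀ b₀ : ℝ} (hab : a₀ < b₀)
    (hfin : μH[(m : ℝ) + 1] (meridian (n := m + 2) ⁻¹' ((fun s => !₂[s, 1]) '' Icc a₀ b₀)) ≠ ⊤) :
    ∃ C : ℝ≥0, 0 < C ∧ ∀ B : Set ℝ, MeasurableSet B →
      μH[(m : ℝ) + 1] (meridian (n := m + 2) ⁻¹' ((fun s => !₂[s, 1]) '' B)) = C * volume B := by
  have hco : Continuous (fun x : EuclideanSpace ℝ (Fin (m + 2)) => x 0) := by fun_prop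
  have hcyl : MeasurableSet {x : EuclideanSpace ℝ (Fin (m + 2)) | ‖radialPart x‖ = 1} :=
    (isClosed_eq continuous_radialPart.norm continuous_const).measurableSet
  -- Projected to the axis, the measure of the unit cylinder is invariant under translations, and it
  -- is locally finite because one segment has finite measure. Uniqueness of Haar measure makes it a
  -- multiple of length, whose factor is never computed.
  set ν : Measure ℝ := (μH[(m : ℝ) + 1].restrict
    {x : EuclideanSpace ℝ (Fin (m + 2)) | ‖radialPart x‖ = 1}).map (fun x => x 0) with hν
  have hνB : ∀ B, MeasurableSet B → ν B =
      μH[(m : ℝ) + 1] (meridian (n := m + 2) ⁻¹' ((fun s => !₂[s, 1]) '' B)) := by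
    intro B hB
    rw [hν, Measure.map_apply hco.measurable hB,
      Measure.restrict_apply (hco.measurable hB), preimage_meridian_horizontal]
  have htrans : ∀ (c : ℝ) (B : Set ℝ), MeasurableSet B → ν ((fun x => c + x) ⁻¹' B) = ν B := by
    intro c B hB
    rw [hνB _ ((measurable_const_add c) hB), hνB _ hB]
    rw [preimage_meridian_horizontal, preimage_meridian_horizontal]
    conv_rhs => rw [← (IsometryEquiv.addLeft
      (EuclideanSpace.single 0 c : EuclideanSpace ℝ (Fin (m + 2)))).hausdorffMeasure_preimage]
    congr 1
    ext x
    have h1 : radialPart (EuclideanSpace.single 0 c + x) = radialPart x := by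
      ext i
      by_cases h : i = 0
      · subst h; simp
      · simp [radialPart, h]
    simp [h1]
  have hinv : ν.IsAddLeftInvariant := by
    refine ⟨fun c => ?_⟩
    ext B hB
    rw [Measure.map_apply (measurable_const_add c) hB, htrans c B hB]
  have hloc : IsLocallyFiniteMeasure ν := by
    refine ⟨fun x => ⟨(fun y => ((a₀ + b₀) / 2 - x) + y) ⁻¹' Icc a₀ b₀, ?_, ?_⟩⟩
    · refine (by fun_prop : ContinuousAt (fun y => ((a₀ + b₀) / 2 - x) + y) x).preimage_mem_nhds ?_
      rw [sub_add_cancel]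
      exact Icc_mem_nhds (by linarith) (by linarith)
    · rw [htrans _ _ measurableSet_Icc, hνB _ measurableSet_Icc]
      exact hfin.lt_top
  have hC := Measure.isAddLeftInvariant_eq_smul ν (volume : Measure ℝ)
  set C := Measure.addHaarScalarFactor ν (volume : Measure ℝ) with hCdef
  have hform : ∀ B : Set ℝ, MeasurableSet B →
      μH[(m : ℝ) + 1] (meridian (n := m + 2) ⁻¹' ((fun s => !₂[s, 1]) '' B)) = C * volume B := by
    intro B hB
    rw [← hνB B hB, hC]
    rfl
  refine ⟨C, ?_, hform⟩
  have h1 := hausdorffMeasure_horizontal_pos m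
  rw [hform _ measurableSet_Icc] at h1
  rw [pos_iff_ne_zero]
  rintro h
  rw [h] at h1
  simp at h1

/-- A cylinder of radius `Y` is a multiple of a cylinder of radius one. -/
theorem preimage_meridian_cylinder {a b L Y : ℝ} (hL : 0 < L) (hY : 0 < Y) (hab : a ≤ b) :
    meridian (n := m + 2) ⁻¹' ((fun s => !₂[L * s, Y]) '' Icc a b) =
      Y • (meridian (n := m + 2) ⁻¹' ((fun s => !₂[s, 1]) '' Icc (L * a / Y) (L * b / Y))) := by
  have h1 : (fun s => (!₂[L * s, Y] : Plane)) '' Icc a b =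
      (fun s => !₂[s, Y]) '' Icc (L * a) (L * b) := by
    rw [← image_mul_left_Icc hL.le hab, image_image]
  rw [h1, preimage_meridian_horizontal, preimage_meridian_horizontal]
  ext x
  rw [mem_smul_set_iff_inv_smul_mem₀ hY.ne']
  have h2 : radialPart (Y⁻¹ • x) = Y⁻¹ • radialPart x := by
    ext i
    by_cases h : i = 0
    · subst h; simp
    · simp [radialPart, h]
  simp only [mem_inter_iff, mem_preimage, mem_Icc, PiLp.smul_apply, smul_eq_mul, mem_ofPred_eq,
    h2, norm_smul, norm_inv, Real.norm_of_nonneg hY.le]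
  rw [inv_mul_eq_div, inv_mul_eq_div, div_le_div_iff_of_pos_right hY,
    div_le_div_iff_of_pos_right hY, div_eq_one_iff_eq hY.ne']

/-- Pieces of a cylinder of radius `Y`, with the axis stretched by the factor `L`. -/
theorem hausdorffMeasure_cylinder {C : ℝ≥0} (hC : ∀ B : Set ℝ, MeasurableSet B →
      μH[(m : ℝ) + 1] (meridian (n := m + 2) ⁻¹' ((fun s => !₂[s, 1]) '' B)) = C * volume B)
    {a b L Y : ℝ} (hL : 0 < L) (hY : 0 < Y) (hab : a ≤ b) :
    μH[(m : ℝ) + 1] (meridian (n := m + 2) ⁻¹' ((fun s => !₂[L * s, Y]) '' Icc a b)) =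
      ENNReal.ofReal (C * (Y ^ m * (L * (b - a)))) := by
  rw [preimage_meridian_cylinder hL hY hab, Measure.hausdorffMeasure_smul₀ (by positivity) hY.ne', hC _ measurableSet_Icc,
    Real.volume_Icc]
  have hY' : ‖Y‖₊ = Real.toNNReal Y := by
    ext; simp [hY.le, abs_of_pos hY]
  rw [hY', ENNReal.smul_def, smul_eq_mul, ENNReal.ofReal_mul C.coe_nonneg, ENNReal.ofReal_coe_nnreal]
  rw [mul_left_comm]
  congr 1
  rw [ENNReal.coe_rpow_of_nonneg _ (by positivity)]
  change ENNReal.ofReal Y ^ ((m : ℝ) + 1) * _ = _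
  rw [ENNReal.ofReal_rpow_of_pos hY, ← ENNReal.ofReal_mul (by positivity)]
  congr 1
  rw [Real.rpow_add hY, Real.rpow_natCast, Real.rpow_one]
  field_simp

end Cylinder

/-- `C` is the measure of the unit cylinder over a segment of unit length. -/
def IsCylinderConstant (m : ℕ) (C : ℝ≥0) : Prop :=
  ∀ B : Set ℝ, MeasurableSet B →
    μH[(m : ℝ) + 1] (meridian (n := m + 2) ⁻¹' ((fun s => !₂[s, 1]) '' B)) = C * volume B

/-! ### The area formula for surfaces of revolution. -/

section Area

variable {m : ℕ} {C : ℝ≥0} {p : ℝ}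

theorem dist_horizontal {L : ℝ} (hL : 0 < L) (Y s t : ℝ) :
    dist (!₂[L * s, Y] : Plane) !₂[L * t, Y] = L * |s - t| := by
  rw [dist_eq_norm, ← sq_eq_sq₀ (norm_nonneg _) (by positivity), Plane.norm_sq]
  simp [mul_pow, sq_abs]
  ring

/-- The surface is compared with the cylinder over the same parameters whose radius bounds the
height and whose axis is stretched by the Lipschitz constant. The reverse comparison below uses
lower bounds instead. -/
theorem hausdorffMeasure_revolution_le (hC : IsCylinderConstant m C) {c : ℝ → Plane}
    {a b L Y : ℝ} (hab : a ≤ b) (hL : 0 < L) (hpos : ∀ s ∈ Icc a b, 0 < c s 1)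
    (hY : ∀ s ∈ Icc a b, c s 1 ≤ Y)
    (hdist : ∀ s ∈ Icc a b, ∀ t ∈ Icc a b, dist (c s) (c t) ≤ L * |s - t|) :
    μH[(m : ℝ) + 1] (meridian (n := m + 2) ⁻¹' (c '' Icc a b)) ≤
      ENNReal.ofReal (C * (Y ^ m * (L * (b - a)))) := by
  have hY0 : 0 < Y := (hpos a (left_mem_Icc.2 hab)).trans_le (hY a (left_mem_Icc.2 hab))
  rw [← hausdorffMeasure_cylinder hC hL hY0 hab]
  refine hausdorffMeasure_preimage_meridian_le (by positivity) hpos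
    (fun s hs => by simpa using hY s hs) fun s hs t ht => ?_
  rw [dist_horizontal hL]
  exact hdist s hs t ht

theorem le_hausdorffMeasure_revolution (hC : IsCylinderConstant m C) {c : ℝ → Plane}
    {a b L Y : ℝ} (hab : a ≤ b) (hL : 0 < L) (hY0 : 0 < Y)
    (hY : ∀ s ∈ Icc a b, Y ≤ c s 1)
    (hdist : ∀ s ∈ Icc a b, ∀ t ∈ Icc a b, L * |s - t| ≤ dist (c s) (c t)) :
    ENNReal.ofReal (C * (Y ^ m * (L * (b - a)))) ≤
      μH[(m : ℝ) + 1] (meridian (n := m + 2) ⁻¹' (c '' Icc a b)) := by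
  rw [← hausdorffMeasure_cylinder hC hL hY0 hab]
  refine hausdorffMeasure_preimage_meridian_le (by positivity) (fun s _ => by simpa using hY0)
    (fun s hs => by simpa using hY s hs) fun s hs t ht => ?_
  rw [dist_horizontal hL]
  exact hdist s hs t ht

/-- The weighted area of the surface generated by a piece of the curve `c`. -/
noncomputable def revolutionArea (m : ℕ) (p : ℝ) (c : ℝ → Plane) (J : Set ℝ) : ℝ≥0∞ :=
  ∫⁻ x in meridian (n := m + 2) ⁻¹' (c '' J), ENNReal.ofReal (‖x‖ ^ p) ∂μH[(m : ℝ) + 1]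

theorem revolutionArea_le {c : ℝ → Plane} {J : Set ℝ} {W : ℝ}
    (hm : MeasurableSet (meridian (n := m + 2) ⁻¹' (c '' J)))
    (hW : ∀ s ∈ J, ‖c s‖ ^ p ≤ W) :
    revolutionArea m p c J ≤
      ENNReal.ofReal W * μH[(m : ℝ) + 1] (meridian (n := m + 2) ⁻¹' (c '' J)) := by
  rw [revolutionArea, ← setLIntegral_const]
  refine setLIntegral_mono_ae' hm (Eventually.of_forall fun x hx => ?_)
  obtain ⟨s, hs, hsx⟩ := hx
  refine ENNReal.ofReal_le_ofReal ?_
  rw [← norm_meridian, ← hsx]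
  exact hW s hs

theorem le_revolutionArea {c : ℝ → Plane} {J : Set ℝ} {W : ℝ}
    (hm : MeasurableSet (meridian (n := m + 2) ⁻¹' (c '' J)))
    (hW : ∀ s ∈ J, W ≤ ‖c s‖ ^ p) :
    ENNReal.ofReal W * μH[(m : ℝ) + 1] (meridian (n := m + 2) ⁻¹' (c '' J)) ≤
      revolutionArea m p c J := by
  rw [revolutionArea, ← setLIntegral_const]
  refine setLIntegral_mono_ae' hm (Eventually.of_forall fun x hx => ?_)
  obtain ⟨s, hs, hsx⟩ := hx
  refine ENNReal.ofReal_le_ofReal ?_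
  rw [← norm_meridian, ← hsx]
  exact hW s hs

theorem measurableSet_revolution {c : ℝ → Plane} {a b : ℝ} (hc : ContinuousOn c (Icc a b)) :
    MeasurableSet (meridian (n := m + 2) ⁻¹' (c '' Icc a b)) :=
  ((isCompact_Icc.image_of_continuousOn hc).isClosed.preimage continuous_meridian).measurableSet

theorem revolutionArea_union_le (c : ℝ → Plane) (J K : Set ℝ) :
    revolutionArea m p c (J ∪ K) ≤ revolutionArea m p c J + revolutionArea m p c K := by
  unfold revolutionArea
  rw [image_union, preimage_union]
  exact lintegral_union_le _ _ _

/-- The infinitesimal version of the area formula. -/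
theorem revolutionArea_local (hC : IsCylinderConstant m C) {c : ℝ → Plane} {c' : Plane}
    {t : ℝ} (hc : HasStrictDerivAt c c' t) (hcont : ∀ᶠ s in 𝓝 t, ContinuousAt c s) (hc' : c' ≠ 0)
    (hpos : 0 < c t 1) {ε : ℝ} (hε : 0 < ε) :
    ∃ δ > 0, ∀ a b, t - δ < a → a ≤ b → b < t + δ →
      ENNReal.ofReal ((C * (‖c t‖ ^ p * (c t 1) ^ m * ‖c'‖) - ε) * (b - a)) ≤
        revolutionArea m p c (Icc a b) ∧
      revolutionArea m p c (Icc a b) ≤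
        ENNReal.ofReal ((C * (‖c t‖ ^ p * (c t 1) ^ m * ‖c'‖) + ε) * (b - a)) := by
  have hn : 0 < ‖c t‖ := by
    rw [norm_pos_iff]; rintro h; rw [h] at hpos; simp at hpos
  have hw0 : 0 < ‖c t‖ ^ p := by positivity
  have hL0 : 0 < ‖c'‖ := norm_pos_iff.2 hc'
  have hcontF : Continuous fun η : ℝ => C * ((‖c t‖ ^ p + η) * (c t 1 + η) ^ m * (‖c'‖ + η)) := by
    fun_prop
  have hF0 := hcontF.tendsto 0
  simp only [add_zero] at hF0
  have hev := hF0.eventually (Metric.ball_mem_nhds _ hε)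
  obtain ⟨η₀, hη₀, hη₀'⟩ := Metric.eventually_nhds_iff.1 hev
  -- Density, radius and speed may each vary by `η`: the product of the three factors stays within
  -- `ε` of its value, and the lower bounds stay positive.
  obtain ⟨η, hη, hη'⟩ := exists_between
    (lt_min (lt_min hη₀ hw0) (lt_min hpos hL0))
  have h1 : η < η₀ := hη'.trans_le ((min_le_left _ _).trans (min_le_left _ _))
  have h2 : η < ‖c t‖ ^ p := hη'.trans_le ((min_le_left _ _).trans (min_le_right _ _))
  have h3 : η < c t 1 := hη'.trans_le ((min_le_right _ _).trans (min_le_left _ _))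
  have h4 : η < ‖c'‖ := hη'.trans_le ((min_le_right _ _).trans (min_le_right _ _))
  have hup : C * ((‖c t‖ ^ p + η) * (c t 1 + η) ^ m * (‖c'‖ + η)) ≤
      C * (‖c t‖ ^ p * (c t 1) ^ m * ‖c'‖) + ε := by
    have := hη₀' (y := η) (by simpa [abs_of_pos hη] using h1)
    rw [Real.dist_eq] at this
    linarith [(abs_lt.1 this).2]
  have hlow : C * (‖c t‖ ^ p * (c t 1) ^ m * ‖c'‖) - ε ≤
      C * ((‖c t‖ ^ p - η) * (c t 1 - η) ^ m * (‖c'‖ - η)) := by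
    have := hη₀' (y := -η) (by simpa [abs_of_pos hη] using h1)
    rw [Real.dist_eq] at this
    simp only [← sub_eq_add_neg] at this
    linarith [(abs_lt.1 this).1]
  have hct : ContinuousAt c t := hc.hasDerivAt.continuousAt
  have e1 : ∀ᶠ s in 𝓝 t, c t 1 - η ≤ c s 1 ∧ c s 1 ≤ c t 1 + η := by
    have h : ContinuousAt (fun s => c s 1) t := by fun_prop
    exact (h.eventually (Icc_mem_nhds (by linarith : c t 1 - η < c t 1) (by linarith)))
  have e2 : ∀ᶠ s in 𝓝 t, ‖c t‖ ^ p - η ≤ ‖c s‖ ^ p ∧ ‖c s‖ ^ p ≤ ‖c t‖ ^ p + η := by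
    have h : ContinuousAt (fun s => ‖c s‖ ^ p) t := hct.norm.rpow_const (Or.inl hn.ne')
    exact (h.eventually (Icc_mem_nhds (by linarith : ‖c t‖ ^ p - η < ‖c t‖ ^ p) (by linarith)))
  -- Strict differentiability makes `c` bi-Lipschitz near `t` with constants `‖c'‖ ± η`, as
  -- comparison with cylinders requires.
  have e3 := hc.hasStrictFDerivAt.isLittleO.def hη
  rw [nhds_prod_eq] at e3
  obtain ⟨V, hV, hV'⟩ := (eventually_prod_self_iff (r := fun s r => ‖c s - c r -
    ContinuousLinearMap.toSpanSingleton ℝ c' (s - r)‖ ≤ η * ‖s - r‖)).1 e3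
  obtain ⟨δ, hδ, hδ'⟩ := Metric.eventually_nhds_iff.1
    (e1.and (e2.and ((Filter.eventually_mem_set.2 hV).and hcont)))
  refine ⟨δ, hδ, fun a b ha hab hb => ?_⟩
  have hmem : ∀ s ∈ Icc a b, dist s t < δ := fun s hs => by
    rw [Real.dist_eq, abs_lt]; constructor <;> linarith [hs.1, hs.2]
  have hE := fun s hs => hδ' (hmem s hs)
  have hD : ∀ s ∈ Icc a b, ∀ r ∈ Icc a b, (‖c'‖ - η) * |s - r| ≤ dist (c s) (c r) ∧
      dist (c s) (c r) ≤ (‖c'‖ + η) * |s - r| := by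
    intro s hs r hr
    have h := hV' s (hE s hs).2.2.1 r (hE r hr).2.2.1
    simp only [Real.norm_eq_abs, ContinuousLinearMap.toSpanSingleton_apply] at h
    have hsm : ‖(s - r) • c'‖ = |s - r| * ‖c'‖ := by rw [norm_smul, Real.norm_eq_abs]
    rw [dist_eq_norm]
    have t1 := norm_sub_norm_le ((s - r) • c') (c s - c r)
    have t2 := norm_sub_norm_le (c s - c r) ((s - r) • c')
    rw [norm_sub_rev ((s - r) • c')] at t1
    constructor <;> nlinarith
  have hcon : ContinuousOn c (Icc a b) := fun s hs => (hE s hs).2.2.2.continuousWithinAt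
  have hms : MeasurableSet (meridian (n := m + 2) ⁻¹' (c '' Icc a b)) := measurableSet_revolution hcon
  have hba : 0 ≤ b - a := sub_nonneg.2 hab
  constructor
  · have g1 := le_hausdorffMeasure_revolution hC hab (sub_pos.2 h4) (sub_pos.2 h3)
      (fun s hs => (hE s hs).1.1) (fun s hs r hr => (hD s hs r hr).1)
    have g2 := le_revolutionArea (p := p) (W := ‖c t‖ ^ p - η) hms (fun s hs => (hE s hs).2.1.1)
    refine le_trans ?_ ((mul_le_mul_right g1 _).trans g2)
    rw [← ENNReal.ofReal_mul (sub_pos.2 h2).le]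
    refine ENNReal.ofReal_le_ofReal ?_
    calc _ ≤ (C * ((‖c t‖ ^ p - η) * (c t 1 - η) ^ m * (‖c'‖ - η))) * (b - a) :=
          mul_le_mul_of_nonneg_right hlow hba
      _ = _ := by ring
  · have g1 := hausdorffMeasure_revolution_le hC hab (add_pos hL0 hη)
      (fun s hs => (sub_pos.2 h3).trans_le (hE s hs).1.1)
      (fun s hs => (hE s hs).1.2) (fun s hs r hr => (hD s hs r hr).2)
    have g2 := revolutionArea_le (p := p) (W := ‖c t‖ ^ p + η) hms (fun s hs => (hE s hs).2.1.2)
    refine (g2.trans (mul_le_mul_right g1 _)).trans ?_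
    rw [← ENNReal.ofReal_mul (by positivity)]
    refine ENNReal.ofReal_le_ofReal ?_
    calc _ = (C * ((‖c t‖ ^ p + η) * (c t 1 + η) ^ m * (‖c'‖ + η))) * (b - a) := by ring
      _ ≤ _ := mul_le_mul_of_nonneg_right hup hba

/-- The area formula for surfaces of revolution. -/
theorem revolutionArea_eq (hC : IsCylinderConstant m C) {c c' : ℝ → Plane}
    {a b : ℝ} (hab : a ≤ b) (hc : ∀ t ∈ Icc a b, HasStrictDerivAt c (c' t) t)
    (hcont : ∀ t ∈ Icc a b, ∀ᶠ s in 𝓝 t, ContinuousAt c s)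
    (hc'c : ContinuousOn c' (Icc a b))
    (hc' : ∀ t ∈ Icc a b, c' t ≠ 0) (hpos : ∀ t ∈ Icc a b, 0 < c t 1) (hinj : InjOn c (Icc a b)) :
    revolutionArea m p c (Icc a b) =
      ENNReal.ofReal (C * ∫ t in a..b, ‖c t‖ ^ p * (c t 1) ^ m * ‖c' t‖) := by
  have hcc : ContinuousOn c (Icc a b) :=
    fun t ht => (hc t ht).hasDerivAt.continuousAt.continuousWithinAt
  set L : ℝ → ℝ := fun t => C * (‖c t‖ ^ p * (c t 1) ^ m * ‖c' t‖) with hL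
  have hn : ∀ t ∈ Icc a b, ‖c t‖ ≠ 0 := fun t ht => by
    rw [norm_ne_zero_iff]; rintro h; have := hpos t ht; rw [h] at this; simp at this
  have hLc : ContinuousOn L (Icc a b) := by
    have h1 : ContinuousOn (fun t => ‖c t‖ ^ p) (Icc a b) :=
      hcc.norm.rpow_const fun t ht => Or.inl (hn t ht)
    have h2 : ContinuousOn (fun t => c t 1) (Icc a b) := by fun_prop
    exact continuousOn_const.mul ((h1.mul (h2.pow m)).mul hc'c.norm)
  have hadd : ∀ s t, a ≤ s → s ≤ t → t ≤ b → revolutionArea m p c (Icc a t) ≤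
      revolutionArea m p c (Icc a s) + revolutionArea m p c (Icc s t) := by
    intro s t has hst htb
    rw [← Icc_union_Icc_eq_Icc has hst]
    exact revolutionArea_union_le _ _ _
  -- The local estimate on a degenerate interval shows that a single parallel has no area, so
  -- adjacent closed intervals overlap in a null set and areas add.
  have hnull : ∀ s ∈ Icc a b, revolutionArea m p c {s} = 0 := by
    intro s hs
    obtain ⟨δ, hδ, h⟩ := revolutionArea_local (p := p) hC (hc s hs) (hcont s hs) (hc' s hs)
      (hpos s hs) one_pos
    have := (h s s (by linarith) le_rfl (by linarith)).2
    simpa using this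
  have hadd' : ∀ s t, a ≤ s → s ≤ t → t ≤ b →
      revolutionArea m p c (Icc a s) + revolutionArea m p c (Icc s t) ≤
        revolutionArea m p c (Icc a t) := by
    intro s t has hst htb
    have h1 : revolutionArea m p c (Icc s t) ≤ revolutionArea m p c (Ioc s t) := by
      have h2 : Icc s t = {s} ∪ Ioc s t := by
        ext x; simp only [mem_Icc, mem_union, mem_singleton_iff, mem_Ioc]
        constructor
        · rintro ⟨h1, h2⟩
          rcases h1.eq_or_lt with h | h
          · exact Or.inl h.symm
          · exact Or.inr ⟨h, h2⟩
        · rintro (rfl | ⟨h1, h2⟩)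
          · exact ⟨le_rfl, hst⟩
          · exact ⟨h1.le, h2⟩
      rw [h2]
      refine (revolutionArea_union_le _ _ _).trans ?_
      rw [hnull s ⟨has, hst.trans htb⟩, zero_add]
    refine (add_le_add_right h1 _).trans ?_
    rw [add_comm]
    have h3 : Icc a t = Ioc s t ∪ Icc a s := by
      rw [union_comm, Icc_union_Ioc_eq_Icc has hst]
    rw [h3]
    unfold revolutionArea
    rw [image_union, preimage_union, lintegral_union]
    · exact measurableSet_revolution (hcc.mono (Icc_subset_Icc_right (hst.trans htb)))
    · refine Disjoint.preimage _ ?_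
      rw [Set.disjoint_left]
      rintro _ ⟨x, hx, rfl⟩ ⟨y, hy, hxy⟩
      have := hinj ⟨hy.1, hy.2.trans (hst.trans htb)⟩ ⟨has.trans hx.1.le, hx.2.trans htb⟩ hxy
      rw [this] at hy
      exact absurd hy.2 (not_le.2 hx.1)
  have hfin : ∀ t ∈ Icc a b, revolutionArea m p c (Icc a t) ≠ ⊤ := by
    obtain ⟨K, hK⟩ := isCompact_Icc.exists_bound_of_continuousOn hc'c
    obtain ⟨Y, hY⟩ := isCompact_Icc.exists_bound_of_continuousOn
      (show ContinuousOn (fun t => c t 1) (Icc a b) by fun_prop)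
    obtain ⟨W, hW⟩ := isCompact_Icc.exists_bound_of_continuousOn
      (show ContinuousOn (fun t => ‖c t‖ ^ p) (Icc a b) from
        hcc.norm.rpow_const fun t ht => Or.inl (hn t ht))
    intro t ht
    have hsub : Icc a t ⊆ Icc a b := Icc_subset_Icc_right ht.2
    have hKpos : 0 < |K| + 1 := by positivity
    have g1 := hausdorffMeasure_revolution_le hC ht.1 hKpos (fun s hs => hpos s (hsub hs))
      (fun s hs => (le_abs_self _).trans (hY s (hsub hs))) (fun s hs r hr => by
        rw [dist_comm, dist_eq_norm, abs_sub_comm]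
        refine Convex.norm_image_sub_le_of_norm_hasDerivWithin_le (s := Icc a t)
          (fun x hx => (hc x (hsub hx)).hasDerivAt.hasDerivWithinAt)
          (fun x hx => (hK x (hsub hx)).trans (by linarith [le_abs_self K])) (convex_Icc a t) hs hr)
    have g2 := revolutionArea_le (m := m) (p := p) (W := W) (measurableSet_revolution (hcc.mono hsub))
      (fun s hs => (le_abs_self _).trans (hW s (hsub hs)))
    refine ne_top_of_le_ne_top ?_ (g2.trans (mul_le_mul_right g1 _))
    exact ENNReal.mul_ne_top ENNReal.ofReal_ne_top ENNReal.ofReal_ne_top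
  -- By additivity, the local estimate says exactly that the area up to `t` has derivative `L t`;
  -- the fundamental theorem of calculus finishes.
  set G : ℝ → ℝ := fun t => (revolutionArea m p c (Icc a t)).toReal with hG
  have hderiv : ∀ t ∈ Icc a b, HasDerivWithinAt G (L t) (Icc a b) t := by
    intro t ht
    rw [hasDerivWithinAt_iff_isLittleO, Asymptotics.isLittleO_iff]
    intro ε hε
    obtain ⟨δ, hδ, h⟩ := revolutionArea_local (p := p) hC (hc t ht) (hcont t ht) (hc' t ht)
      (hpos t ht) hε
    have hinc : ∀ r s, a ≤ r → r ≤ s → s ≤ b → t - δ < r → s < t + δ →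
        |G s - G r - L t * (s - r)| ≤ ε * (s - r) := by
      intro r s har hrs hsb hr hs
      obtain ⟨k1, k2⟩ := h r s hr hrs hs
      have hsm : s ∈ Icc a b := ⟨har.trans hrs, hsb⟩
      have hrm : r ∈ Icc a b := ⟨har, hrs.trans hsb⟩
      have heq : revolutionArea m p c (Icc a s) =
          revolutionArea m p c (Icc a r) + revolutionArea m p c (Icc r s) :=
        le_antisymm (hadd r s har hrs hsb) (hadd' r s har hrs hsb)
      have hfin' : revolutionArea m p c (Icc r s) ≠ ⊤ :=
        ne_top_of_le_ne_top (hfin s hsm) (heq ▸ le_add_self)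
      have hGs : G s - G r = (revolutionArea m p c (Icc r s)).toReal := by
        simp only [hG]
        rw [heq, ENNReal.toReal_add (hfin r hrm) hfin']
        ring
      rw [hGs]
      have hsr : 0 ≤ s - r := sub_nonneg.2 hrs
      have hLn : 0 ≤ L t := by
        have := hpos t ht
        simp only [hL]; positivity
      have k1' := (ENNReal.ofReal_le_iff_le_toReal hfin').1 k1
      have k2' := ENNReal.toReal_le_of_le_ofReal (by positivity) k2
      rw [abs_le]
      simp only [hL] at *
      constructor <;> nlinarith
    filter_upwards [self_mem_nhdsWithin, nhdsWithin_le_nhds (Metric.ball_mem_nhds t hδ)] with s hs hs'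
    rw [Metric.mem_ball, Real.dist_eq, abs_lt] at hs'
    rw [Real.norm_eq_abs, Real.norm_eq_abs, smul_eq_mul]
    rcases le_total t s with hts | hts
    · have := hinc t s ht.1 hts hs.2 (by linarith) (by linarith)
      rw [abs_of_nonneg (sub_nonneg.2 hts), mul_comm (s - t)]
      exact this
    · have := hinc s t hs.1 hts ht.2 (by linarith) (by linarith)
      rw [abs_of_nonpos (sub_nonpos.2 hts), neg_sub]
      rw [← abs_neg]
      convert this using 2
      ring
  have hint := intervalIntegral.integral_eq_sub_of_hasDerivAt_of_le hab
    (fun t ht => (hderiv t ht).continuousWithinAt)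
    (fun t ht => (hderiv t (Ioo_subset_Icc_self ht)).hasDerivAt (Icc_mem_nhds ht.1 ht.2))
    (hLc.intervalIntegrable_of_Icc hab)
  have hGa : G a = 0 := by
    simp only [hG, Icc_self]
    rw [hnull a (left_mem_Icc.2 hab)]
    rfl
  rw [hGa, sub_zero] at hint
  rw [← intervalIntegral.integral_const_mul]
  change _ = ENNReal.ofReal (∫ t in a..b, L t)
  rw [hint]
  exact (ENNReal.ofReal_toReal (hfin b (right_mem_Icc.2 hab))).symm

end Area

/-! ### Volumes in meridian coordinates. -/

section Polar

/-- Integration of radial functions in polar coordinates. -/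
theorem lintegral_norm_euclideanSpace (m : ℕ) {f : ℝ → ℝ≥0∞} (hf : Measurable f) :
    ∫⁻ v : EuclideanSpace ℝ (Fin (m + 1)), f ‖v‖ =
      (volume : Measure (EuclideanSpace ℝ (Fin (m + 1)))).toSphere univ *
        ∫⁻ r in Ioi (0 : ℝ), ENNReal.ofReal (r ^ m) * f r := by
  set μ := (volume : Measure (EuclideanSpace ℝ (Fin (m + 1)))) with hμ
  have hmp := μ.measurePreserving_homeomorphUnitSphereProd
  have hdim : Module.finrank ℝ (EuclideanSpace ℝ (Fin (m + 1))) - 1 = m := by simp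
  rw [hdim] at hmp
  have hm2 : Measurable fun z : Metric.sphere (0 : EuclideanSpace ℝ (Fin (m + 1))) 1 ×
      Ioi (0 : ℝ) => f z.2 := hf.comp (measurable_subtype_coe.comp measurable_snd)
  calc ∫⁻ v, f ‖v‖ ∂μ = ∫⁻ v in ({0}ᶜ : Set (EuclideanSpace ℝ (Fin (m + 1)))), f ‖v‖ ∂μ := by
        rw [restrict_compl_singleton]
    _ = ∫⁻ v : ({0}ᶜ : Set (EuclideanSpace ℝ (Fin (m + 1)))), f ‖v.1‖ ∂(μ.comap (↑)) :=
        (lintegral_subtype_comap (measurableSet_singleton _).compl fun v => f ‖v‖).symm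
    _ = ∫⁻ z, f z.2 ∂(μ.toSphere.prod (.volumeIoiPow m)) := by
        rw [← hmp.lintegral_comp hm2]
        simp
    _ = μ.toSphere univ * ∫⁻ r : Ioi (0 : ℝ), f r ∂(.volumeIoiPow m) := by
        rw [lintegral_prod _ hm2.aemeasurable]
        dsimp only
        rw [lintegral_const, mul_comm]
    _ = _ := by
        rw [Measure.volumeIoiPow, lintegral_withDensity_eq_lintegral_mul]
        · congr 1
          exact lintegral_subtype_comap measurableSet_Ioi
            (fun r => ENNReal.ofReal (r ^ m) * f r)
        · exact (measurable_subtype_coe.pow_const _).ennreal_ofReal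
        · exact hf.comp measurable_subtype_coe

theorem volume_preserving_plane :
    MeasurePreserving (fun z : ℝ × ℝ => (!₂[z.1, z.2] : Plane)) := by
  have h := (PiLp.volume_preserving_toLp (Fin 2)).comp
    ((volume_preserving_finTwoArrow ℝ).symm)
  have e : (fun z : ℝ × ℝ => (!₂[z.1, z.2] : Plane)) =
      WithLp.toLp 2 ∘ MeasurableEquiv.finTwoArrow.symm := by
    funext z
    exact Plane.ext rfl rfl
  rw [e]
  exact h

theorem norm_radialPart_toLp {m : ℕ} (x : EuclideanSpace ℝ (Fin (m + 2))) :
    ‖radialPart x‖ = ‖(WithLp.toLp 2 (fun i : Fin (m + 1) => x i.succ) :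
      EuclideanSpace ℝ (Fin (m + 1)))‖ := by
  rw [← sq_eq_sq₀ (norm_nonneg _) (norm_nonneg _), EuclideanSpace.norm_sq_eq,
    EuclideanSpace.norm_sq_eq, Fin.sum_univ_succ]
  simp [radialPart, Fin.succ_ne_zero]

/-- Integration over `ℝⁿ` of functions of the meridian projection. -/
theorem lintegral_comp_meridian (m : ℕ) : ∃ D : ℝ≥0, ∀ F : Plane → ℝ≥0∞, Measurable F →
    ∫⁻ x : EuclideanSpace ℝ (Fin (m + 2)), F (meridian x) =
      D * ∫⁻ q in {q : Plane | 0 < q 1}, ENNReal.ofReal (q 1 ^ m) * F q := by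
  set D := (volume : Measure (EuclideanSpace ℝ (Fin (m + 1)))).toSphere univ with hD
  have hDfin : D ≠ ⊤ := measure_ne_top _ _
  refine ⟨D.toNNReal, fun F hF => ?_⟩
  rw [ENNReal.coe_toNNReal hDfin]
  have hG : Measurable fun z : ℝ × ℝ => F !₂[z.1, z.2] :=
    hF.comp volume_preserving_plane.measurable
  have h1 : MeasurePreserving (fun x : EuclideanSpace ℝ (Fin (m + 2)) =>
      ((x 0, WithLp.toLp 2 (fun i : Fin (m + 1) => x i.succ)) :
        ℝ × EuclideanSpace ℝ (Fin (m + 1)))) := by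
    have h2 := (PiLp.volume_preserving_ofLp (Fin (m + 2)))
    have h3 := volume_preserving_piFinSuccAbove (fun _ : Fin (m + 2) => ℝ) 0
    have h4 := (MeasurePreserving.id (volume : Measure ℝ)).prod
      (PiLp.volume_preserving_toLp (Fin (m + 1)))
    have h5 := h4.comp (h3.comp h2)
    exact h5
  have hstep : ∀ x : EuclideanSpace ℝ (Fin (m + 2)), F (meridian x) =
      (fun z : ℝ × EuclideanSpace ℝ (Fin (m + 1)) => F !₂[z.1, ‖z.2‖])
        (x 0, WithLp.toLp 2 (fun i : Fin (m + 1) => x i.succ)) := by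
    intro x
    simp only [meridian, norm_radialPart_toLp]
  have hmeas : Measurable fun z : ℝ × EuclideanSpace ℝ (Fin (m + 1)) => F !₂[z.1, ‖z.2‖] :=
    hG.comp (measurable_fst.prodMk measurable_snd.norm)
  calc ∫⁻ x : EuclideanSpace ℝ (Fin (m + 2)), F (meridian x)
      = ∫⁻ z : ℝ × EuclideanSpace ℝ (Fin (m + 1)), F !₂[z.1, ‖z.2‖] := by
        rw [← h1.lintegral_comp hmeas]
        exact lintegral_congr hstep
    _ = ∫⁻ s : ℝ, ∫⁻ v : EuclideanSpace ℝ (Fin (m + 1)), F !₂[s, ‖v‖] :=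
        lintegral_prod _ hmeas.aemeasurable
    _ = ∫⁻ s : ℝ, D * ∫⁻ r in Ioi (0 : ℝ), ENNReal.ofReal (r ^ m) * F !₂[s, r] := by
        refine lintegral_congr fun s => ?_
        exact lintegral_norm_euclideanSpace m (f := fun r => F !₂[s, r])
          (hG.comp (measurable_const.prodMk measurable_id))
    _ = D * ∫⁻ s : ℝ, ∫⁻ r in Ioi (0 : ℝ), ENNReal.ofReal (r ^ m) * F !₂[s, r] :=
        lintegral_const_mul' _ _ hDfin
    _ = _ := by
        congr 1
        have hs : MeasurableSet {q : Plane | 0 < q 1} :=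
          (isOpen_lt continuous_const (by fun_prop)).measurableSet
        have hK : Measurable fun q : Plane => ENNReal.ofReal (q 1 ^ m) * F q := by
          refine Measurable.mul ?_ hF
          have : Continuous fun q : Plane => q 1 ^ m := by fun_prop
          exact this.measurable.ennreal_ofReal
        rw [← lintegral_indicator hs, ← volume_preserving_plane.lintegral_comp
          (hK.indicator hs)]
        have hmeas2 : Measurable fun z : ℝ × ℝ => {q : Plane | 0 < q 1}.indicator
            (fun q => ENNReal.ofReal (q 1 ^ m) * F q) !₂[z.1, z.2] :=
          (hK.indicator hs).comp volume_preserving_plane.measurable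
        rw [Measure.volume_eq_prod, lintegral_prod _ hmeas2.aemeasurable]
        refine lintegral_congr fun s => ?_
        rw [← lintegral_indicator measurableSet_Ioi]
        refine lintegral_congr fun r => ?_
        simp only [indicator, mem_Ioi, mem_ofPred_eq]
        rfl

/-- Orthonormal frame coordinates preserve area. -/
theorem volume_preserving_framePoint (P : Plane) {T : Plane} (hT : T 0 ^ 2 + T 1 ^ 2 = 1) :
    MeasurePreserving (framePoint P T) := by
  set M : Matrix (Fin 2) (Fin 2) ℝ := !![T 0, -T 1; T 1, T 0] with hM
  have hdet : M.det = 1 := by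
    rw [hM, Matrix.det_fin_two_of]; linear_combination hT
  have h1 : MeasurePreserving (Matrix.toLin' M) := by
    refine ⟨(LinearMap.continuous_on_pi _).measurable, ?_⟩
    rw [Real.map_matrix_volume_pi_eq_smul_volume_pi (by rw [hdet]; exact one_ne_zero), hdet]
    simp
  have h2 := (measurePreserving_add_left (volume : Measure Plane) P).comp
    ((PiLp.volume_preserving_toLp (Fin 2)).comp
      (h1.comp ((volume_preserving_finTwoArrow ℝ).symm)))
  have e : framePoint P T = (fun x => P + x) ∘ WithLp.toLp 2 ∘ Matrix.toLin' M ∘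
      MeasurableEquiv.finTwoArrow.symm := ?_
  · rw [e]
    exact h2
  funext w
  refine Plane.ext ?_ ?_
  · simp [hM, Matrix.toLin'_apply, MeasurableEquiv.finTwoArrow]
    ring
  · simp [hM, Matrix.toLin'_apply, MeasurableEquiv.finTwoArrow]
    ring

end Polar

/-! ### Dilations and the scale invariant isoperimetric inequality. -/

section Scaling

/-- Homogeneity of the density is combined with the scaling of the underlying measure. The statement
is abstract in `μ` so as to serve both Lebesgue and Hausdorff measure. -/
theorem setLIntegral_rpow_norm_smul {E : Type*} [NormedAddCommGroup E] [NormedSpace ℝ E]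
    [MeasurableSpace E] [BorelSpace E] {μ : Measure E} {r : ℝ} (hr : 0 < r) {k : ℝ≥0∞}
    (hμ : ∀ s : Set E, μ (r • s) = k * μ s) (p : ℝ) (S : Set E) :
    ∫⁻ x in r • S, ENNReal.ofReal (‖x‖ ^ p) ∂μ =
      k * ENNReal.ofReal (r ^ p) * ∫⁻ x in S, ENNReal.ofReal (‖x‖ ^ p) ∂μ := by
  have hg : MeasurableEmbedding (fun x : E => r • x) :=
    (Homeomorph.smulOfNeZero r hr.ne').measurableEmbedding
  have hmap : μ = k • μ.map (fun x => r • x) := by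
    ext s hs
    rw [Measure.smul_apply, hg.map_apply, smul_eq_mul, ← hμ, Set.preimage_smul₀ hr.ne',
      smul_inv_smul₀ hr.ne']
  conv_lhs => rw [hmap]
  rw [Measure.restrict_smul, lintegral_smul_measure, hg.restrict_map, hg.lintegral_map,
    Set.preimage_smul₀ hr.ne', inv_smul_smul₀ hr.ne', smul_eq_mul, mul_assoc]
  congr 1
  rw [← lintegral_const_mul' _ _ ENNReal.ofReal_ne_top]
  refine lintegral_congr fun x => ?_
  rw [← ENNReal.ofReal_mul (by positivity), norm_smul, Real.norm_of_nonneg hr.le,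
    Real.mul_rpow hr.le (norm_nonneg _)]

variable {m : ℕ} {p : ℝ}

theorem weightedVolume_smul {r : ℝ} (hr : 0 < r) (E : Set (EuclideanSpace ℝ (Fin (m + 2)))) :
    weightedVolume (m + 2) p (r • E) =
      ENNReal.ofReal (r ^ ((m : ℝ) + 2 + p)) * weightedVolume (m + 2) p E := by
  unfold weightedVolume
  rw [setLIntegral_rpow_norm_smul hr (k := ENNReal.ofReal (r ^ (m + 2)))]
  · congr 1
    rw [← ENNReal.ofReal_mul (by positivity), Real.rpow_add hr]
    congr 2
    exact_mod_cast (Real.rpow_natCast r (m + 2)).symm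
  · intro s
    rw [Measure.addHaar_smul_of_nonneg _ hr.le]
    simp

theorem weightedPerimeter_eq (E : Set (EuclideanSpace ℝ (Fin (m + 2)))) :
    weightedPerimeter (m + 2) p E =
      ∫⁻ x in frontier E, ENNReal.ofReal (‖x‖ ^ p) ∂μH[(m : ℝ) + 1] := by
  have : ((m + 2 : ℕ) : ℝ) - 1 = (m : ℝ) + 1 := by push_cast; ring
  rw [weightedPerimeter, this]

theorem weightedPerimeter_smul {r : ℝ} (hr : 0 < r) (E : Set (EuclideanSpace ℝ (Fin (m + 2)))) :
    weightedPerimeter (m + 2) p (r • E) =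
      ENNReal.ofReal (r ^ ((m : ℝ) + 1 + p)) * weightedPerimeter (m + 2) p E := by
  have hfr : frontier (r • E) = r • frontier E :=
    ((Homeomorph.smulOfNeZero r hr.ne').image_frontier E).symm
  rw [weightedPerimeter_eq, weightedPerimeter_eq, hfr,
    setLIntegral_rpow_norm_smul hr (k := ENNReal.ofReal (r ^ ((m : ℝ) + 1)))]
  · rw [← ENNReal.ofReal_mul (by positivity), Real.rpow_add hr ((m : ℝ) + 1)]
  · intro s
    rw [Measure.hausdorffMeasure_smul₀ (by positivity) hr.ne', ENNReal.smul_def, smul_eq_mul]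
    congr 1
    rw [ENNReal.coe_rpow_of_nonneg _ (by positivity), ← ENNReal.ofReal_rpow_of_pos hr]
    congr 1
    have hr' : ‖r‖₊ = Real.toNNReal r := by
      ext
      simp [hr.le, abs_of_pos hr]
    rw [hr']
    rfl

/-- The scale invariant form of the isoperimetric property. -/
theorem IsIsoperimetric.perimeter_le {E E' : Set (EuclideanSpace ℝ (Fin (m + 2)))}
    (hp : 0 < p) (hE : IsIsoperimetric (m + 2) p E) (hE0 : weightedVolume (m + 2) p E ≠ 0)
    (hE' : MeasurableSet E') (h0 : weightedVolume (m + 2) p E' ≠ 0)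
    (htop : weightedVolume (m + 2) p E' ≠ ⊤) :
    weightedPerimeter (m + 2) p E ≤ ENNReal.ofReal
      (((weightedVolume (m + 2) p E).toReal / (weightedVolume (m + 2) p E').toReal) ^
        (((m : ℝ) + 1 + p) / ((m : ℝ) + 2 + p))) * weightedPerimeter (m + 2) p E' := by
  have hV := ENNReal.toReal_pos hE0 hE.volume_ne_top
  have hV' := ENNReal.toReal_pos h0 htop
  set q := (weightedVolume (m + 2) p E).toReal / (weightedVolume (m + 2) p E').toReal with hq
  have hq0 : 0 < q := div_pos hV hV'
  have hk : 0 < (m : ℝ) + 2 + p := by positivity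
  -- Dilation by `r` multiplies volume by `r^(m+2+p)`, so this `r` gives `E'` the volume of `E`. The
  -- perimeter is multiplied by `r^(m+1+p)`.
  set r := q ^ (1 / ((m : ℝ) + 2 + p)) with hr
  have hr0 : 0 < r := by positivity
  have h1 : r ^ ((m : ℝ) + 2 + p) = q := by
    rw [hr, ← Real.rpow_mul hq0.le, one_div_mul_cancel hk.ne', Real.rpow_one]
  have h2 : r ^ ((m : ℝ) + 1 + p) = q ^ (((m : ℝ) + 1 + p) / ((m : ℝ) + 2 + p)) := by
    rw [hr, ← Real.rpow_mul hq0.le]; congr 1; ring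
  rw [← h2, ← weightedPerimeter_smul hr0]
  refine hE.minimal _ (hE'.const_smul₀ r) ?_
  rw [weightedVolume_smul hr0, h1, ← ENNReal.ofReal_toReal htop, ← ENNReal.ofReal_mul hq0.le, hq,
    div_mul_cancel₀ _ hV'.ne', ENNReal.ofReal_toReal hE.volume_ne_top]

theorem weightedVolume_pos {n : ℕ} [NeZero n] {E : Set (EuclideanSpace ℝ (Fin n))} (hE : IsOpen E)
    (hne : E.Nonempty) : weightedVolume n p E ≠ 0 := by
  intro h
  rw [weightedVolume, lintegral_eq_zero_iff (by fun_prop)] at h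
  have h1 : ∀ᵐ x ∂(volume.restrict E), x = 0 ∨ False := by
    filter_upwards [h] with x hx
    by_contra! h0
    have : 0 < ‖x‖ ^ p := Real.rpow_pos_of_pos (norm_pos_iff.2 h0.1) _
    simp only [Pi.zero_apply, ENNReal.ofReal_eq_zero] at hx
    linarith
  rw [ae_restrict_iff' hE.measurableSet] at h1
  have h2 : ∀ᵐ x : EuclideanSpace ℝ (Fin n), x ≠ 0 := by
    have : Nontrivial (EuclideanSpace ℝ (Fin n)) := inferInstance
    exact Measure.ae_ne volume 0
  have h3 : volume E = 0 := by
    rw [measure_eq_zero_iff_ae_notMem]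
    filter_upwards [h1, h2] with x hx hx' hxE
    exact hx' ((hx hxE).resolve_right id)
  exact (hE.measure_pos volume hne).ne' h3

/-- There is a set of finite positive volume and finite perimeter. -/
theorem exists_finite_perimeter (m : ℕ) (hp : 0 < p) :
    ∃ Q : Set (EuclideanSpace ℝ (Fin (m + 2))), MeasurableSet Q ∧
      weightedVolume (m + 2) p Q ≠ 0 ∧ weightedVolume (m + 2) p Q ≠ ⊤ ∧
      weightedPerimeter (m + 2) p Q ≠ ⊤ := by
  -- A cube is convenient because each face is a Lipschitz image of a cube in `Fin (m + 1) → ℝ`,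
  -- where Hausdorff measure is Lebesgue measure.
  set Q : Set (EuclideanSpace ℝ (Fin (m + 2))) := {x | ∀ i, |x i| < 1} with hQ
  set K : Set (EuclideanSpace ℝ (Fin (m + 2))) := {x | ∀ i, |x i| ≤ 1} with hK
  have hQo : IsOpen Q := by
    have : Q = ⋂ i, {x | |x i| < 1} := by ext; simp [hQ]
    rw [this]
    exact isOpen_iInter_of_finite fun i => isOpen_lt (by fun_prop) continuous_const
  have hKc : IsClosed K := by
    have : K = ⋂ i, {x | |x i| ≤ 1} := by ext; simp [hK]
    rw [this]
    exact isClosed_iInter fun i => isClosed_le (by fun_prop) continuous_const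
  have hQK : Q ⊆ K := fun x hx i => (hx i).le
  have hnorm : ∀ x ∈ K, ‖x‖ ≤ √(m + 2) := by
    intro x hx
    rw [EuclideanSpace.norm_eq]
    refine Real.sqrt_le_sqrt ?_
    calc ∑ i, ‖x i‖ ^ 2 ≤ ∑ _i : Fin (m + 2), (1 : ℝ) := Finset.sum_le_sum fun i _ => by
          rw [Real.norm_eq_abs]
          exact pow_le_one₀ (abs_nonneg _) (hx i)
      _ = _ := by simp
  have hbound : ∀ (μ : Measure (EuclideanSpace ℝ (Fin (m + 2)))) (S : Set _), S ⊆ K →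
      MeasurableSet S → μ S ≠ ⊤ → ∫⁻ x in S, ENNReal.ofReal (‖x‖ ^ p) ∂μ ≠ ⊤ := by
    intro μ S hS hSm hμ
    have : ∫⁻ x in S, ENNReal.ofReal (‖x‖ ^ p) ∂μ ≤ ENNReal.ofReal (√(m + 2) ^ p) * μ S := by
      rw [← setLIntegral_const]
      refine setLIntegral_mono_ae' hSm (Eventually.of_forall fun x hx => ?_)
      exact ENNReal.ofReal_le_ofReal
        (Real.rpow_le_rpow (norm_nonneg _) (hnorm x (hS hx)) hp.le)
    exact ne_top_of_le_ne_top (ENNReal.mul_ne_top ENNReal.ofReal_ne_top hμ) this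
  refine ⟨Q, hQo.measurableSet, weightedVolume_pos hQo ⟨0, fun i => by simp⟩, ?_, ?_⟩
  · refine hbound _ Q hQK hQo.measurableSet ?_
    refine ne_top_of_le_ne_top (measure_closedBall_lt_top (x := 0) (r := √(m + 2))).ne
      (measure_mono fun x hx => ?_)
    rw [mem_closedBall_zero_iff]
    exact hnorm x (hQK hx)
  · rw [weightedPerimeter_eq]
    have hfr : frontier Q ⊆ K := frontier_subset_closure.trans (closure_minimal hQK hKc)
    refine hbound _ _ hfr isClosed_frontier.measurableSet ?_
    set φ : Fin (m + 2) × Bool → (Fin (m + 1) → ℝ) → EuclideanSpace ℝ (Fin (m + 2)) :=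
      fun j y => WithLp.toLp 2 (Fin.insertNth (α := fun _ => ℝ) j.1 (bif j.2 then 1 else -1) y)
      with hφ
    have hcov : frontier Q ⊆ ⋃ j, φ j '' Icc (-1) 1 := by
      intro x hx
      have hxK := hfr hx
      rw [hQo.frontier_eq] at hx
      have hxQ := hx.2
      simp only [hQ, mem_ofPred_eq, not_forall, not_lt] at hxQ
      obtain ⟨i, hi⟩ := hxQ
      have hi1 : |x i| = 1 := le_antisymm (hxK i) hi
      have hy : (fun j => x (i.succAbove j)) ∈ Icc (-1 : Fin (m + 1) → ℝ) 1 :=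
        ⟨fun j => (abs_le.1 (hxK (i.succAbove j))).1, fun j => (abs_le.1 (hxK (i.succAbove j))).2⟩
      rw [mem_iUnion]
      have hins : ∀ c : ℝ, x i = c → WithLp.toLp 2 (Fin.insertNth (α := fun _ => ℝ) i c
          (fun j => x (i.succAbove j))) = x := by
        intro c hc
        ext j
        rcases Fin.eq_self_or_eq_succAbove i j with rfl | ⟨k, rfl⟩
        · simp [hc]
        · simp
      rcases eq_or_eq_neg_of_abs_eq hi1 with h | h
      · exact ⟨(i, true), _, hy, hins 1 h⟩
      · exact ⟨(i, false), _, hy, hins (-1) h⟩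
    have hμpi : (μH[(m : ℝ) + 1] : Measure (Fin (m + 1) → ℝ)) = volume := by
      have := hausdorffMeasure_pi_real (ι := Fin (m + 1))
      rwa [Fintype.card_fin, Nat.cast_add, Nat.cast_one] at this
    have hface : ∀ j, μH[(m : ℝ) + 1] (φ j '' Icc (-1) 1) < ⊤ := by
      intro j
      have hl1 : LipschitzWith 1 (fun y : Fin (m + 1) → ℝ =>
          (Fin.insertNth (α := fun _ => ℝ) j.1 (bif j.2 then 1 else -1) y : Fin (m + 2) → ℝ)) := by
        refine LipschitzWith.of_dist_le_mul fun y z => ?_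
        rw [NNReal.coe_one, one_mul, dist_pi_le_iff dist_nonneg]
        intro i
        rcases Fin.eq_self_or_eq_succAbove j.1 i with rfl | ⟨k, rfl⟩
        · simp
        · simpa using dist_le_pi_dist y z k
      have hl2 := (PiLp.lipschitzWith_toLp 2 (fun _ : Fin (m + 2) => ℝ)).comp hl1
      have h3 := hl2.hausdorffMeasure_image_le (d := (m : ℝ) + 1) (by positivity) (Icc (-1) 1)
      refine lt_of_le_of_lt h3 ?_
      rw [hμpi]
      refine ENNReal.mul_lt_top ?_ isCompact_Icc.measure_lt_top
      exact ENNReal.rpow_lt_top_of_nonneg (by positivity) ENNReal.coe_ne_top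
    refine ne_top_of_le_ne_top ?_ ((measure_mono hcov).trans (measure_iUnion_le _))
    rw [tsum_fintype]
    exact (ENNReal.sum_lt_top.2 fun j _ => hface j).ne

/-- A suitably dilated cube is a competitor of finite perimeter. -/
theorem IsIsoperimetric.perimeter_ne_top {E : Set (EuclideanSpace ℝ (Fin (m + 2)))}
    (hp : 0 < p) (hE : IsIsoperimetric (m + 2) p E) (hE0 : weightedVolume (m + 2) p E ≠ 0) :
    weightedPerimeter (m + 2) p E ≠ ⊤ := by
  obtain ⟨Q, hQ, h0, h1, h2⟩ := exists_finite_perimeter m hp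
  exact ne_top_of_le_ne_top (ENNReal.mul_ne_top ENNReal.ofReal_ne_top h2)
    (hE.perimeter_le hp hE0 hQ h0 h1)

/-- A half-space has infinite weighted volume. -/
theorem weightedVolume_halfSpace (hp : 0 < p) :
    weightedVolume (m + 2) p {x | 1 < x 0} = ⊤ := by
  set S : Set (EuclideanSpace ℝ (Fin (m + 2))) := {x | 1 < x 0} with hS
  have hSo : IsOpen S := isOpen_lt continuous_const (by fun_prop)
  have hSne : S.Nonempty := ⟨EuclideanSpace.single 0 2, by simp [hS]⟩
  have h0 := weightedVolume_pos (p := p) hSo hSne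
  by_contra htop
  -- Doubling maps the half-space into itself but multiplies its volume by a factor above `1`, which
  -- is impossible for a finite positive volume.
  have hsub : (2 : ℝ) • S ⊆ S := by
    rintro _ ⟨x, hx, rfl⟩
    simp only [hS, mem_ofPred_eq, PiLp.smul_apply, smul_eq_mul] at hx ⊢
    linarith
  have h1 : weightedVolume (m + 2) p ((2 : ℝ) • S) ≤ weightedVolume (m + 2) p S :=
    lintegral_mono_set hsub
  rw [weightedVolume_smul two_pos] at h1
  have h2 : (1 : ℝ≥0∞) < ENNReal.ofReal ((2 : ℝ) ^ ((m : ℝ) + 2 + p)) := by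
    rw [← ENNReal.ofReal_one]
    refine (ENNReal.ofReal_lt_ofReal_iff (by positivity)).2 ?_
    exact Real.one_lt_rpow (by norm_num) (by positivity)
  have h3 := ENNReal.mul_lt_mul_left h0 htop h2
  rw [one_mul] at h3
  exact absurd h1 (not_le.2 h3)

end Scaling

/-! ### The region and its planar section. -/

section PlanarSection

variable {m : ℕ} {p : ℝ} {E : Set (EuclideanSpace ℝ (Fin (m + 2)))}

theorem norm_single_add_single (q : Plane) :
    ‖(EuclideanSpace.single 0 (q 0) + EuclideanSpace.single 1 (q 1) :
      EuclideanSpace ℝ (Fin (m + 2)))‖ = ‖q‖ := by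
  rw [← sq_eq_sq₀ (norm_nonneg _) (norm_nonneg _), norm_sq_single_add (by simp), Plane.norm_sq]
  simp

theorem IsSphericallySymmetric.planarSection_mem (hsym : IsSphericallySymmetric (m + 2) E)
    {q : Plane} (hq : q ∈ planarSection (m + 2) E) {q' : Plane} (h1 : ‖q'‖ = ‖q‖)
    (h0 : q 0 ≤ q' 0) : q' ∈ planarSection (m + 2) E := by
  refine hsym _ hq _ ?_ ?_
  · rw [norm_single_add_single, norm_single_add_single, h1]
  · simpa using h0

/-- A point and its image in the `e₁e₂`-plane have the same norm and abscissa, so symmetry applies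
in both directions. Thus `E` is the preimage of its section. -/
theorem IsSphericallySymmetric.meridian_mem_iff (hsym : IsSphericallySymmetric (m + 2) E)
    {x : EuclideanSpace ℝ (Fin (m + 2))} : meridian x ∈ planarSection (m + 2) E ↔ x ∈ E := by
  constructor <;> intro h
  · refine hsym _ h _ ?_ ?_
    · rw [norm_single_add_single, norm_meridian]
    · simp
  · refine hsym _ h _ ?_ ?_
    · rw [norm_single_add_single, norm_meridian]
    · simp

theorem isOpen_planarSection (hE : IsOpen E) : IsOpen (planarSection (m + 2) E) := by
  have : Continuous (fun q : Plane => (EuclideanSpace.single 0 (q 0) +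
      EuclideanSpace.single 1 (q 1) : EuclideanSpace ℝ (Fin (m + 2)))) := by
    have h : (fun q : Plane => (EuclideanSpace.single 0 (q 0) +
      EuclideanSpace.single 1 (q 1) : EuclideanSpace ℝ (Fin (m + 2)))) = fun q =>
        (q 0) • EuclideanSpace.single 0 (1 : ℝ) + (q 1) • EuclideanSpace.single 1 (1 : ℝ) := by
      funext q
      congr 1 <;> · ext i; simp
    rw [h]
    fun_prop
  exact hE.preimage this

/-- The lift of the half-plane to the half of a plane through `x`. -/
theorem exists_meridian_section (x : EuclideanSpace ℝ (Fin (m + 2))) (hx : 0 < meridian x 1) :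
    ∃ g : Plane → EuclideanSpace ℝ (Fin (m + 2)), Continuous g ∧ g (meridian x) = x ∧
      ∀ q : Plane, 0 ≤ q 1 → meridian (g q) = q := by
  rw [meridian_one] at hx
  refine ⟨fun q => EuclideanSpace.single 0 (q 0) + (q 1 / ‖radialPart x‖) • radialPart x,
    ?_, ?_, ?_⟩
  · have h : (fun q : Plane => EuclideanSpace.single 0 (q 0) +
        (q 1 / ‖radialPart x‖) • radialPart x) = fun q =>
        (q 0) • EuclideanSpace.single 0 (1 : ℝ) + (q 1 / ‖radialPart x‖) • radialPart x := by
      funext q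
      congr 1
      ext i; simp
    rw [h]
    fun_prop
  · simp only [meridian_zero, meridian_one, div_self hx.ne', one_smul, single_add_radialPart]
  · intro q hq
    rw [meridian_single_add (by simp)]
    refine Plane.ext (by simp) ?_
    simp [norm_smul, abs_of_nonneg hq, hx.ne']

/-- Off the axis, the half-plane through `x` is a continuous section of the projection, along which
nearby points of `A` lift to points near `x`. -/
theorem mem_frontier_preimage_meridian {A : Set Plane} (hA : IsOpen A)
    {x : EuclideanSpace ℝ (Fin (m + 2))} (hx : 0 < meridian x 1) :
    x ∈ frontier (meridian ⁻¹' A) ↔ meridian x ∈ frontier A := by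
  rw [(hA.preimage continuous_meridian).frontier_eq, hA.frontier_eq]
  refine and_congr ⟨fun h => ?_, fun h => ?_⟩ Iff.rfl
  · have h1 : closure (meridian (n := m + 2) ⁻¹' A) ⊆ meridian ⁻¹' closure A :=
      closure_minimal (fun y hy => subset_closure hy)
        (isClosed_closure.preimage continuous_meridian)
    exact h1 h
  · obtain ⟨g, hg, hgx, hgm⟩ := exists_meridian_section x hx
    rw [mem_closure_iff_nhds] at h ⊢
    intro t ht
    rw [← hgx] at ht
    have h1 : ∀ᶠ q in 𝓝 (meridian x), g q ∈ t ∧ 0 < q 1 :=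
      (hg.continuousAt.eventually_mem ht).and
        ((isOpen_lt continuous_const (by fun_prop) :
          IsOpen {q : Plane | 0 < q 1}).mem_nhds hx)
    obtain ⟨q, hq, hqA⟩ := h _ h1
    exact ⟨g q, hq.1, by rw [mem_preimage, hgm q hq.2.le]; exact hqA⟩

/-- A region of finite volume does not extend to the right of its boundary. -/
theorem IsSphericallySymmetric.planarSection_le (hp : 0 < p)
    (hsym : IsSphericallySymmetric (m + 2) E) (hfin : weightedVolume (m + 2) p E ≠ ⊤)
    (hright : ∀ q ∈ frontier (planarSection (m + 2) E), q 0 ≤ 1) :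
    ∀ q ∈ planarSection (m + 2) E, q 0 ≤ 1 := by
  intro q hq
  by_contra! h
  set A := planarSection (m + 2) E with hA
  have hconv : IsPreconnected {q : Plane | 1 < q 0} := by
    refine Convex.isPreconnected (convex_halfSpace_gt ⟨fun _ _ => rfl, fun _ _ => rfl⟩ 1)
  -- The open half-plane to the right of the frontier is connected and misses it, so one point of
  -- `A` there would drag a half-space of infinite volume into `E`.
  have hsub : {q : Plane | 1 < q 0} ⊆ A := by
    intro q' hq'
    by_contra hn
    obtain ⟨z, hz, hzf⟩ := hconv.inter_frontier_nonempty' ⟨q, h, hq⟩ ⟨q', hq', hn⟩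
    exact absurd (hright z hzf) (not_le.2 hz)
  have h2 : {x : EuclideanSpace ℝ (Fin (m + 2)) | 1 < x 0} ⊆ E := by
    intro x hx
    exact hsym.meridian_mem_iff.1 (hsub (by simpa using hx))
  have := lintegral_mono_set (μ := volume) (f := fun x => ENNReal.ofReal (‖x‖ ^ p)) h2
  have h3 := weightedVolume_halfSpace (m := m) hp
  rw [weightedVolume] at h3
  rw [h3, top_le_iff] at this
  exact hfin this

end PlanarSection

/-! ### Finiteness of the cylinder constant. -/

section CylinderConstant

variable {m : ℕ} {p : ℝ} {E : Set (EuclideanSpace ℝ (Fin (m + 2)))} {β : ℝ} {γ : ℝ → Plane}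

theorem revolutionArea_le_weightedPerimeter {A : Set Plane} (hA : IsOpen A)
    (hE : E = meridian ⁻¹' A) {c : ℝ → Plane} {J : Set ℝ} (hc : ∀ s ∈ J, c s ∈ frontier A)
    (hpos : ∀ s ∈ J, 0 < c s 1) :
    revolutionArea m p c J ≤ weightedPerimeter (m + 2) p E := by
  rw [weightedPerimeter_eq, revolutionArea]
  refine lintegral_mono_set ?_
  rintro x ⟨s, hs, hsx⟩
  have h1 : 0 < meridian x 1 := by rw [← hsx]; exact hpos s hs
  rw [hE, mem_frontier_preimage_meridian hA h1, ← hsx]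
  exact hc s hs

/-- Finiteness of the measure of a piece of cylinder is read off from the finite perimeter of `E`.
Near parameter `β/2` the curve stays above half its height and spreads distances by at least `1/2`,
so the boundary surface dominates a cylinder of smaller radius. -/
theorem exists_isCylinderConstant {A : Set Plane} (hp : 0 < p) (hA : IsOpen A)
    (hE : E = meridian ⁻¹' A) (hγ : IsGeneratingCurve A β γ)
    (hfin : weightedPerimeter (m + 2) p E ≠ ⊤) : ∃ C : ℝ≥0, 0 < C ∧ IsCylinderConstant m C := by
  have hβ := hγ.pos
  set t := β / 2 with ht
  have ht0 : t ∈ Ioo 0 β := ⟨by linarith, by linarith⟩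
  have htβ : t ∈ Ioo (-β) β := ⟨by linarith [ht0.1], ht0.2⟩
  have hst : HasStrictDerivAt γ (deriv γ t) t := (hγ.contDiffAt htβ).hasStrictDerivAt (by norm_num)
  have h1 := hst.hasStrictFDerivAt.isLittleO.def (c := 1 / 2) (by norm_num)
  have h2 : ∀ᶠ s in 𝓝 t, γ t 1 / 2 < γ s 1 := by
    have hc : ContinuousAt (fun s => γ s 1) t :=
      ((by fun_prop : Continuous fun q : Plane => q 1).continuousAt).comp
        (hγ.hasDerivAt htβ).continuousAt
    exact hc.eventually_const_lt (by linarith [hγ.above t ht0])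
  obtain ⟨δ₁, hδ₁, h1⟩ := Metric.eventually_nhds_iff.1 h1
  obtain ⟨δ₂, hδ₂, h2⟩ := Metric.eventually_nhds_iff.1
    (h2.and (isOpen_Ioo.eventually_mem ht0))
  set δ := min δ₁ δ₂ / 2 with hδ
  have hmin : 0 < min δ₁ δ₂ := lt_min hδ₁ hδ₂
  have hδ0 : 0 < δ := by positivity
  have hJ : ∀ s ∈ Icc (t - δ) (t + δ), dist s t < min δ₁ δ₂ := by
    intro s hs
    rw [Real.dist_eq, abs_lt]
    constructor <;> linarith [hs.1, hs.2]
  set Y := γ t 1 / 2 with hY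
  have hY0 : 0 < Y := half_pos (hγ.above t ht0)
  have hle : μH[(m : ℝ) + 1] (meridian (n := m + 2) ⁻¹'
      ((fun s => !₂[1 / 2 * s, Y]) '' Icc (t - δ) (t + δ))) ≤
      μH[(m : ℝ) + 1] (meridian (n := m + 2) ⁻¹' (γ '' Icc (t - δ) (t + δ))) := by
    refine hausdorffMeasure_preimage_meridian_le (by positivity) (fun s _ => by simpa using hY0)
      (fun s hs => ?_) fun s hs s' hs' => ?_
    · simpa using (h2 ((hJ s hs).trans_le (min_le_right _ _))).1.le
    · rw [dist_horizontal (by norm_num)]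
      have h3 := @h1 (s, s') (by
        rw [Prod.dist_eq]
        exact max_lt ((hJ s hs).trans_le (min_le_left _ _))
          ((hJ s' hs').trans_le (min_le_left _ _)))
      simp only [ContinuousLinearMap.toSpanSingleton_apply] at h3
      have h4 : ‖(s - s') • deriv γ t‖ = |s - s'| := by
        rw [norm_smul, hγ.norm_deriv t htβ, mul_one, Real.norm_eq_abs]
      rw [Real.norm_eq_abs] at h3
      rw [dist_eq_norm]
      have h5 := norm_sub_norm_le ((s - s') • deriv γ t) (γ s - γ s')
      rw [norm_sub_rev ((s - s') • deriv γ t) (γ s - γ s')] at h5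
      linarith
  have hcont : ContinuousOn γ (Icc (t - δ) (t + δ)) := by
    intro s hs
    have := (h2 ((hJ s hs).trans_le (min_le_right _ _))).2
    exact (hγ.hasDerivAt ⟨by linarith [this.1], this.2⟩).continuousAt.continuousWithinAt
  have h6 := le_revolutionArea (m := m) (p := p) (W := Y ^ p) (measurableSet_revolution hcont)
    (fun s hs => by
      refine Real.rpow_le_rpow hY0.le ?_ hp.le
      have h7 := (h2 ((hJ s hs).trans_le (min_le_right _ _))).1
      have h8 := PiLp.norm_apply_le (γ s) 1
      rw [Real.norm_eq_abs] at h8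
      linarith [le_abs_self (γ s 1)])
  have h9 := h6.trans (revolutionArea_le_weightedPerimeter hA hE
    (fun s hs => by
      have := (h2 ((hJ s hs).trans_le (min_le_right _ _))).2
      exact hγ.mem_frontier s ⟨by linarith [this.1], this.2.le⟩)
    (fun s hs => hY0.trans (h2 ((hJ s hs).trans_le (min_le_right _ _))).1))
  have h10 : μH[(m : ℝ) + 1] (meridian (n := m + 2) ⁻¹'
      ((fun s => !₂[1 / 2 * s, Y]) '' Icc (t - δ) (t + δ))) ≠ ⊤ := by
    intro htop
    rw [htop, top_le_iff] at hle
    rw [hle, ENNReal.mul_top (by simpa using Real.rpow_pos_of_pos hY0 p), top_le_iff] at h9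
    exact hfin h9
  rw [preimage_meridian_cylinder (by norm_num) hY0 (by linarith),
    Measure.hausdorffMeasure_smul₀ (by positivity) hY0.ne'] at h10
  refine exists_hausdorffMeasure_horizontal (a₀ := 1 / 2 * (t - δ) / Y)
    (b₀ := 1 / 2 * (t + δ) / Y) ?_ ?_
  · rw [div_lt_div_iff_of_pos_right hY0]; linarith
  · intro htop
    rw [htop] at h10
    refine h10 ?_
    rw [ENNReal.smul_top]
    have : ‖Y‖₊ ^ ((m : ℝ) + 1) ≠ 0 := by
      rw [← NNReal.coe_ne_zero, NNReal.coe_rpow]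
      simpa using (Real.rpow_pos_of_pos (norm_pos_iff.2 hY0.ne') _).ne'
    simp [this]

end CylinderConstant

/-! ### Differentiation under the integral and the lemma of du Bois-Reymond. -/

section Calculus

theorem hasDerivAt_intervalIntegral_of_continuousOn {F F' : ℝ → ℝ → ℝ} {a b τ : ℝ} (hab : a ≤ b)
    (hτ : 0 < τ) (hF : ∀ t ∈ Icc (-τ) τ, ContinuousOn (F t) (Icc a b))
    (hF' : ContinuousOn (fun z : ℝ × ℝ => F' z.1 z.2) (Icc (-τ) τ ×ˢ Icc a b))
    (hd : ∀ t ∈ Icc (-τ) τ, ∀ u ∈ Icc a b, HasDerivAt (fun t => F t u) (F' t u) t) :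
    HasDerivAt (fun t => ∫ u in a..b, F t u) (∫ u in a..b, F' 0 u) 0 := by
  obtain ⟨M, hM⟩ := (isCompact_Icc.prod isCompact_Icc).exists_bound_of_continuousOn hF'
  have h0 : (0 : ℝ) ∈ Icc (-τ) τ := ⟨by linarith, hτ.le⟩
  have hsub : uIoc a b ⊆ Icc a b := by rw [uIoc_of_le hab]; exact Ioc_subset_Icc_self
  have hmeas : ∀ {f : ℝ → ℝ}, ContinuousOn f (Icc a b) →
      AEStronglyMeasurable f (volume.restrict (uIoc a b)) := fun hf =>
    (hf.mono hsub).aestronglyMeasurable measurableSet_uIoc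
  refine (intervalIntegral.hasDerivAt_integral_of_dominated_loc_of_deriv_le
    (bound := fun _ => M) (Icc_mem_nhds (by linarith : -τ < 0) hτ) ?_ ?_ ?_ ?_ ?_ ?_).2
  · filter_upwards [Icc_mem_nhds (by linarith : -τ < 0) hτ] with t ht using hmeas (hF t ht)
  · exact (hF 0 h0).intervalIntegrable_of_Icc hab
  · refine hmeas (hF'.comp (f := fun u => ((0 : ℝ), u)) (by fun_prop) fun u hu => ⟨h0, hu⟩)
  · exact Eventually.of_forall fun u hu t ht => hM (t, u) ⟨ht, hsub hu⟩
  · exact intervalIntegrable_const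
  · exact Eventually.of_forall fun u hu t ht => hd t ht u (hsub hu)

/-- A `C¹` germ is the germ of a `C¹` function on the line. -/
theorem ContDiffAt.exists_eventuallyEq {f : ℝ → ℝ} (hf : ContDiffAt ℝ 1 f 0) :
    ∃ g g' : ℝ → ℝ, Continuous g' ∧ (∀ u, HasDerivAt g (g' u) u) ∧ g =ᶠ[𝓝 0] f := by
  have h1 : ∀ᶠ u in 𝓝 (0 : ℝ), ContDiffAt ℝ 1 f u := hf.eventually (by simp)
  obtain ⟨ε, hε, h1⟩ := Metric.eventually_nhds_iff.1 h1
  have hpos : -(ε / 2) ≤ ε / 2 := by linarith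
  have hd : ∀ u ∈ Icc (-(ε / 2)) (ε / 2), ContDiffAt ℝ 1 f u := by
    intro u hu
    refine h1 ?_
    rw [Real.dist_eq, sub_zero, abs_lt]
    constructor <;> linarith [hu.1, hu.2]
  have hc : ContinuousOn (deriv f) (Icc (-(ε / 2)) (ε / 2)) := by
    have h2 : ContDiffOn ℝ 1 f (Metric.ball 0 ε) := fun u hu => (h1 hu).contDiffWithinAt
    refine (h2.continuousOn_deriv_of_isOpen Metric.isOpen_ball le_rfl).mono fun u hu => ?_
    rw [mem_ball_zero_iff, Real.norm_eq_abs, abs_lt]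
    constructor <;> linarith [hu.1, hu.2]
  -- The derivative is extended by constants beyond a small interval and integrated.
  set g' : ℝ → ℝ := IccExtend hpos ((Icc (-(ε / 2)) (ε / 2)).domRestrict (deriv f)) with hg'
  have hg'c : Continuous g' := (continuousOn_iff_continuous_domRestrict.1 hc).Icc_extend'
  refine ⟨fun u => f 0 + ∫ s in (0 : ℝ)..u, g' s, g', hg'c, fun u => ?_, ?_⟩
  · exact (hg'c.integral_hasStrictDerivAt 0 u).hasDerivAt.const_add _
  · filter_upwards [Icc_mem_nhds (by linarith : -(ε / 2) < 0) (by linarith : 0 < ε / 2)] with u hu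
    have hsub : uIcc 0 u ⊆ Icc (-(ε / 2)) (ε / 2) :=
      ordConnected_Icc.uIcc_subset ⟨by linarith, by linarith⟩ hu
    have : ∫ s in (0 : ℝ)..u, g' s = f u - f 0 := by
      rw [← intervalIntegral.integral_eq_sub_of_hasDerivAt (f := f) (f' := deriv f)
        (fun s hs => ((hd s (hsub hs)).differentiableAt one_ne_zero).hasDerivAt)
        ((hc.mono hsub).intervalIntegrable)]
      refine intervalIntegral.integral_congr fun s hs => ?_
      simp only [hg', IccExtend_of_mem _ _ (hsub hs), domRestrict_apply]
    rw [this]; ring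

/-- The lemma of du Bois-Reymond. -/
theorem hasDerivAt_of_forall_integral_eq_zero {g k : ℝ → ℝ} {a b : ℝ} (hab : a < b)
    (hg : ContinuousOn g (Icc a b)) (hk : ContinuousOn k (Icc a b))
    (h : ∀ φ : ℝ → ℝ, Continuous φ → ∫ u in a..b, φ u = 0 →
      ∫ u in a..b, (g u * (∫ s in a..u, φ s) + k u * φ u) = 0) :
    ∀ u ∈ Ioo a b, HasDerivAt k (g u) u := by
  set g₁ : ℝ → ℝ := IccExtend hab.le ((Icc a b).domRestrict g) with hg₁
  set k₁ : ℝ → ℝ := IccExtend hab.le ((Icc a b).domRestrict k) with hk₁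
  have hg₁c : Continuous g₁ := (continuousOn_iff_continuous_domRestrict.1 hg).Icc_extend'
  have hk₁c : Continuous k₁ := (continuousOn_iff_continuous_domRestrict.1 hk).Icc_extend'
  have hgg : ∀ u ∈ Icc a b, g₁ u = g u := fun u hu => by
    simp only [hg₁, IccExtend_of_mem _ _ hu, domRestrict_apply]
  have hkk : ∀ u ∈ Icc a b, k₁ u = k u := fun u hu => by
    simp only [hk₁, IccExtend_of_mem _ _ hu, domRestrict_apply]
  set G : ℝ → ℝ := fun u => ∫ s in a..u, g₁ s with hG
  have hGd : ∀ u, HasDerivAt G (g₁ u) u := fun u => (hg₁c.integral_hasStrictDerivAt a u).hasDerivAt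
  have hGc : Continuous G := continuous_iff_continuousAt.2 fun u => (hGd u).continuousAt
  have ii : ∀ {f : ℝ → ℝ}, Continuous f → IntervalIntegrable f volume a b :=
    fun hf => hf.intervalIntegrable _ _
  -- Subtracting the mean `M` makes `φ = k₁ - G - M` an admissible test function. After integration
  -- by parts, testing with it yields `∫ φ² = 0`, that is `k = G + M`.
  set M := (∫ u in a..b, (k₁ u - G u)) / (b - a) with hM
  set φ : ℝ → ℝ := fun u => k₁ u - G u - M with hφ
  have hφc : Continuous φ := by fun_prop
  have hφ0 : ∫ u in a..b, φ u = 0 := by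
    change ∫ u in a..b, (k₁ u - G u - M) = 0
    rw [intervalIntegral.integral_sub (ii (by fun_prop : Continuous fun u => k₁ u - G u))
      intervalIntegrable_const, intervalIntegral.integral_const, hM, smul_eq_mul,
      mul_div_cancel₀ _ (by linarith : b - a ≠ 0), sub_self]
  have hηd : ∀ u, HasDerivAt (fun u => ∫ s in a..u, φ s) (φ u) u :=
    fun u => (hφc.integral_hasStrictDerivAt a u).hasDerivAt
  have hηc : Continuous (fun u => ∫ s in a..u, φ s) :=
    continuous_iff_continuousAt.2 fun u => (hηd u).continuousAt
  have hgη : Continuous (fun u => g₁ u * ∫ s in a..u, φ s) := hg₁c.mul hηc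
  have h1 := h φ hφc hφ0
  have h2 : ∫ u in a..b, (g u * (∫ s in a..u, φ s) + k u * φ u) =
      ∫ u in a..b, (g₁ u * (∫ s in a..u, φ s) + k₁ u * φ u) := by
    refine intervalIntegral.integral_congr fun u hu => ?_
    rw [uIcc_of_le hab.le] at hu
    simp only [hgg u hu, hkk u hu]
  have h3 : ∫ u in a..b, g₁ u * (∫ s in a..u, φ s) = -∫ u in a..b, G u * φ u := by
    have := intervalIntegral.integral_deriv_mul_eq_sub (u := G) (v := fun u => ∫ s in a..u, φ s)
      (a := a) (b := b) (fun u _ => hGd u) (fun u _ => hηd u) (hg₁c.intervalIntegrable _ _)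
      (hφc.intervalIntegrable _ _)
    rw [intervalIntegral.integral_add (ii hgη)
      (ii (by fun_prop : Continuous fun u => G u * φ u)), hφ0] at this
    simp at this
    linarith
  have h4 : ∫ u in a..b, φ u * φ u = 0 := by
    rw [h2, intervalIntegral.integral_add (ii hgη)
      (ii (by fun_prop : Continuous fun u => k₁ u * φ u)), h3] at h1
    have e : ∀ u, φ u * φ u = k₁ u * φ u - G u * φ u - M * φ u := fun u => by simp only [hφ]; ring
    simp_rw [e]
    rw [intervalIntegral.integral_sub (ii (by fun_prop : Continuous fun u => k₁ u * φ u - G u * φ u))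
      (ii (by fun_prop : Continuous fun u => M * φ u)),
      intervalIntegral.integral_sub (ii (by fun_prop : Continuous fun u => k₁ u * φ u))
      (ii (by fun_prop : Continuous fun u => G u * φ u)), intervalIntegral.integral_const_mul, hφ0]
    linarith
  have h5 : ∀ u ∈ Ioo a b, φ u = 0 := by
    by_contra! hne
    obtain ⟨u, hu, hun⟩ := hne
    have : 0 < ∫ u in a..b, φ u * φ u :=
      intervalIntegral.integral_pos hab (hφc.mul hφc).continuousOn
        (fun _ _ => mul_self_nonneg _) ⟨u, Ioo_subset_Icc_self hu, mul_self_pos.2 hun⟩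
    exact this.ne' h4
  intro u hu
  rw [← hgg u (Ioo_subset_Icc_self hu)]
  refine ((hGd u).add_const M).congr_of_eventuallyEq ?_
  filter_upwards [isOpen_Ioo.mem_nhds hu] with v hv
  have := h5 v hv
  rw [← hkk v (Ioo_subset_Icc_self hv)]
  simp only [hφ] at this
  linarith

end Calculus

/-! ### Replacing a boundary arc inside a box. -/

section Modification

variable {m : ℕ} {p : ℝ} {A : Set Plane} {P T : Plane} {f h : ℝ → ℝ} {R δ ε : ℝ}

theorem continuous_frameFst (P T : Plane) : Continuous (frameFst P T) := by
  unfold frameFst; fun_prop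

theorem continuous_frameSnd (P T : Plane) : Continuous (frameSnd P T) := by
  unfold frameSnd; fun_prop

/-- The closed box with half-axes `δ` and `ε` in a frame. -/
def frameBox (P T : Plane) (δ ε : ℝ) : Set Plane :=
  {q | |frameFst P T q| ≤ δ ∧ |frameSnd P T q| ≤ ε}

theorem isClosed_frameBox : IsClosed (frameBox P T δ ε) :=
  (isClosed_le (continuous_frameFst P T).abs continuous_const).inter
    (isClosed_le (continuous_frameSnd P T).abs continuous_const)

/-- The epigraph of a function in a frame. -/
def frameEpigraph (P T : Plane) (h : ℝ → ℝ) : Set Plane :=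
  {q | h (frameFst P T q) < frameSnd P T q}

theorem isOpen_frameEpigraph (hh : Continuous h) : IsOpen (frameEpigraph P T h) :=
  isOpen_lt (hh.comp (continuous_frameFst P T)) (continuous_frameSnd P T)

/-- The region `A`, replaced inside a box by the epigraph of `h`. -/
def modifyBox (A : Set Plane) (P T : Plane) (δ ε : ℝ) (h : ℝ → ℝ) : Set Plane :=
  A \ frameBox P T δ ε ∪ frameBox P T δ ε ∩ frameEpigraph P T h

/-- In the frame at `P` with first vector `T`, the region `A` is the epigraph of `f` inside a box
that does not meet the axis; the graph over `[-δ, δ]` stays in a smaller box. -/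
structure IsEpigraphBox (A : Set Plane) (P T : Plane) (f : ℝ → ℝ) (R δ ε : ℝ) : Prop where
  unit : T 0 ^ 2 + T 1 ^ 2 = 1
  delta_pos : 0 < δ
  delta_lt : δ < R
  eps_lt : ε < R
  continuous : Continuous f
  bound : ∀ u, |u| ≤ δ → |f u| < ε
  mem_iff : ∀ w : ℝ × ℝ, |w.1| < R → |w.2| < R → (framePoint P T w ∈ A ↔ f w.1 < w.2)
  mem_frontier : ∀ u, |u| ≤ δ → framePoint P T (u, f u) ∈ frontier A
  pos : ∀ w : ℝ × ℝ, |w.1| < R → |w.2| < R → 0 < framePoint P T w 1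

namespace IsEpigraphBox

theorem mem_iff' (hb : IsEpigraphBox A P T f R δ ε) {q : Plane} (h1 : |frameFst P T q| < R)
    (h2 : |frameSnd P T q| < R) : q ∈ A ↔ f (frameFst P T q) < frameSnd P T q := by
  have := hb.mem_iff (frameFst P T q, frameSnd P T q) h1 h2
  rwa [framePoint_frameFst_frameSnd hb.unit] at this

theorem pos' (hb : IsEpigraphBox A P T f R δ ε) {q : Plane} (hq : q ∈ frameBox P T δ ε) :
    0 < q 1 := by
  have := hb.pos (frameFst P T q, frameSnd P T q) (hq.1.trans_lt hb.delta_lt)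
    (hq.2.trans_lt hb.eps_lt)
  rwa [framePoint_frameFst_frameSnd hb.unit] at this

theorem modifyBox_self (hb : IsEpigraphBox A P T f R δ ε) : modifyBox A P T δ ε f = A := by
  ext q
  by_cases hq : q ∈ frameBox P T δ ε
  · simp [modifyBox, hq, frameEpigraph,
      hb.mem_iff' (hq.1.trans_lt hb.delta_lt) (hq.2.trans_lt hb.eps_lt)]
  · simp [modifyBox, hq]

theorem mem_modifyBox_iff (hb : IsEpigraphBox A P T f R δ ε) (hhf : ∀ u, δ ≤ |u| → h u = f u)
    (hhε : ∀ u, |u| ≤ δ → |h u| < ε) {q : Plane} (h1 : |frameFst P T q| < R)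
    (h2 : |frameSnd P T q| < R) :
    q ∈ modifyBox A P T δ ε h ↔ h (frameFst P T q) < frameSnd P T q := by
  by_cases hq : q ∈ frameBox P T δ ε
  · simp [modifyBox, hq, frameEpigraph]
  · have : q ∈ modifyBox A P T δ ε h ↔ q ∈ A := by simp [modifyBox, hq]
    rw [this, hb.mem_iff' h1 h2]
    rcases le_or_gt δ |frameFst P T q| with h3 | h3
    · rw [hhf _ h3]
    · have h4 : ε < |frameSnd P T q| := by
        by_contra! h4
        exact hq ⟨h3.le, h4⟩
      have h5 := abs_lt.1 (hb.bound _ h3.le)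
      have h6 := abs_lt.1 (hhε _ h3.le)
      rcases lt_abs.1 h4 with h7 | h7
      · exact ⟨fun _ => by linarith, fun _ => by linarith⟩
      · exact ⟨fun _ => by linarith, fun _ => by linarith⟩

/-- Near every point of the closed box the modified region is the epigraph of `h`. This remains true
across the faces: `h = f` beyond the lateral ones, and both graphs stay away from the top and
bottom. Outside the box nothing changes, so only the new graph can be gained and the old graph is
lost. -/
theorem frontier_modifyBox_subset (hb : IsEpigraphBox A P T f R δ ε) (hh : Continuous h)
    (hhf : ∀ u, δ ≤ |u| → h u = f u) (hhε : ∀ u, |u| ≤ δ → |h u| < ε) :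
    frontier (meridian (n := m + 2) ⁻¹' modifyBox A P T δ ε h) ⊆
      (frontier (meridian (n := m + 2) ⁻¹' A) \
        meridian ⁻¹' ((fun u => framePoint P T (u, f u)) '' Icc (-δ) δ)) ∪
      meridian ⁻¹' ((fun u => framePoint P T (u, h u)) '' Icc (-δ) δ) := by
  intro x hx
  by_cases hq : meridian x ∈ frameBox P T δ ε
  · right
    have hR1 := hq.1.trans_lt hb.delta_lt
    have hR2 := hq.2.trans_lt hb.eps_lt
    have hc1 := (continuous_frameFst P T).comp (continuous_meridian (n := m + 2))
    have hc2 := (continuous_frameSnd P T).comp (continuous_meridian (n := m + 2))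
    have hW : ∀ᶠ y in 𝓝 x, |frameFst P T (meridian y)| < R ∧ |frameSnd P T (meridian y)| < R :=
      (hc1.abs.continuousAt.eventually_lt_const hR1).and
        (hc2.abs.continuousAt.eventually_lt_const hR2)
    refine ⟨frameFst P T (meridian x), abs_le.1 hq.1, ?_⟩
    have heq : h (frameFst P T (meridian x)) = frameSnd P T (meridian x) := by
      rcases lt_trichotomy (h (frameFst P T (meridian x))) (frameSnd P T (meridian x))
        with hlt | heq | hgt
      · refine absurd ?_ hx.2
        rw [mem_interior_iff_mem_nhds]
        filter_upwards [hW, (hh.comp hc1).continuousAt.eventually_lt hc2.continuousAt hlt]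
          with y h1 h2
        exact (hb.mem_modifyBox_iff hhf hhε h1.1 h1.2).2 h2
      · exact heq
      · refine absurd hx.1 ?_
        rw [mem_closure_iff_frequently, not_frequently]
        filter_upwards [hW, hc2.continuousAt.eventually_lt (hh.comp hc1).continuousAt hgt]
          with y h1 h2 h3
        exact absurd ((hb.mem_modifyBox_iff hhf hhε h1.1 h1.2).1 h3) h2.not_gt
    simp only [heq]
    exact framePoint_frameFst_frameSnd hb.unit _
  · left
    set N := meridian (n := m + 2) ⁻¹' (frameBox P T δ ε)ᶜ with hN
    have hNo : IsOpen N := isClosed_frameBox.isOpen_compl.preimage continuous_meridian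
    have hsame : meridian (n := m + 2) ⁻¹' modifyBox A P T δ ε h ∩ N = meridian ⁻¹' A ∩ N := by
      ext y
      refine and_congr_left fun hy => ?_
      have hy' : meridian y ∉ frameBox P T δ ε := hy
      simp [modifyBox, hy']
    have hxN : x ∈ N := hq
    refine ⟨?_, ?_⟩
    · have h1 := frontier_inter_open_inter (s := meridian (n := m + 2) ⁻¹' modifyBox A P T δ ε h) hNo
      have h2 := frontier_inter_open_inter (s := meridian (n := m + 2) ⁻¹' A) hNo
      rw [hsame, h2] at h1
      exact (h1.symm.subset ⟨hx, hxN⟩).1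
    · rintro ⟨u, hu, hux⟩
      refine hq ?_
      rw [← hux]
      have hu' : |u| ≤ δ := abs_le.2 hu
      exact ⟨by simpa [frameFst_framePoint hb.unit] using hu',
        by simpa [frameSnd_framePoint hb.unit] using (hb.bound u hu').le⟩

/-- An inequality suffices for the comparison. The lost area is added on the left because
subtraction in `ENNReal` is truncated. -/
theorem weightedPerimeter_modifyBox_add_le (hb : IsEpigraphBox A P T f R δ ε) (hA : IsOpen A)
    (hh : Continuous h) (hhf : ∀ u, δ ≤ |u| → h u = f u) (hhε : ∀ u, |u| ≤ δ → |h u| < ε) :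
    weightedPerimeter (m + 2) p (meridian ⁻¹' modifyBox A P T δ ε h) +
        revolutionArea m p (fun u => framePoint P T (u, f u)) (Icc (-δ) δ) ≤
      weightedPerimeter (m + 2) p (meridian ⁻¹' A) +
        revolutionArea m p (fun u => framePoint P T (u, h u)) (Icc (-δ) δ) := by
  have hfc := hb.continuous
  have hcf : Continuous fun u => framePoint P T (u, f u) :=
    (continuous_framePoint P T).comp (by fun_prop)
  have hS := measurableSet_revolution (m := m) (a := -δ) (b := δ) hcf.continuousOn
  have hSf : meridian (n := m + 2) ⁻¹' ((fun u => framePoint P T (u, f u)) '' Icc (-δ) δ) ⊆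
      frontier (meridian (n := m + 2) ⁻¹' A) := by
    rintro x ⟨u, hu, hux⟩
    have hu' : |u| ≤ δ := abs_le.2 hu
    have hpos := hb.pos (u, f u) (hu'.trans_lt hb.delta_lt) ((hb.bound u hu').trans hb.eps_lt)
    simp only at hux
    rw [hux] at hpos
    rw [mem_frontier_preimage_meridian hA hpos, ← hux]
    exact hb.mem_frontier u hu'
  rw [weightedPerimeter_eq, weightedPerimeter_eq, revolutionArea, revolutionArea]
  have h1 := lintegral_mono_set (μ := μH[(m : ℝ) + 1]) (f := fun x => ENNReal.ofReal (‖x‖ ^ p))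
    (hb.frontier_modifyBox_subset (m := m) hh hhf hhε)
  have h2 := h1.trans (lintegral_union_le _ _ _)
  refine (add_le_add_left h2 _).trans ?_
  rw [add_right_comm]
  refine add_le_add_left ?_ _
  rw [add_comm, ← lintegral_inter_add_sdiff (μ := μH[(m : ℝ) + 1]) _
    (frontier (meridian (n := m + 2) ⁻¹' A)) hS, inter_eq_self_of_subset_right hSf]

end IsEpigraphBox

end Modification

/-! ### The volume of the modified region. -/

section ModifiedVolume

variable {m : ℕ} {p : ℝ} {A : Set Plane} {P T : Plane} {f h : ℝ → ℝ} {R δ ε : ℝ}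

/-- The density of the weighted volume and area in the meridian half-plane. -/
noncomputable def meridianDensity (m : ℕ) (p : ℝ) (q : Plane) : ℝ := ‖q‖ ^ p * q 1 ^ m

theorem continuous_meridianDensity (hp : 0 < p) : Continuous (meridianDensity m p) := by
  unfold meridianDensity
  exact (continuous_norm.rpow_const fun _ => Or.inr hp.le).mul (by fun_prop)

theorem meridianDensity_nonneg {q : Plane} (hq : 0 ≤ q 1) : 0 ≤ meridianDensity m p q := by
  unfold meridianDensity; positivity

theorem meridianDensity_pos {q : Plane} (hq : 0 < q 1) : 0 < meridianDensity m p q := by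
  have : q ≠ 0 := by rintro rfl; simp at hq
  unfold meridianDensity
  have := norm_pos_iff.2 this
  positivity

/-- Integration over the part of a box above a graph. -/
theorem setLIntegral_epigraph {F : ℝ × ℝ → ℝ} (hF : Continuous F) (hh : Continuous h)
    (hδ : 0 ≤ δ) (hhε : ∀ u, |u| ≤ δ → |h u| < ε)
    (hF0 : ∀ w : ℝ × ℝ, |w.1| ≤ δ → |w.2| ≤ ε → 0 ≤ F w) :
    ∫⁻ w in {w : ℝ × ℝ | |w.1| ≤ δ ∧ |w.2| ≤ ε ∧ h w.1 < w.2}, ENNReal.ofReal (F w) =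
      ENNReal.ofReal (∫ u in (-δ)..δ, ∫ v in (h u)..ε, F (u, v)) := by
  have hmS : MeasurableSet {w : ℝ × ℝ | |w.1| ≤ δ ∧ |w.2| ≤ ε ∧ h w.1 < w.2} := by
    have h1 : MeasurableSet {w : ℝ × ℝ | |w.1| ≤ δ} :=
      (isClosed_le (by fun_prop) continuous_const).measurableSet
    have h2 : MeasurableSet {w : ℝ × ℝ | |w.2| ≤ ε} :=
      (isClosed_le (by fun_prop) continuous_const).measurableSet
    have h3 : MeasurableSet {w : ℝ × ℝ | h w.1 < w.2} :=
      (isOpen_lt (by fun_prop) (by fun_prop)).measurableSet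
    exact h1.inter (h2.inter h3)
  have hinner : ∀ u, |u| ≤ δ → 0 ≤ ∫ v in (h u)..ε, F (u, v) := fun u hu => by
    have := abs_lt.1 (hhε u hu)
    refine intervalIntegral.integral_nonneg this.2.le fun v hv => hF0 _ hu ?_
    exact abs_le.2 ⟨by linarith [hv.1], hv.2⟩
  have hcont : Continuous fun u => ∫ v in (h u)..ε, F (u, v) := by
    have h1 : (fun u => ∫ v in (h u)..ε, F (u, v)) = fun u => -∫ v in ε..(h u), F (u, v) := by
      funext u; rw [intervalIntegral.integral_symm]
    rw [h1]
    exact (intervalIntegral.continuous_parametric_intervalIntegral_of_continuous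
      (f := fun u v => F (u, v)) (by fun_prop) hh).neg
  rw [← lintegral_indicator hmS, Measure.volume_eq_prod, lintegral_prod _
    ((by fun_prop : Measurable fun w => ENNReal.ofReal (F w)).indicator hmS).aemeasurable]
  rw [intervalIntegral.integral_of_le (by linarith), ← integral_Icc_eq_integral_Ioc,
    ofReal_integral_eq_lintegral_ofReal (hcont.continuousOn.integrableOn_Icc)
    ((ae_restrict_iff' measurableSet_Icc).2 (Eventually.of_forall fun u hu =>
      hinner u (abs_le.2 hu))), ← lintegral_indicator measurableSet_Icc]
  refine lintegral_congr fun u => ?_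
  by_cases hu : |u| ≤ δ
  · have hh' := abs_lt.1 (hhε u hu)
    have hu' : u ∈ Icc (-δ) δ := abs_le.1 hu
    rw [indicator_of_mem hu', intervalIntegral.integral_of_le hh'.2.le,
      ofReal_integral_eq_lintegral_ofReal, ← lintegral_indicator measurableSet_Ioc]
    · refine lintegral_congr fun v => ?_
      simp only [indicator, mem_ofPred_eq, mem_Ioc, hu, true_and]
      refine if_congr ⟨fun hv => ⟨hv.2, (abs_le.1 hv.1).2⟩, fun hv => ⟨?_, hv.1⟩⟩ rfl rfl
      exact abs_le.2 ⟨by linarith [hv.1], hv.2⟩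
    · exact ((by fun_prop : Continuous fun v => F (u, v)).continuousOn.integrableOn_Icc).mono_set
        Ioc_subset_Icc_self
    · refine (ae_restrict_iff' measurableSet_Ioc).2 (Eventually.of_forall fun v hv => ?_)
      exact hF0 _ hu (abs_le.2 ⟨by linarith [hv.1], hv.2⟩)
  · have hu' : u ∉ Icc (-δ) δ := fun h => hu (abs_le.2 h)
    rw [indicator_of_notMem hu']
    simp [indicator, hu]

theorem weightedVolume_preimage_meridian {S : Set Plane} (hS : MeasurableSet S) :
    weightedVolume (m + 2) p (meridian ⁻¹' S) =
      ∫⁻ x : EuclideanSpace ℝ (Fin (m + 2)),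
        S.indicator (fun q => ENNReal.ofReal (‖q‖ ^ p)) (meridian x) := by
  rw [weightedVolume, ← lintegral_indicator (continuous_meridian.measurable hS)]
  refine lintegral_congr fun x => ?_
  by_cases hx : meridian x ∈ S
  · rw [indicator_of_mem hx, indicator_of_mem (by exact hx), norm_meridian]
  · rw [indicator_of_notMem hx, indicator_of_notMem (by exact hx)]

namespace IsEpigraphBox

theorem measurableSet_modifyBox (hA : IsOpen A) (hh : Continuous h) :
    MeasurableSet (modifyBox A P T δ ε h) :=
  (hA.measurableSet.diff isClosed_frameBox.measurableSet).union
    (isClosed_frameBox.measurableSet.inter (isOpen_frameEpigraph hh).measurableSet)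

theorem weightedVolume_modifyBox (hb : IsEpigraphBox A P T f R δ ε) (hp : 0 < p)
    {D : ℝ≥0} (hD : ∀ F : Plane → ℝ≥0∞, Measurable F →
      ∫⁻ x : EuclideanSpace ℝ (Fin (m + 2)), F (meridian x) =
        D * ∫⁻ q in {q : Plane | 0 < q 1}, ENNReal.ofReal (q 1 ^ m) * F q)
    (hh : Continuous h) (hhε : ∀ u, |u| ≤ δ → |h u| < ε) :
    weightedVolume (m + 2) p (meridian ⁻¹' modifyBox A P T δ ε h) =
      weightedVolume (m + 2) p (meridian ⁻¹' (A \ frameBox P T δ ε)) +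
        ENNReal.ofReal (D * ∫ u in (-δ)..δ, ∫ v in (h u)..ε,
          meridianDensity m p (framePoint P T (u, v))) := by
  have hB := (isClosed_frameBox (P := P) (T := T) (δ := δ) (ε := ε)).measurableSet
  have hBE := hB.inter (isOpen_frameEpigraph (P := P) (T := T) hh).measurableSet
  have hc := continuous_meridian (n := m + 2)
  have hmF : Measurable fun q : Plane => ENNReal.ofReal (‖q‖ ^ p) := by fun_prop
  have h1 : weightedVolume (m + 2) p (meridian ⁻¹' modifyBox A P T δ ε h) =
      weightedVolume (m + 2) p (meridian ⁻¹' (A \ frameBox P T δ ε)) +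
      weightedVolume (m + 2) p (meridian ⁻¹' (frameBox P T δ ε ∩ frameEpigraph P T h)) := by
    unfold weightedVolume modifyBox
    rw [preimage_union, lintegral_union (hc.measurable hBE)]
    refine Disjoint.preimage _ ?_
    exact disjoint_sdiff_left.mono_right inter_subset_left
  rw [h1, weightedVolume_preimage_meridian hBE, hD _ (hmF.indicator hBE),
    ENNReal.ofReal_mul D.coe_nonneg, ENNReal.ofReal_coe_nnreal]
  congr 2
  have hpos : MeasurableSet {q : Plane | 0 < q 1} :=
    (isOpen_lt continuous_const (by fun_prop)).measurableSet
  have hS : {w : ℝ × ℝ | |w.1| ≤ δ ∧ |w.2| ≤ ε ∧ h w.1 < w.2} =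
      framePoint P T ⁻¹' (frameBox P T δ ε ∩ frameEpigraph P T h) := by
    ext w
    simp [frameBox, frameEpigraph, frameFst_framePoint hb.unit, frameSnd_framePoint hb.unit,
      and_assoc]
  have hmem : MeasurableSet {w : ℝ × ℝ | |w.1| ≤ δ ∧ |w.2| ≤ ε ∧ h w.1 < w.2} := by
    rw [hS]
    exact (continuous_framePoint P T).measurable hBE
  have hmG : Measurable fun q : Plane => ENNReal.ofReal (q 1 ^ m) *
      (frameBox P T δ ε ∩ frameEpigraph P T h).indicator (fun q => ENNReal.ofReal (‖q‖ ^ p)) q :=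
    (by fun_prop : Measurable fun q : Plane => ENNReal.ofReal (q 1 ^ m)).mul (hmF.indicator hBE)
  rw [← lintegral_indicator hpos, ← setLIntegral_epigraph (F := fun w =>
    meridianDensity m p (framePoint P T w))
    ((continuous_meridianDensity hp).comp (continuous_framePoint P T)) hh hb.delta_pos.le hhε
    fun w h1 h2 => meridianDensity_nonneg (hb.pos w (h1.trans_lt hb.delta_lt)
      (h2.trans_lt hb.eps_lt)).le,
    ← (volume_preserving_framePoint P hb.unit).lintegral_comp (hmG.indicator hpos),
    ← lintegral_indicator hmem]
  refine lintegral_congr fun w => ?_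
  by_cases hw : framePoint P T w ∈ frameBox P T δ ε ∩ frameEpigraph P T h
  · have hw' : w ∈ {w : ℝ × ℝ | |w.1| ≤ δ ∧ |w.2| ≤ ε ∧ h w.1 < w.2} := by rw [hS]; exact hw
    have h0 := hb.pos' hw.1
    rw [indicator_of_mem hw', indicator_of_mem (by exact h0), indicator_of_mem hw,
      ← ENNReal.ofReal_mul (by positivity), meridianDensity, mul_comm]
  · have hw' : w ∉ {w : ℝ × ℝ | |w.1| ≤ δ ∧ |w.2| ≤ ε ∧ h w.1 < w.2} := by rw [hS]; exact hw
    rw [indicator_of_notMem hw']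
    simp [indicator, hw]

end IsEpigraphBox

end ModifiedVolume

/-! ### Area and volume functionals of graphs. -/

section GraphFunctionals

variable {m : ℕ} {p : ℝ} {A : Set Plane} {P T : Plane} {f f' h h' : ℝ → ℝ} {R δ ε : ℝ}

/-- The weighted area of the surface generated by a graph in a frame, up to a constant. -/
noncomputable def graphArea (m : ℕ) (p : ℝ) (P T : Plane) (δ : ℝ) (h h' : ℝ → ℝ) : ℝ :=
  ∫ u in (-δ)..δ, meridianDensity m p (framePoint P T (u, h u)) * √(1 + h' u ^ 2)

/-- The weighted volume of the body generated by the region in a box above a graph, up to a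
constant. -/
noncomputable def graphVolume (m : ℕ) (p : ℝ) (P T : Plane) (δ ε : ℝ) (h : ℝ → ℝ) : ℝ :=
  ∫ u in (-δ)..δ, ∫ v in (h u)..ε, meridianDensity m p (framePoint P T (u, v))

theorem hasDerivAt_framePoint {g : ℝ → ℝ} {g' u : ℝ} (hg : HasDerivAt g g' u) :
    HasDerivAt (fun u => framePoint P T (u, g u)) (!₂[T 0 - g' * T 1, T 1 + g' * T 0] : Plane) u := by
  rw [Plane.hasDerivAt_iff]
  constructor
  · have := (((hasDerivAt_id u).mul_const (T 0)).const_add (P 0)).sub (hg.mul_const (T 1))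
    rw [one_mul] at this
    exact this
  · have := (((hasDerivAt_id u).mul_const (T 1)).const_add (P 1)).add (hg.mul_const (T 0))
    rw [one_mul] at this
    exact this

theorem norm_frame_tangent (hT : T 0 ^ 2 + T 1 ^ 2 = 1) (k : ℝ) :
    ‖(!₂[T 0 - k * T 1, T 1 + k * T 0] : Plane)‖ = √(1 + k ^ 2) := by
  rw [← Real.sqrt_sq (norm_nonneg _), Plane.norm_sq]
  congr 1
  simp
  linear_combination (1 + k ^ 2) * hT

theorem revolutionArea_graph {C : ℝ≥0} (hC : IsCylinderConstant m C)
    (hT : T 0 ^ 2 + T 1 ^ 2 = 1) (hδ : 0 ≤ δ) (hh : ∀ u, HasDerivAt h (h' u) u)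
    (hh' : Continuous h') (hpos : ∀ u ∈ Icc (-δ) δ, 0 < framePoint P T (u, h u) 1) :
    revolutionArea m p (fun u => framePoint P T (u, h u)) (Icc (-δ) δ) =
      ENNReal.ofReal (C * graphArea m p P T δ h h') := by
  have hc' : Continuous fun u => (!₂[T 0 - h' u * T 1, T 1 + h' u * T 0] : Plane) := by
    refine (PiLp.continuous_toLp 2 _).comp (continuous_pi fun i => ?_)
    fin_cases i <;> simp <;> fun_prop
  have hd := fun u => hasDerivAt_framePoint (P := P) (T := T) (hh u)
  rw [revolutionArea_eq (c' := fun u => !₂[T 0 - h' u * T 1, T 1 + h' u * T 0]) hC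
    (by linarith)
    (fun u _ => hasStrictDerivAt_of_hasDerivAt_of_continuousAt
      (Eventually.of_forall fun u => hd u) hc'.continuousAt)
    (fun u _ => Eventually.of_forall fun s => (hd s).continuousAt) hc'.continuousOn ?_ hpos ?_]
  · simp only [norm_frame_tangent hT]
    rfl
  · intro u _ h0
    have h1 := norm_frame_tangent hT (h' u)
    rw [h0, norm_zero] at h1
    have : 0 < √(1 + h' u ^ 2) := by positivity
    linarith
  · intro u _ v _ huv
    have := congrArg (frameFst P T) huv
    simpa [frameFst_framePoint hT] using this

namespace IsEpigraphBox

/-- The isoperimetric inequality for variations of a boundary arc. -/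
theorem perimeter_le_variation {C D : ℝ≥0} (hb : IsEpigraphBox A P T f R δ ε) (hp : 0 < p)
    (hA : IsOpen A) (hC : IsCylinderConstant m C)
    (hD : ∀ F : Plane → ℝ≥0∞, Measurable F →
      ∫⁻ x : EuclideanSpace ℝ (Fin (m + 2)), F (meridian x) =
        D * ∫⁻ q in {q : Plane | 0 < q 1}, ENNReal.ofReal (q 1 ^ m) * F q)
    (hE : IsIsoperimetric (m + 2) p (meridian ⁻¹' A))
    (hE0 : weightedVolume (m + 2) p (meridian ⁻¹' A) ≠ 0)
    (hf : ∀ u, HasDerivAt f (f' u) u) (hf' : Continuous f')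
    (hh : ∀ u, HasDerivAt h (h' u) u) (hh' : Continuous h')
    (hhf : h δ = f δ) (hhf' : h (-δ) = f (-δ)) (hhε : ∀ u, |u| ≤ δ → |h u| < ε)
    (hv : 0 < (weightedVolume (m + 2) p (meridian ⁻¹' A)).toReal +
      D * (graphVolume m p P T δ ε h - graphVolume m p P T δ ε f)) :
    (weightedPerimeter (m + 2) p (meridian ⁻¹' A)).toReal ≤
      ((weightedVolume (m + 2) p (meridian ⁻¹' A)).toReal /
        ((weightedVolume (m + 2) p (meridian ⁻¹' A)).toReal +
          D * (graphVolume m p P T δ ε h - graphVolume m p P T δ ε f))) ^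
            (((m : ℝ) + 1 + p) / ((m : ℝ) + 2 + p)) *
      ((weightedPerimeter (m + 2) p (meridian ⁻¹' A)).toReal +
        C * (graphArea m p P T δ h h' - graphArea m p P T δ f f')) := by
  have hδ := hb.delta_pos
  have hfc := hb.continuous
  have hhc : Continuous h := continuous_iff_continuousAt.2 fun u => (hh u).continuousAt
  -- `H` agrees with `h` on `[-δ, δ]` and with `f` beyond. It may have corners at `±δ`, but the
  -- modification needs only continuity, and the area over `[-δ, δ]` is computed from `h`.
  set H : ℝ → ℝ := fun u => f u + (h (max (-δ) (min u δ)) - f (max (-δ) (min u δ))) with hH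
  have hHc : Continuous H := by fun_prop
  have hHh : ∀ u, |u| ≤ δ → H u = h u := fun u hu => by
    have hu' := abs_le.1 hu
    simp only [hH]
    rw [min_eq_left hu'.2, max_eq_right hu'.1]; ring
  have hHf : ∀ u, δ ≤ |u| → H u = f u := fun u hu => by
    simp only [hH]
    rcases le_abs.1 hu with hu | hu
    · rw [min_eq_right hu, max_eq_right (by linarith), hhf]; ring
    · rw [min_eq_left (by linarith), max_eq_left (by linarith), hhf']; ring
  have hHε : ∀ u, |u| ≤ δ → |H u| < ε := fun u hu => by rw [hHh u hu]; exact hhε u hu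
  have hpos : ∀ g : ℝ → ℝ, (∀ u, |u| ≤ δ → |g u| < ε) →
      ∀ u ∈ Icc (-δ) δ, 0 < framePoint P T (u, g u) 1 := fun g hg u hu =>
    hb.pos (u, g u) ((abs_le.2 hu).trans_lt hb.delta_lt) ((hg u (abs_le.2 hu)).trans hb.eps_lt)
  have hnn : ∀ g : ℝ → ℝ, (∀ u, |u| ≤ δ → |g u| < ε) → 0 ≤ graphVolume m p P T δ ε g := by
    intro g hg
    refine intervalIntegral.integral_nonneg (by linarith) fun u hu => ?_
    have h1 := abs_lt.1 (hg u (abs_le.2 hu))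
    refine intervalIntegral.integral_nonneg h1.2.le fun v hv => meridianDensity_nonneg ?_
    refine (hb.pos (u, v) ((abs_le.2 hu).trans_lt hb.delta_lt) ?_).le
    exact (abs_le.2 ⟨by linarith [hv.1], hv.2⟩ : |v| ≤ ε).trans_lt hb.eps_lt
  have hgv : graphVolume m p P T δ ε H = graphVolume m p P T δ ε h := by
    refine intervalIntegral.integral_congr fun u hu => ?_
    rw [uIcc_of_le (by linarith)] at hu
    simp only [hHh u (abs_le.2 hu)]
  have hRH : revolutionArea m p (fun u => framePoint P T (u, H u)) (Icc (-δ) δ) =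
      revolutionArea m p (fun u => framePoint P T (u, h u)) (Icc (-δ) δ) := by
    have : (fun u => framePoint P T (u, H u)) '' Icc (-δ) δ =
        (fun u => framePoint P T (u, h u)) '' Icc (-δ) δ :=
      image_congr fun u hu => by simp only [hHh u (abs_le.2 hu)]
    rw [revolutionArea, revolutionArea, this]
  set E := meridian (n := m + 2) ⁻¹' A with hEdef
  set E' := meridian (n := m + 2) ⁻¹' modifyBox A P T δ ε H with hE'
  have hPfin := hE.perimeter_ne_top hp hE0
  have hV1 := hb.weightedVolume_modifyBox (m := m) hp hD hHc hHε
  have hV0 := hb.weightedVolume_modifyBox (m := m) hp hD hfc hb.bound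
  rw [hb.modifyBox_self] at hV0
  have hrest : weightedVolume (m + 2) p (meridian ⁻¹' (A \ frameBox P T δ ε)) ≠ ⊤ := by
    refine ne_top_of_le_ne_top hE.volume_ne_top ?_
    exact lintegral_mono_set (preimage_mono sdiff_subset)
  have hV1t : (weightedVolume (m + 2) p E').toReal = (weightedVolume (m + 2) p E).toReal +
      D * (graphVolume m p P T δ ε h - graphVolume m p P T δ ε f) := by
    rw [hV1, hV0, ENNReal.toReal_add hrest ENNReal.ofReal_ne_top,
      ENNReal.toReal_add hrest ENNReal.ofReal_ne_top]
    change _ + (ENNReal.ofReal (D * graphVolume m p P T δ ε H)).toReal =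
      _ + (ENNReal.ofReal (D * graphVolume m p P T δ ε f)).toReal + _
    rw [ENNReal.toReal_ofReal (mul_nonneg D.coe_nonneg (hnn _ hHε)),
      ENNReal.toReal_ofReal (mul_nonneg D.coe_nonneg (hnn _ hb.bound)), hgv]
    ring
  have hV1fin : weightedVolume (m + 2) p E' ≠ ⊤ := by
    rw [hV1]; exact ENNReal.add_ne_top.2 ⟨hrest, ENNReal.ofReal_ne_top⟩
  have hV1ne : weightedVolume (m + 2) p E' ≠ 0 := by
    intro h0
    rw [h0, ENNReal.toReal_zero] at hV1t
    exact hv.ne hV1t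
  have hmeas : MeasurableSet E' :=
    continuous_meridian.measurable (measurableSet_modifyBox hA hHc)
  have hP := hb.weightedPerimeter_modifyBox_add_le (m := m) (p := p) hA hHc hHf hHε
  rw [hRH, revolutionArea_graph hC hb.unit hδ.le hf hf' (hpos f hb.bound),
    revolutionArea_graph hC hb.unit hδ.le hh hh' (hpos h hhε)] at hP
  have hGnn : ∀ g g' : ℝ → ℝ, (∀ u, |u| ≤ δ → |g u| < ε) → 0 ≤ graphArea m p P T δ g g' :=
    fun g g' hg => intervalIntegral.integral_nonneg (by linarith) fun u hu =>
      mul_nonneg (meridianDensity_nonneg (hpos g hg u hu).le) (Real.sqrt_nonneg _)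
  have hsum : weightedPerimeter (m + 2) p E +
      ENNReal.ofReal (C * graphArea m p P T δ h h') ≠ ⊤ :=
    ENNReal.add_ne_top.2 ⟨hPfin, ENNReal.ofReal_ne_top⟩
  have hP'fin : weightedPerimeter (m + 2) p E' ≠ ⊤ :=
    ne_top_of_le_ne_top hsum (le_self_add.trans hP)
  have hP1 : (weightedPerimeter (m + 2) p E').toReal ≤ (weightedPerimeter (m + 2) p E).toReal +
      C * (graphArea m p P T δ h h' - graphArea m p P T δ f f') := by
    have := ENNReal.toReal_mono hsum hP
    rw [ENNReal.toReal_add hP'fin ENNReal.ofReal_ne_top,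
      ENNReal.toReal_add hPfin ENNReal.ofReal_ne_top,
      ENNReal.toReal_ofReal (mul_nonneg C.coe_nonneg (hGnn _ _ hb.bound)),
      ENNReal.toReal_ofReal (mul_nonneg C.coe_nonneg (hGnn _ _ hhε))] at this
    linarith
  have hmain := hE.perimeter_le hp hE0 hmeas hV1ne hV1fin
  rw [hV1t] at hmain
  have hq : 0 ≤ ((weightedVolume (m + 2) p E).toReal /
      ((weightedVolume (m + 2) p E).toReal +
        D * (graphVolume m p P T δ ε h - graphVolume m p P T δ ε f))) ^
            (((m : ℝ) + 1 + p) / ((m : ℝ) + 2 + p)) :=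
    Real.rpow_nonneg (div_nonneg ENNReal.toReal_nonneg hv.le) _
  have h2 := ENNReal.toReal_mono (ENNReal.mul_ne_top ENNReal.ofReal_ne_top hP'fin) hmain
  rw [ENNReal.toReal_mul, ENNReal.toReal_ofReal hq] at h2
  exact h2.trans (mul_le_mul_of_nonneg_left hP1 hq)

end IsEpigraphBox

end GraphFunctionals

/-! ### First variation of area and volume. -/

section FirstVariation

variable {m : ℕ} {p : ℝ} {A : Set Plane} {P T : Plane} {f f' h h' : ℝ → ℝ} {R δ ε : ℝ}

/-- The logarithmic derivative of the density at `q` in the direction `V`. -/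
noncomputable def logDensityDeriv (m : ℕ) (p : ℝ) (q V : Plane) : ℝ :=
  p * inner ℝ q V / ‖q‖ ^ 2 + m * V 1 / q 1

theorem hasDerivAt_meridianDensity {c : ℝ → Plane} {V : Plane} {t : ℝ} (hc : HasDerivAt c V t)
    (hpos : 0 < c t 1) :
    HasDerivAt (fun t => meridianDensity m p (c t))
      (logDensityDeriv m p (c t) V * meridianDensity m p (c t)) t := by
  have hn : 0 < ‖c t‖ := norm_pos_iff.2 (by rintro h; rw [h] at hpos; simp at hpos)
  have h1 : HasDerivAt (fun t => ‖c t‖ ^ p) (p * inner ℝ (c t) V / ‖c t‖ ^ 2 * ‖c t‖ ^ p) t := by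
    have h2 := (hc.norm_sq.rpow_const (p := p / 2) (Or.inl (by positivity)))
    have e : ∀ x : Plane, (‖x‖ ^ 2) ^ (p / 2) = ‖x‖ ^ p := fun x => by
      rw [← Real.rpow_natCast, ← Real.rpow_mul (norm_nonneg _)]
      congr 1
      push_cast
      ring
    simp only [e] at h2
    refine h2.congr_deriv ?_
    rw [Real.rpow_sub_one (by positivity), e]
    field_simp
  have h3 : HasDerivAt (fun t => c t 1 ^ m) (m * V 1 / c t 1 * c t 1 ^ m) t := by
    refine ((Plane.hasDerivAt_iff.1 hc).2.fun_pow m).congr_deriv ?_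
    rcases m with _ | k
    · simp
    · simp only [Nat.add_sub_cancel]
      field_simp
      ring
  refine (h1.fun_mul h3).congr_deriv ?_
  rw [logDensityDeriv, meridianDensity]
  ring

/-- The left normal. -/
def leftNormal (T : Plane) : Plane := !₂[-T 1, T 0]

theorem hasDerivAt_framePoint_snd {g : ℝ → ℝ} {g' t : ℝ} (hg : HasDerivAt g g' t) (u : ℝ) :
    HasDerivAt (fun t => framePoint P T (u, g t)) (g' • leftNormal T) t := by
  rw [Plane.hasDerivAt_iff]
  constructor
  · refine ((hg.mul_const (T 1)).const_sub (P 0 + u * T 0)).congr_deriv ?_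
    simp [leftNormal]
  · refine ((hg.mul_const (T 0)).const_add (P 1 + u * T 1)).congr_deriv ?_
    simp [leftNormal]

theorem logDensityDeriv_smul (q V : Plane) (k : ℝ) :
    logDensityDeriv m p q (k • V) = k * logDensityDeriv m p q V := by
  simp only [logDensityDeriv, inner_smul_right, PiLp.smul_apply, smul_eq_mul]
  ring

theorem continuousOn_logDensityDeriv (V : Plane) :
    ContinuousOn (fun q => logDensityDeriv m p q V) {q : Plane | 0 < q 1} := by
  unfold logDensityDeriv
  have h1 : ∀ q ∈ {q : Plane | 0 < q 1}, ‖q‖ ^ 2 ≠ 0 := by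
    intro q hq h
    have : q = 0 := by simpa using h
    rw [this] at hq
    simp at hq
  have h2 : ∀ q ∈ {q : Plane | 0 < q 1}, q 1 ≠ 0 := fun q hq => ne_of_gt hq
  refine ContinuousOn.add (ContinuousOn.div (by fun_prop) (by fun_prop) h1)
    (ContinuousOn.div (by fun_prop) (by fun_prop) h2)

namespace IsEpigraphBox

theorem eventually_abs_lt (hb : IsEpigraphBox A P T f R δ ε) {η : ℝ → ℝ} (hη : Continuous η) :
    ∀ᶠ t in 𝓝 (0 : ℝ), ∀ u ∈ Icc (-δ) δ, |f u + t * η u| < ε := by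
  have hfc := hb.continuous
  refine isCompact_Icc.eventually_forall_of_forall_eventually fun u hu => ?_
  have : Continuous fun z : ℝ × ℝ => |f z.2 + z.1 * η z.2| := by fun_prop
  exact this.continuousAt.eventually_lt_const (by simpa using hb.bound u (abs_le.2 hu))

theorem framePoint_pos (hb : IsEpigraphBox A P T f R δ ε) {u v : ℝ} (hu : u ∈ Icc (-δ) δ)
    (hv : |v| < ε) : 0 < framePoint P T (u, v) 1 :=
  hb.pos (u, v) ((abs_le.2 hu).trans_lt hb.delta_lt) (hv.trans hb.eps_lt)

/-- The variation `φ` of the slope is kept independent of the variation `η` of the height. They are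
linked by `η' = φ` only when the competitor is formed. -/
theorem hasDerivAt_graphArea (hb : IsEpigraphBox A P T f R δ ε) (hp : 0 < p)
    {φ η : ℝ → ℝ} (hf' : Continuous f') (hφ : Continuous φ) (hη : Continuous η) :
    HasDerivAt (fun t => graphArea m p P T δ (fun u => f u + t * η u) (fun u => f' u + t * φ u))
      (∫ u in (-δ)..δ, (logDensityDeriv m p (framePoint P T (u, f u)) (leftNormal T) *
          meridianDensity m p (framePoint P T (u, f u)) * √(1 + f' u ^ 2) * η u +
        meridianDensity m p (framePoint P T (u, f u)) * (f' u / √(1 + f' u ^ 2)) * φ u)) 0 := by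
  have hδ := hb.delta_pos
  have hfc := hb.continuous
  obtain ⟨τ₀, hτ₀, hτ⟩ := Metric.eventually_nhds_iff.1 (hb.eventually_abs_lt hη)
  set τ := τ₀ / 2 with hτdef
  have hτ0 : 0 < τ := half_pos hτ₀
  have hbd : ∀ t ∈ Icc (-τ) τ, ∀ u ∈ Icc (-δ) δ, |f u + t * η u| < ε := by
    intro t ht
    refine hτ ?_
    rw [Real.dist_eq, sub_zero, abs_lt]
    constructor <;> linarith [ht.1, ht.2]
  set q : ℝ → ℝ → Plane := fun t u => framePoint P T (u, f u + t * η u) with hq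
  have hqc : Continuous fun z : ℝ × ℝ => q z.1 z.2 :=
    (continuous_framePoint P T).comp (by fun_prop)
  have hqpos : ∀ t ∈ Icc (-τ) τ, ∀ u ∈ Icc (-δ) δ, 0 < q t u 1 :=
    fun t ht u hu => hb.framePoint_pos hu (hbd t ht u hu)
  have hωc : Continuous fun z : ℝ × ℝ => meridianDensity m p (q z.1 z.2) :=
    (continuous_meridianDensity hp).comp hqc
  have hs : ∀ x : ℝ, 0 < √(1 + x ^ 2) := fun x => by positivity
  have hsc : Continuous fun z : ℝ × ℝ => √(1 + (f' z.2 + z.1 * φ z.2) ^ 2) := by fun_prop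
  have key := hasDerivAt_intervalIntegral_of_continuousOn (a := -δ) (b := δ) (τ := τ)
    (F := fun t u => meridianDensity m p (q t u) * √(1 + (f' u + t * φ u) ^ 2))
    (F' := fun t u => logDensityDeriv m p (q t u) (leftNormal T) * meridianDensity m p (q t u) *
      √(1 + (f' u + t * φ u) ^ 2) * η u + meridianDensity m p (q t u) *
        ((f' u + t * φ u) / √(1 + (f' u + t * φ u) ^ 2)) * φ u)
    (by linarith) hτ0 ?_ ?_ ?_
  · simp only [hq, zero_mul, add_zero] at key
    exact key
  · intro t _
    have h0 : Continuous fun u => (u, f u + t * η u) := by fun_prop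
    have h1 := (continuous_meridianDensity (m := m) hp).comp
      ((continuous_framePoint P T).comp h0)
    exact (h1.mul (by fun_prop)).continuousOn
  · have h1 : ContinuousOn (fun z : ℝ × ℝ => logDensityDeriv m p (q z.1 z.2) (leftNormal T))
        (Icc (-τ) τ ×ˢ Icc (-δ) δ) := by
      refine ContinuousOn.comp (g := fun q => logDensityDeriv m p q (leftNormal T))
        (f := fun z : ℝ × ℝ => q z.1 z.2) (continuousOn_logDensityDeriv (leftNormal T))
        hqc.continuousOn fun z hz => ?_
      exact hqpos z.1 hz.1 z.2 hz.2
    have h2 : Continuous fun z : ℝ × ℝ =>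
        (f' z.2 + z.1 * φ z.2) / √(1 + (f' z.2 + z.1 * φ z.2) ^ 2) :=
      Continuous.div (by fun_prop) hsc fun z => (hs _).ne'
    exact (((h1.mul hωc.continuousOn).mul hsc.continuousOn).mul
      (hη.comp continuous_snd).continuousOn).add
      ((hωc.mul h2).mul (hφ.comp continuous_snd)).continuousOn
  · intro t ht u hu
    have h1 : HasDerivAt (fun t => f u + t * η u) (η u) t := by
      simpa using ((hasDerivAt_id t).mul_const (η u)).const_add (f u)
    have h2 : HasDerivAt (fun t => f' u + t * φ u) (φ u) t := by
      simpa using ((hasDerivAt_id t).mul_const (φ u)).const_add (f' u)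
    have h3 := hasDerivAt_meridianDensity (m := m) (p := p)
      (hasDerivAt_framePoint_snd (P := P) (T := T) h1 u) (hqpos t ht u hu)
    have h4 := ((h2.fun_pow 2).const_add 1).sqrt (by positivity)
    refine (h3.fun_mul h4).congr_deriv ?_
    rw [logDensityDeriv_smul]
    simp only [hq]
    have := (hs (f' u + t * φ u)).ne'
    field_simp
    ring

/-- Only the lower limit of the inner integral moves: raising the graph shrinks the epigraph, whence
the minus sign. -/
theorem hasDerivAt_graphVolume (hb : IsEpigraphBox A P T f R δ ε) (hp : 0 < p)
    {η : ℝ → ℝ} (hη : Continuous η) :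
    HasDerivAt (fun t => graphVolume m p P T δ ε (fun u => f u + t * η u))
      (∫ u in (-δ)..δ, -(meridianDensity m p (framePoint P T (u, f u)) * η u)) 0 := by
  have hδ := hb.delta_pos
  have hfc := hb.continuous
  have hω : Continuous fun w : ℝ × ℝ => meridianDensity m p (framePoint P T w) :=
    (continuous_meridianDensity hp).comp (continuous_framePoint P T)
  have key := hasDerivAt_intervalIntegral_of_continuousOn (a := -δ) (b := δ) (τ := 1)
    (F := fun t u => ∫ v in (f u + t * η u)..ε, meridianDensity m p (framePoint P T (u, v)))
    (F' := fun t u => -(meridianDensity m p (framePoint P T (u, f u + t * η u)) * η u))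
    (by linarith) one_pos ?_ ?_ ?_
  · simp only [zero_mul, add_zero] at key
    exact key
  · intro t _
    have h1 : (fun u => ∫ v in (f u + t * η u)..ε, meridianDensity m p (framePoint P T (u, v))) =
        fun u => -∫ v in ε..(f u + t * η u), meridianDensity m p (framePoint P T (u, v)) := by
      funext u; rw [intervalIntegral.integral_symm]
    rw [h1]
    exact (intervalIntegral.continuous_parametric_intervalIntegral_of_continuous
      (f := fun u v => meridianDensity m p (framePoint P T (u, v))) hω
      (by fun_prop)).neg.continuousOn
  · have h1 : Continuous fun z : ℝ × ℝ =>
        meridianDensity m p (framePoint P T (z.2, f z.2 + z.1 * η z.2)) :=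
      hω.comp (by fun_prop)
    exact (h1.mul (hη.comp continuous_snd)).neg.continuousOn
  · intro t _ u _
    have h1 : HasDerivAt (fun t => f u + t * η u) (η u) t := by
      simpa using ((hasDerivAt_id t).mul_const (η u)).const_add (f u)
    have hc : Continuous fun v => meridianDensity m p (framePoint P T (u, v)) :=
      hω.comp (by fun_prop)
    have h2 := (hc.integral_hasStrictDerivAt ε (f u + t * η u)).hasDerivAt.comp t h1
    refine h2.neg.congr_of_eventuallyEq (Eventually.of_forall fun s => ?_)
    simp only [Pi.neg_apply, Function.comp_apply]
    rw [intervalIntegral.integral_symm]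

end IsEpigraphBox

end FirstVariation

/-! ### The Euler–Lagrange equation in weak and strong form. -/

section EulerLagrange

variable {m : ℕ} {p : ℝ} {A : Set Plane} {P T : Plane} {f f' : ℝ → ℝ} {R δ ε : ℝ}

/-- The Lagrange multiplier of an isoperimetric region. -/
noncomputable def lagrangeMultiplier (m : ℕ) (p : ℝ) (E : Set (EuclideanSpace ℝ (Fin (m + 2))))
    (C D : ℝ) : ℝ :=
  (weightedPerimeter (m + 2) p E).toReal * (((m : ℝ) + 1 + p) / ((m : ℝ) + 2 + p)) * D /
    ((weightedVolume (m + 2) p E).toReal * C)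

namespace IsEpigraphBox

/-- The primitive `η` of `φ` vanishes at both ends of the interval, so `f + t η` is an admissible
competitor for small `t`. The scale invariant inequality gives a local minimum at `t = 0`; its
derivative combines the variations of area and volume, the latter weighted by the multiplier. -/
theorem integral_variation_eq_zero {C D : ℝ≥0} (hb : IsEpigraphBox A P T f R δ ε) (hp : 0 < p)
    (hA : IsOpen A) (hC0 : 0 < C) (hC : IsCylinderConstant m C)
    (hD : ∀ F : Plane → ℝ≥0∞, Measurable F →
      ∫⁻ x : EuclideanSpace ℝ (Fin (m + 2)), F (meridian x) =
        D * ∫⁻ q in {q : Plane | 0 < q 1}, ENNReal.ofReal (q 1 ^ m) * F q)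
    (hE : IsIsoperimetric (m + 2) p (meridian ⁻¹' A))
    (hE0 : weightedVolume (m + 2) p (meridian ⁻¹' A) ≠ 0)
    (hf : ∀ u, HasDerivAt f (f' u) u) (hf' : Continuous f') {φ : ℝ → ℝ} (hφ : Continuous φ)
    (hφ0 : ∫ u in (-δ)..δ, φ u = 0) :
    ∫ u in (-δ)..δ, ((logDensityDeriv m p (framePoint P T (u, f u)) (leftNormal T) *
        meridianDensity m p (framePoint P T (u, f u)) * √(1 + f' u ^ 2) +
        lagrangeMultiplier m p (meridian ⁻¹' A) C D *
          meridianDensity m p (framePoint P T (u, f u))) * (∫ s in (-δ)..u, φ s) +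
      meridianDensity m p (framePoint P T (u, f u)) * (f' u / √(1 + f' u ^ 2)) * φ u) = 0 := by
  have hδ := hb.delta_pos
  have hfc := hb.continuous
  set η : ℝ → ℝ := fun u => ∫ s in (-δ)..u, φ s with hη
  have hηd : ∀ u, HasDerivAt η (φ u) u :=
    fun u => (hφ.integral_hasStrictDerivAt (-δ) u).hasDerivAt
  have hηc : Continuous η := continuous_iff_continuousAt.2 fun u => (hηd u).continuousAt
  have hη1 : η δ = 0 := hφ0
  have hη0 : η (-δ) = 0 := by simp [hη]
  set E := meridian (n := m + 2) ⁻¹' A with hEdef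
  set Pe := (weightedPerimeter (m + 2) p E).toReal with hPe
  set Ve := (weightedVolume (m + 2) p E).toReal with hVe
  have hVe0 : 0 < Ve := ENNReal.toReal_pos hE0 hE.volume_ne_top
  set κ := ((m : ℝ) + 1 + p) / ((m : ℝ) + 2 + p) with hκ
  have hG := hb.hasDerivAt_graphArea (m := m) hp hf' hφ hηc
  have hK := hb.hasDerivAt_graphVolume (m := m) hp hηc
  set G : ℝ → ℝ := fun t => graphArea m p P T δ (fun u => f u + t * η u) (fun u => f' u + t * φ u)
    with hGdef
  set K : ℝ → ℝ := fun t => graphVolume m p P T δ ε (fun u => f u + t * η u) with hKdef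
  have hG0 : G 0 = graphArea m p P T δ f f' := by simp [hGdef]
  have hK0 : K 0 = graphVolume m p P T δ ε f := by simp [hKdef]
  generalize hG' : (∫ u in (-δ)..δ, (logDensityDeriv m p (framePoint P T (u, f u)) (leftNormal T) *
          meridianDensity m p (framePoint P T (u, f u)) * √(1 + f' u ^ 2) * η u +
        meridianDensity m p (framePoint P T (u, f u)) * (f' u / √(1 + f' u ^ 2)) * φ u)) = G'
    at hG
  generalize hK' : (∫ u in (-δ)..δ, -(meridianDensity m p (framePoint P T (u, f u)) * η u)) = K'
    at hK
  -- `Φ t` bounds from above the perimeter of the competitor rescaled to the volume of `E`, with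
  -- equality to the perimeter of `E` at `t = 0`.
  set Φ : ℝ → ℝ := fun t => (Ve / (Ve + D * (K t - K 0))) ^ κ * (Pe + C * (G t - G 0)) with hΦ
  have hΦ0 : Φ 0 = Pe := by
    simp [hΦ, div_self hVe0.ne']
  have hvol : HasDerivAt (fun t => Ve + D * (K t - K 0)) (D * K') 0 :=
    ((hK.sub_const _).const_mul _).const_add _
  have hvol0 : Ve + D * (K 0 - K 0) = Ve := by ring
  have hmin : IsLocalMin Φ 0 := by
    have h1 : ∀ᶠ t in 𝓝 (0 : ℝ), 0 < Ve + D * (K t - K 0) :=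
      hvol.continuousAt.eventually_const_lt (by simpa using hVe0)
    filter_upwards [h1, hb.eventually_abs_lt hηc] with t ht1 ht2
    rw [hΦ0]
    have hht : ∀ u, HasDerivAt (fun u => f u + t * η u) (f' u + t * φ u) u :=
      fun u => (hf u).add ((hηd u).const_mul t)
    rw [hK0] at ht1
    have := hb.perimeter_le_variation (m := m) hp hA hC hD hE hE0 hf hf' hht (by fun_prop)
      (by simp [hη1]) (by simp [hη0]) (fun u hu => ht2 u (abs_le.1 hu)) ht1
    simp only [hΦ, hG0, hK0]
    exact this
  have hderiv : HasDerivAt Φ (-(κ * D * K' / Ve) * Pe + C * G') 0 := by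
    have h1 : HasDerivAt (fun t => Ve / (Ve + D * (K t - K 0))) (-(D * K' / Ve)) 0 := by
      refine ((hasDerivAt_const (0 : ℝ) Ve).fun_div hvol (by rw [hvol0]; exact hVe0.ne')).congr_deriv ?_
      rw [hvol0]
      field_simp
      ring
    have h2 := h1.rpow_const (p := κ) (Or.inl (by rw [hvol0, div_self hVe0.ne']; exact one_ne_zero))
    have h3 : HasDerivAt (fun t => Pe + C * (G t - G 0)) (C * G') 0 :=
      ((hG.sub_const _).const_mul _).const_add _
    refine (h2.fun_mul h3).congr_deriv ?_
    rw [hvol0, div_self hVe0.ne', Real.one_rpow, Real.one_rpow, sub_self, mul_zero, add_zero]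
    ring
  have hzero := hmin.hasDerivAt_eq_zero hderiv
  have hωc : Continuous fun u => meridianDensity m p (framePoint P T (u, f u)) :=
    (continuous_meridianDensity hp).comp ((continuous_framePoint P T).comp (by fun_prop))
  have hLc : ContinuousOn (fun u => logDensityDeriv m p (framePoint P T (u, f u)) (leftNormal T))
      (uIcc (-δ) δ) := by
    rw [uIcc_of_le (by linarith)]
    refine ContinuousOn.comp (g := fun q => logDensityDeriv m p q (leftNormal T))
      (f := fun u => framePoint P T (u, f u)) (continuousOn_logDensityDeriv (leftNormal T))
      ((continuous_framePoint P T).comp (by fun_prop)).continuousOn fun u hu => ?_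
    exact hb.framePoint_pos hu (hb.bound u (abs_le.2 hu))
  have hsc : Continuous fun u => √(1 + f' u ^ 2) := by fun_prop
  have hqc : Continuous fun u => f' u / √(1 + f' u ^ 2) :=
    hf'.div hsc fun u => by positivity
  have hi1 : IntervalIntegrable (fun u => logDensityDeriv m p (framePoint P T (u, f u))
      (leftNormal T) * meridianDensity m p (framePoint P T (u, f u)) * √(1 + f' u ^ 2) * η u +
        meridianDensity m p (framePoint P T (u, f u)) * (f' u / √(1 + f' u ^ 2)) * φ u)
      volume (-δ) δ :=
    ((((hLc.mul hωc.continuousOn).mul hsc.continuousOn).mul hηc.continuousOn).add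
      ((hωc.mul hqc).mul hφ).continuousOn).intervalIntegrable
  have hi2 : IntervalIntegrable (fun u => -(meridianDensity m p (framePoint P T (u, f u)) * η u))
      volume (-δ) δ := (hωc.mul hηc).neg.intervalIntegrable _ _
  have hfinal : G' - lagrangeMultiplier m p E C D * K' = 0 := by
    have hC0' : (0 : ℝ) < C := hC0
    rw [lagrangeMultiplier, ← hPe, ← hVe, ← hκ]
    field_simp
    field_simp at hzero
    linarith
  rw [← hfinal, ← hG', ← hK', ← intervalIntegral.integral_const_mul,
    ← intervalIntegral.integral_sub hi1 (hi2.const_mul _)]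
  refine intervalIntegral.integral_congr fun u _ => ?_
  ring

/-- The Euler–Lagrange equation: the curvature of the boundary of an isoperimetric region. -/
theorem hasDerivAt_sin_angle {C D : ℝ≥0} (hb : IsEpigraphBox A P T f R δ ε) (hp : 0 < p)
    (hA : IsOpen A) (hC0 : 0 < C) (hC : IsCylinderConstant m C)
    (hD : ∀ F : Plane → ℝ≥0∞, Measurable F →
      ∫⁻ x : EuclideanSpace ℝ (Fin (m + 2)), F (meridian x) =
        D * ∫⁻ q in {q : Plane | 0 < q 1}, ENNReal.ofReal (q 1 ^ m) * F q)
    (hE : IsIsoperimetric (m + 2) p (meridian ⁻¹' A))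
    (hE0 : weightedVolume (m + 2) p (meridian ⁻¹' A) ≠ 0)
    (hf : ∀ u, HasDerivAt f (f' u) u) (hf' : Continuous f') (hf0 : f 0 = 0) (hf'0 : f' 0 = 0) :
    HasDerivAt (fun u => f' u / √(1 + f' u ^ 2))
      (lagrangeMultiplier m p (meridian ⁻¹' A) C D + m * T 0 / P 1 -
        p * (P 0 * T 1 - P 1 * T 0) / (P 0 ^ 2 + P 1 ^ 2)) 0 := by
  have hδ := hb.delta_pos
  have hfc := hb.continuous
  set H := lagrangeMultiplier m p (meridian (n := m + 2) ⁻¹' A) C D with hH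
  have hωc : Continuous fun u => meridianDensity m p (framePoint P T (u, f u)) :=
    (continuous_meridianDensity hp).comp ((continuous_framePoint P T).comp (by fun_prop))
  have hLc : ContinuousOn (fun u => logDensityDeriv m p (framePoint P T (u, f u)) (leftNormal T))
      (Icc (-δ) δ) := by
    refine ContinuousOn.comp (g := fun q => logDensityDeriv m p q (leftNormal T))
      (f := fun u => framePoint P T (u, f u)) (continuousOn_logDensityDeriv (leftNormal T))
      ((continuous_framePoint P T).comp (by fun_prop)).continuousOn fun u hu => ?_
    exact hb.framePoint_pos hu (hb.bound u (abs_le.2 hu))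
  have hsc : Continuous fun u => √(1 + f' u ^ 2) := by fun_prop
  have hqc : Continuous fun u => f' u / √(1 + f' u ^ 2) :=
    hf'.div hsc fun u => by positivity
  -- Although `f` is only `C¹`, the density times the sine of the slope angle becomes
  -- differentiable. The density along the graph is differentiable and positive, and dividing by it
  -- leaves the sine.
  have h1 := hasDerivAt_of_forall_integral_eq_zero
    (g := fun u => logDensityDeriv m p (framePoint P T (u, f u)) (leftNormal T) *
        meridianDensity m p (framePoint P T (u, f u)) * √(1 + f' u ^ 2) +
        H * meridianDensity m p (framePoint P T (u, f u)))
    (k := fun u => meridianDensity m p (framePoint P T (u, f u)) * (f' u / √(1 + f' u ^ 2)))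
    (by linarith : -δ < δ)
    (((hLc.mul hωc.continuousOn).mul hsc.continuousOn).add
      (continuous_const.mul hωc).continuousOn) (hωc.mul hqc).continuousOn
    (fun φ hφ hφ0 => hb.integral_variation_eq_zero hp hA hC0 hC hD hE hE0 hf hf' hφ hφ0)
    0 ⟨by linarith, hδ⟩
  have hP0 : framePoint P T (0, f 0) = P := by
    rw [hf0]; exact Plane.ext (by simp) (by simp)
  have hP1 : 0 < P 1 := by
    rw [← hP0]
    exact hb.framePoint_pos ⟨by linarith, hδ.le⟩ (hb.bound 0 (by simpa using hδ.le))
  have h2 := hasDerivAt_meridianDensity (m := m) (p := p)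
    (hasDerivAt_framePoint (P := P) (T := T) (hf 0)) (by rw [hP0]; exact hP1)
  have hω0 : 0 < meridianDensity m p P := meridianDensity_pos hP1
  have h3 := h1.fun_div h2 (by rw [hP0]; exact hω0.ne')
  simp only [hP0, hf'0] at h3
  have hev : (fun u => f' u / √(1 + f' u ^ 2)) =ᶠ[𝓝 0] fun u =>
      meridianDensity m p (framePoint P T (u, f u)) * (f' u / √(1 + f' u ^ 2)) /
        meridianDensity m p (framePoint P T (u, f u)) := by
    have : ∀ᶠ u in 𝓝 (0 : ℝ), 0 < meridianDensity m p (framePoint P T (u, f u)) :=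
      hωc.continuousAt.eventually_const_lt (by simp only [hP0]; exact hω0)
    filter_upwards [this] with u hu
    rw [mul_div_cancel_left₀ _ hu.ne']
  refine (h3.congr_of_eventuallyEq hev).congr_deriv ?_
  have hr : 0 < P 0 ^ 2 + P 1 ^ 2 := by positivity
  rw [logDensityDeriv, Plane.inner_eq, Plane.norm_sq]
  simp [leftNormal]
  field_simp
  ring

end IsEpigraphBox

end EulerLagrange

/-! ### Second derivatives of the generating curve. -/

namespace IsGeneratingCurve

variable {m : ℕ} {p : ℝ} {A : Set Plane} {β : ℝ} {γ : ℝ → Plane} {s₀ : ℝ}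

theorem exists_isEpigraphBox (hγ : IsGeneratingCurve A β γ) (hA : IsOpen A)
    (hx : ∀ q ∈ A, q 0 ≤ γ 0 0) (hs : s₀ ∈ Ioo 0 β) :
    ∃ (g g' : ℝ → ℝ) (R δ ε : ℝ), IsEpigraphBox A (γ s₀) (deriv γ s₀) g R δ ε ∧
      (∀ u, HasDerivAt g (g' u) u) ∧ Continuous g' ∧ g 0 = 0 ∧ g' 0 = 0 ∧
      ∀ᶠ s in 𝓝 s₀, frameSnd (γ s₀) (deriv γ s₀) (γ s) =
        g (frameFst (γ s₀) (deriv γ s₀) (γ s)) := by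
  have hs' : s₀ ∈ Ioo (-β) β := ⟨by linarith [hs.1, hγ.pos], hs.2⟩
  have hT := hγ.deriv_sq hs'
  obtain ⟨f, hf, hf0, hf', hgr, hmem, hfr⟩ := hγ.exists_local_epigraph hA hx hs'
  obtain ⟨g, g', hg'c, hg, hgf⟩ := hf.exists_eventuallyEq
  have hg0 : g 0 = 0 := by rw [hgf.eq_of_nhds, hf0]
  have hg'0 : g' 0 = 0 := by
    have := hgf.deriv_eq
    rwa [(hg 0).deriv, hf'] at this
  have hgc : Continuous g := continuous_iff_continuousAt.2 fun u => (hg u).continuousAt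
  have hgf2 : ∀ᶠ w : ℝ × ℝ in 𝓝 0, g w.1 = f w.1 :=
    (continuous_fst.tendsto (0 : ℝ × ℝ)).eventually hgf
  have hP : framePoint (γ s₀) (deriv γ s₀) 0 = γ s₀ := Plane.ext (by simp) (by simp)
  have hpos : ∀ᶠ w : ℝ × ℝ in 𝓝 0, 0 < framePoint (γ s₀) (deriv γ s₀) w 1 := by
    have hc : Continuous fun w => framePoint (γ s₀) (deriv γ s₀) w 1 := by
      have := continuous_framePoint (γ s₀) (deriv γ s₀)
      fun_prop
    refine hc.continuousAt.eventually_const_lt ?_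
    simp only [hP]
    exact hγ.above s₀ hs
  obtain ⟨R, hR, hall⟩ := Metric.eventually_nhds_iff.1 (hgf2.and (hmem.and (hfr.and hpos)))
  have hall' : ∀ w : ℝ × ℝ, |w.1| < R → |w.2| < R → dist w 0 < R := fun w h1 h2 => by
    rw [Prod.dist_eq]
    exact max_lt (by simpa using h1) (by simpa using h2)
  obtain ⟨δ₀, hδ₀, hsmall⟩ := Metric.eventually_nhds_iff.1
    ((hgc.abs.continuousAt (x := 0)).eventually_lt_const
      (show |g 0| < R / 2 by rw [hg0, abs_zero]; exact half_pos hR))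
  have hmin : 0 < min δ₀ R := lt_min hδ₀ hR
  have h1 := min_le_left δ₀ R
  have h2 := min_le_right δ₀ R
  have hbound : ∀ u, |u| ≤ min δ₀ R / 2 → |g u| < R / 2 := fun u hu => by
    refine hsmall ?_
    rw [Real.dist_eq, sub_zero]
    linarith
  refine ⟨g, g', R, min δ₀ R / 2, R / 2, ⟨hT, by linarith, by linarith, by linarith, hgc, hbound,
    ?_, ?_, ?_⟩, hg, hg'c, hg0, hg'0, ?_⟩
  · intro w hw1 hw2
    have := hall (hall' w hw1 hw2)
    rw [this.2.1, this.1]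
  · intro u hu
    have := hall (hall' (u, g u) (show |u| < R by linarith) ((hbound u hu).trans (by linarith)))
    exact this.2.2.1.2 this.1
  · intro w hw1 hw2
    exact (hall (hall' w hw1 hw2)).2.2.2
  · have hc : ContinuousAt (fun s => frameFst (γ s₀) (deriv γ s₀) (γ s)) s₀ :=
      (continuous_frameFst _ _).continuousAt.comp (hγ.hasDerivAt hs').continuousAt
    have h0 : frameFst (γ s₀) (deriv γ s₀) (γ s₀) = 0 := by simp [frameFst]
    have h3 : ∀ᶠ s in 𝓝 s₀, g (frameFst (γ s₀) (deriv γ s₀) (γ s)) =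
        f (frameFst (γ s₀) (deriv γ s₀) (γ s)) := by
      have hc' : Tendsto (fun s => frameFst (γ s₀) (deriv γ s₀) (γ s)) (𝓝 s₀) (𝓝 0) := by
        simpa only [ContinuousAt, h0] using hc
      exact hc'.eventually hgf
    filter_upwards [hgr, h3] with s h4 h5
    rw [h4, h5]

/-- The generating curve of an isoperimetric region is twice differentiable, with the curvature
prescribed by the Lagrange multiplier. -/
theorem hasDerivAt_deriv {C D : ℝ≥0} (hγ : IsGeneratingCurve A β γ) (hp : 0 < p)
    (hA : IsOpen A) (hx : ∀ q ∈ A, q 0 ≤ γ 0 0) (hC0 : 0 < C) (hC : IsCylinderConstant m C)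
    (hD : ∀ F : Plane → ℝ≥0∞, Measurable F →
      ∫⁻ x : EuclideanSpace ℝ (Fin (m + 2)), F (meridian x) =
        D * ∫⁻ q in {q : Plane | 0 < q 1}, ENNReal.ofReal (q 1 ^ m) * F q)
    (hE : IsIsoperimetric (m + 2) p (meridian ⁻¹' A))
    (hE0 : weightedVolume (m + 2) p (meridian ⁻¹' A) ≠ 0) (hs : s₀ ∈ Ioo 0 β)
    {κ : ℝ} (hκ : κ = lagrangeMultiplier m p (meridian ⁻¹' A) C D +
      m * deriv γ s₀ 0 / γ s₀ 1 - p * (γ s₀ 0 * deriv γ s₀ 1 - γ s₀ 1 * deriv γ s₀ 0) /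
        (γ s₀ 0 ^ 2 + γ s₀ 1 ^ 2)) :
    HasDerivAt (fun s => deriv γ s 0) (-κ * deriv γ s₀ 1) s₀ ∧
      HasDerivAt (fun s => deriv γ s 1) (κ * deriv γ s₀ 0) s₀ := by
  have hs' : s₀ ∈ Ioo (-β) β := ⟨by linarith [hs.1, hγ.pos], hs.2⟩
  obtain ⟨g, g', R, δ, ε, hb, hg, hg'c, hg0, hg'0, hgr⟩ := hγ.exists_isEpigraphBox hA hx hs
  have hσ := hb.hasDerivAt_sin_angle hp hA hC0 hC hD hE hE0 hg hg'c hg0 hg'0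
  rw [← hκ] at hσ
  have hT := hb.unit
  set P := γ s₀ with hP
  set T := deriv γ s₀ with hTdef
  -- `tu` and `tv` are the cosine and sine of the angle between `γ'(s)` and the tangent at `s₀`. The
  -- sine is the differentiable function `g'/√(1 + g'²)` of the tangential coordinate, and near `s₀`
  -- the cosine is `√(1 - tv²)`, so both are differentiable there.
  set tu : ℝ → ℝ := fun s => deriv γ s 0 * T 0 + deriv γ s 1 * T 1 with htu
  set tv : ℝ → ℝ := fun s => deriv γ s 1 * T 0 - deriv γ s 0 * T 1 with htv
  have hnear : ∀ᶠ s in 𝓝 s₀, s ∈ Ioo (-β) β := isOpen_Ioo.mem_nhds hs'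
  have hdu : ∀ s ∈ Ioo (-β) β, HasDerivAt (fun s => frameFst P T (γ s)) (tu s) s := fun s hs => by
    obtain ⟨h0, h1⟩ := Plane.hasDerivAt_iff.1 (hγ.hasDerivAt hs)
    exact ((h0.sub_const _).mul_const _).add ((h1.sub_const _).mul_const _)
  have hdv : ∀ s ∈ Ioo (-β) β, HasDerivAt (fun s => frameSnd P T (γ s)) (tv s) s := fun s hs => by
    obtain ⟨h0, h1⟩ := Plane.hasDerivAt_iff.1 (hγ.hasDerivAt hs)
    exact ((h1.sub_const _).mul_const _).sub ((h0.sub_const _).mul_const _)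
  have hu0 : frameFst P T (γ s₀) = 0 := by simp [frameFst, hP]
  have htu0 : tu s₀ = 1 := by simp only [htu]; linear_combination hT
  have htv0 : tv s₀ = 0 := by simp only [htv]; ring
  have hsq : ∀ s ∈ Ioo (-β) β, tu s ^ 2 + tv s ^ 2 = 1 := fun s hs => by
    have := hγ.deriv_sq hs
    simp only [htu, htv]
    linear_combination (T 0 ^ 2 + T 1 ^ 2) * this + hT
  have htuc : ContinuousAt tu s₀ := by
    have h1 := hγ.continuousAt_deriv hs'
    fun_prop
  have htupos : ∀ᶠ s in 𝓝 s₀, 0 < tu s :=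
    htuc.eventually_const_lt (by rw [htu0]; exact one_pos)
  have hrel : ∀ᶠ s in 𝓝 s₀, tv s = g' (frameFst P T (γ s)) * tu s := by
    filter_upwards [hgr.eventually_nhds, hnear] with s h1 h2
    have h3 := (hg (frameFst P T (γ s))).comp s (hdu s h2)
    exact (hdv s h2).unique (h3.congr_of_eventuallyEq h1)
  have htvσ : ∀ᶠ s in 𝓝 s₀, tv s = g' (frameFst P T (γ s)) /
      √(1 + g' (frameFst P T (γ s)) ^ 2) := by
    filter_upwards [hrel, htupos, hnear] with s h1 h2 h3
    have h4 := hsq s h3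
    set k := g' (frameFst P T (γ s))
    have h5 : √(1 + k ^ 2) = 1 / tu s := by
      rw [Real.sqrt_eq_iff_mul_self_eq (by positivity) (by positivity)]
      rw [h1] at h4
      field_simp
      linarith
    rw [h5, h1]
    field_simp
  have hdtv : HasDerivAt tv κ s₀ := by
    rw [← hu0] at hσ
    have h1 := hσ.comp s₀ (hdu s₀ hs')
    rw [htu0, mul_one] at h1
    exact h1.congr_of_eventuallyEq htvσ
  have hdtu : HasDerivAt tu 0 s₀ := by
    have h1 := ((hdtv.fun_pow 2).const_sub 1).sqrt (by rw [htv0]; norm_num)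
    rw [htv0] at h1
    refine (h1.congr_of_eventuallyEq ?_).congr_deriv (by simp)
    filter_upwards [htupos, hnear] with s h2 h3
    rw [← hsq s h3, add_sub_cancel_right, Real.sqrt_sq h2.le]
  constructor
  · have h1 := (hdtu.mul_const (T 0)).sub (hdtv.mul_const (T 1))
    refine (h1.congr_of_eventuallyEq (Eventually.of_forall fun s => ?_)).congr_deriv (by ring)
    simp only [htu, htv, Pi.sub_apply]
    linear_combination -deriv γ s 0 * hT
  · have h1 := (hdtu.mul_const (T 1)).add (hdtv.mul_const (T 0))
    refine (h1.congr_of_eventuallyEq (Eventually.of_forall fun s => ?_)).congr_deriv (by ring)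
    simp only [htu, htv, Pi.add_apply]
    linear_combination -deriv γ s 1 * hT

end IsGeneratingCurve

/-! ### A priori bounds along the curve. -/

namespace IsGeneratingCurve

variable {A : Set Plane} {β : ℝ} {γ : ℝ → Plane}

theorem continuousOn_coord (hγ : IsGeneratingCurve A β γ) (i : Fin 2) :
    ContinuousOn (fun s => γ s i) (Icc (-β) β) :=
  (by fun_prop : Continuous fun q : Plane => q i).comp_continuousOn hγ.continuousOn

/-- The derivative of `‖γ‖²` is twice `γ · γ'`. -/
theorem norm_sq_le (hγ : IsGeneratingCurve A β γ)
    (hd : ∀ s ∈ Ioo 0 β, inner ℝ (γ s) (deriv γ s) ≤ 0) {s : ℝ} (hs : s ∈ Ioo 0 β) :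
    ‖γ s‖ ^ 2 ≤ ‖γ 0‖ ^ 2 := by
  have hβ := hγ.pos
  have hder : ∀ t ∈ Ioo 0 s, HasDerivAt (fun t => ‖γ t‖ ^ 2) (2 * inner ℝ (γ t) (deriv γ t)) t :=
    fun t ht => (hγ.hasDerivAt ⟨by linarith [ht.1], ht.2.trans hs.2⟩).norm_sq
  have hanti : AntitoneOn (fun t => ‖γ t‖ ^ 2) (Icc 0 s) := by
    refine antitoneOn_of_deriv_nonpos (convex_Icc 0 s) ?_ ?_ ?_
    · refine (hγ.continuousOn.mono fun t ht => ⟨by linarith [ht.1], ?_⟩).norm.pow 2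
      exact ht.2.trans hs.2.le
    · rw [interior_Icc]
      exact fun t ht => (hder t ht).differentiableAt.differentiableWithinAt
    · rw [interior_Icc]
      intro t ht
      rw [(hder t ht).deriv]
      linarith [hd t ⟨ht.1, ht.2.trans hs.2⟩]
  exact hanti ⟨le_rfl, hs.1.le⟩ ⟨hs.1.le, le_rfl⟩ hs.1.le

/-- At unit speed the height falls at rate at most `1`, and it is zero at `β`. -/
theorem height_le (hγ : IsGeneratingCurve A β γ) {s : ℝ} (hs : s ∈ Ioo 0 β) :
    γ s 1 ≤ β - s := by
  have hder : ∀ t ∈ Ioo s β, HasDerivAt (fun t => γ t 1 + t) (deriv γ t 1 + 1) t := fun t ht =>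
    (Plane.hasDerivAt_iff.1
      (hγ.hasDerivAt ⟨by linarith [hs.1, ht.1, hγ.pos], ht.2⟩)).2.add (hasDerivAt_id t)
  have hmono : MonotoneOn (fun t => γ t 1 + t) (Icc s β) := by
    refine monotoneOn_of_deriv_nonneg (convex_Icc s β) ?_ ?_ ?_
    · exact ((hγ.continuousOn_coord 1).mono
        (Icc_subset_Icc_left (by linarith [hs.1, hγ.pos]))).add continuousOn_id
    · rw [interior_Icc]
      exact fun t ht => (hder t ht).differentiableAt.differentiableWithinAt
    · rw [interior_Icc]
      intro t ht
      rw [(hder t ht).deriv]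
      have := hγ.deriv_sq (s := t) ⟨by linarith [hs.1, ht.1, hγ.pos], ht.2⟩
      nlinarith [sq_nonneg (deriv γ t 0), sq_nonneg (deriv γ t 1 + 1)]
  have := hmono ⟨le_rfl, hs.2.le⟩ ⟨hs.2.le, le_rfl⟩ hs.2.le
  simp only [hγ.end_axis] at this
  linarith

end IsGeneratingCurve

theorem mainTheorem4 (n : ℕ) [NeZero n] (hn : 3 ≤ n) (p : ℝ) (hp : 0 < p)
    (E : Set (EuclideanSpace ℝ (Fin n))) (hopen : IsOpen E)
    (hiso : IsIsoperimetric n p E) (hsym : IsSphericallySymmetric n E)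
    (β : ℝ) (γ : ℝ → Plane) (hγ : IsGeneratingCurve (planarSection n E) β γ)
    (hγ0 : γ 0 = !₂[1, 0]) :
    (∀ F₀ : ℝ, IsInitialCenter γ F₀ → 1 / 2 < F₀ →
      0 < γ β 0 ∧
      (∃ v : Plane, Tendsto (deriv γ) (𝓝[<] β) (𝓝 v) ∧
        0 ≤ v 0 ∧ v 1 ≤ 0 ∧ v ≠ !₂[0, -1]) ∧
      ∃ ε > 0, ∀ s ∈ Ioo (β - ε) β, 0 < inner ℝ (γ s) (deriv γ s)) ∧
    ∀ s ∈ Ioo 0 β, inner ℝ (γ s) (deriv γ s) ≤ 0 := by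
  obtain ⟨m, rfl⟩ : ∃ m, n = m + 2 := ⟨n - 2, by omega⟩
  have hm : 1 ≤ m := by omega
  have hβ := hγ.pos
  set A := planarSection (m + 2) E with hAdef
  have hA : IsOpen A := isOpen_planarSection hopen
  have hx0 : γ 0 0 = 1 := by rw [hγ0]; rfl
  have hEA : E = meridian ⁻¹' A := by
    ext x
    exact hsym.meridian_mem_iff.symm
  -- The bound is assumed only on the frontier; finite volume extends it to the region.
  have hx : ∀ q ∈ A, q 0 ≤ γ 0 0 := by
    rw [hx0]
    refine hsym.planarSection_le hp hiso.volume_ne_top fun q hq => ?_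
    rw [← hx0]
    exact hγ.rightmost q hq
  have hd : ∀ s ∈ Ioo 0 β, inner ℝ (γ s) (deriv γ s) ≤ 0 := fun s hs =>
    hγ.inner_deriv_nonpos hA hx (fun q hq q' h1 h0 => hsym.planarSection_mem hq h1 h0) hs
  refine ⟨fun F₀ hF hF₀ => ?_, hd⟩
  -- By the Euler–Lagrange equation and the tangent restriction `hd`, `F₀ > 1 / 2` is impossible:
  -- the curve could not return to the axis.
  exfalso
  have hne : E.Nonempty := by
    have h1 := hγ.mem_frontier 0 ⟨by linarith, hβ.le⟩
    obtain ⟨q, hq⟩ := closure_nonempty_iff.1 ⟨_, h1.1⟩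
    exact ⟨_, hq⟩
  have hE0 : weightedVolume (m + 2) p E ≠ 0 := weightedVolume_pos hopen hne
  -- The values of `C` and `D` are immaterial: they enter the curvature equation only through the
  -- constant `lagrangeMultiplier`.
  obtain ⟨C, hC0, hC⟩ := exists_isCylinderConstant hp hA hEA hγ (hiso.perimeter_ne_top hp hE0)
  obtain ⟨D, hD⟩ := lintegral_comp_meridian m
  rw [hEA] at hiso hE0
  have hIoo : ∀ s ∈ Ioo 0 β, s ∈ Ioo (-β) β := fun s hs => ⟨by linarith [hs.1], hs.2⟩
  have h0β : (0 : ℝ) ∈ Ioo (-β) β := ⟨by linarith, hβ⟩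
  have hode := fun s hs => hγ.hasDerivAt_deriv hp hA hx hC0 hC hD hiso hE0 (s₀ := s) hs rfl
  obtain ⟨c, hc, hcF⟩ := exists_between hF₀
  have hγc := (hγ.hasDerivAt h0β).continuousAt
  have hγ'c := hγ.continuousAt_deriv h0β
  obtain ⟨hT0, hT1⟩ := hγ.deriv_zero
  have hlim : ∀ {g : ℝ → Plane} (i : Fin 2), ContinuousAt g 0 →
      Tendsto (fun s => g s i) (𝓝[>] 0) (𝓝 (g 0 i)) := fun i hg =>
    (((by fun_prop : Continuous fun q : Plane => q i).continuousAt.comp hg).tendsto).mono_left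
      nhdsWithin_le_nhds
  refine not_returning_of_initial_center hm hp hβ (x := fun s => γ s 0) (y := fun s => γ s 1)
    (a := fun s => deriv γ s 0) (b := fun s => deriv γ s 1)
    (fun s hs => (Plane.hasDerivAt_iff.1 (hγ.hasDerivAt (hIoo s hs))).1)
    (fun s hs => (Plane.hasDerivAt_iff.1 (hγ.hasDerivAt (hIoo s hs))).2)
    (fun s hs => (hode s hs).1) (fun s hs => (hode s hs).2)
    (fun s hs => hγ.deriv_sq (hIoo s hs)) hγ.above (fun s hs => ?_)
    (fun s hs => hγ.height_le hs) (fun s hs => ?_) ?_ ?_ ?_ ?_ hc ?_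
  · have := hγ.norm_sq_le hd hs
    rw [Plane.norm_sq, Plane.norm_sq, hx0, hγ.start_axis] at this
    simpa using this
  · rw [← Plane.inner_eq]
    exact hd s hs
  · rw [← hx0]; exact hlim 0 hγc
  · have := hlim 1 hγc
    rwa [hγ.start_axis] at this
  · have := hlim 0 hγ'c
    rwa [hT0] at this
  · have := hlim 1 hγ'c
    rwa [hT1] at this
  · have h1 : 𝓝[>] (0 : ℝ) ≤ 𝓝[≠] 0 := nhdsWithin_mono _ fun x hx => ne_of_gt hx
    filter_upwards [h1 hF.1, h1 (hF.2.eventually_const_lt hcF)] with s h2 h3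
    refine ⟨h2, ?_⟩
    rw [← Plane.inner_eq]
    exact h3
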